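/- Let $n\ge 1$, $\Lambda=\{(i,\alpha)\in\mathbb N\times\mathbb N^n : i+|\alpha|\le 2,\ i<2\}$ and $N=\#\Lambda$. Let $F(t,x,z)$, with $z=\{z_{i,\alpha}\}_{(i,\alpha)\in\Lambda}$, be a holomorphic function on an open neighborhood $\Delta$ of the origin of $\mathbb C_t\times\mathbb C_x^n\times\mathbb C_z^N$ such that, whenever $(0,x,0)\in\Delta$, we have $F(0,x,0)=0$ and $(\partial F/\partial z_{i,\alpha})(0,x,0)=0$ for all $(i,\alpha)\in\Lambda$ with $|\alpha|>0$. Consider the equation $$\Bigl(t\frac{\partial}{\partial t}\Bigr)^2u=F\Bigl(t,x,\Bigl\{\Bigl(t\frac{\partial}{\partial t}\Bigr)^i\Bigl(\frac{\partial}{\partial x}\Bigr)^\alpha u\Bigr\}_{(i,\alpha)\in\Lambda}\Bigr),\qquad(\ast)$$ and suppose that both roots $\lambda$ of $\lambda^2-\sum_{i<2}(\partial F/\partial z_{i,0})(0,0,0)\,\lambda^i=0$ satisfy $\operatorname{Re}\lambda<0$. Let $I\subset\mathbb R$ be a nonempty open interval. Let $S_I$ be the set of all points $t$ of the universal covering space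 of $\mathbb C\setminus\{0\}$ with $\arg t\in I$, and for $r,R>0$ put $S_I(r)=\{t\in S_I : 0<|t|<r\}$ and $D_R=\{x\in\mathbb C^n : \max_j|x_j|<R\}$. Let $u(t,x)$ be a holomorphic solution of $(\ast)$ on $S_I(r_0)\times D_{R_0}$ for some $r_0,R_0>0$, and suppose that for some $0<R\le R_0$ $$\sup_{x\in D_R}|u(t,x)|=o(1)\qquad(S_I\ni t\to 0).$$ Then $u(t,x)=u_0(t,x)$ on $S_I(\sigma)\times D_\delta$ for some $\sigma>0$ and $\delta>0$, where $u_0(t,x)$ is the (existing, and as a germ at $(0,0)$ unique) holomorphic solution of $(\ast)$ in a neighborhood of $(0,0)\in\mathbb C_t\times\mathbb C_x^n$ with $u_0(0,x)\equiv 0$. -/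

import Mathlib

open Filter Topology

/-- The index set `Λ = {(i, α) ∈ ℕ × ℕⁿ ; i + |α| ≤ 2, i < 2}`.  The bounds `i < 2` and
`α j < 3` built into the types lose nothing, and make `Λ` a finite type. -/
abbrev Idx (n : ℕ) : Type :=
  {p : Fin 2 × (Fin n → Fin 3) // (p.1 : ℕ) + ∑ j, (p.2 j : ℕ) ≤ 2}

/-- The index `(i, 0)`, for `i < 2`. -/
def Idx.zero {n : ℕ} (i : Fin 2) : Idx n :=
  ⟨(i, fun _ => 0), by simp⟩

/-- The partial derivative `∂g/∂x_j` of a function of `x ∈ ℂⁿ`. -/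
noncomputable def partialX {n : ℕ} (j : Fin n) (g : (Fin n → ℂ) → ℂ) : (Fin n → ℂ) → ℂ :=
  fun x => deriv (fun s => g (Function.update x j s)) (x j)

/-- `(∂/∂x)^α = (∂/∂x_1)^{α_1} ⋯ (∂/∂x_n)^{α_n}`. -/
noncomputable def multiPartialX {n : ℕ} (α : Fin n → ℕ) (g : (Fin n → ℂ) → ℂ) :
    (Fin n → ℂ) → ℂ :=
  (List.finRange n).foldr (fun j h => (partialX j)^[α j] h) g

/-- The operator `t ∂/∂t` on functions of `(t, x) ∈ ℂ × ℂⁿ`. -/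
noncomputable def eulerT {n : ℕ} (v : ℂ → (Fin n → ℂ) → ℂ) : ℂ → (Fin n → ℂ) → ℂ :=
  fun t x => t * deriv (fun s => v s x) t

/-- The operator `t ∂/∂t` on functions on `𝓡(ℂ ∖ {0}) × ℂⁿ`.  The universal covering space of
`ℂ ∖ {0}` is `ℂ`, with the covering map `τ ↦ t = exp τ` (so `τ = log t = log |t| + i arg t`);
in the coordinate `τ` the vector field `t ∂/∂t` is `∂/∂τ`. -/
noncomputable def eulerLog {n : ℕ} (u : ℂ → (Fin n → ℂ) → ℂ) : ℂ → (Fin n → ℂ) → ℂ :=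
  fun τ x => deriv (fun s => u s x) τ

/-- The family `{ϑ^i (∂/∂x)^α u}_{(i, α) ∈ Λ}`, where `ϑ` stands for `t ∂/∂t`
(`eulerT` or `eulerLog`). -/
noncomputable def jet {n : ℕ}
    (ϑ : (ℂ → (Fin n → ℂ) → ℂ) → (ℂ → (Fin n → ℂ) → ℂ))
    (u : ℂ → (Fin n → ℂ) → ℂ) (t : ℂ) (x : Fin n → ℂ) : Idx n → ℂ :=
  fun p => (ϑ^[(p.1.1 : ℕ)] (fun s => multiPartialX (fun j => (p.1.2 j : ℕ)) (u s))) t x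

/-- The partial derivative `(∂F/∂z_p)(t, x, z)`. -/
noncomputable def partialZ {n : ℕ} (F : ℂ × (Fin n → ℂ) × (Idx n → ℂ) → ℂ) (p : Idx n)
    (t : ℂ) (x : Fin n → ℂ) (z : Idx n → ℂ) : ℂ :=
  deriv (fun s => F (t, x, Function.update z p s)) (z p)

/-- `F(t, x, z)` is holomorphic in the open neighborhood `Ω` of the origin,
`F(0, x, 0) ≡ 0`, and `(∂F/∂z_{i,α})(0, x, 0) ≡ 0` if `|α| > 0`. -/
structure IsFuchsian {n : ℕ} (Ω : Set (ℂ × (Fin n → ℂ) × (Idx n → ℂ)))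
    (F : ℂ × (Fin n → ℂ) × (Idx n → ℂ) → ℂ) : Prop where
  isOpen : IsOpen Ω
  zero_mem : (0, 0, 0) ∈ Ω
  holomorphic : AnalyticOnNhd ℂ F Ω
  apply_zero : ∀ x, (0, x, 0) ∈ Ω → F (0, x, 0) = 0
  partialZ_zero : ∀ p : Idx n, 0 < ∑ j, (p.1.2 j : ℕ) →
    ∀ x, (0, x, 0) ∈ Ω → partialZ F p 0 x 0 = 0

/-- `l` is a characteristic exponent at `x`: a root of
`l² - ∑_{i<2} (∂F/∂z_{i,0})(0, x, 0) lⁱ = 0`. -/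
def IsCharExponent {n : ℕ} (F : ℂ × (Fin n → ℂ) × (Idx n → ℂ) → ℂ) (x : Fin n → ℂ)
    (l : ℂ) : Prop :=
  l ^ 2 - ∑ i : Fin 2, partialZ F (Idx.zero i) 0 x 0 * l ^ (i : ℕ) = 0

/-- The sector `S_I = {t ∈ 𝓡(ℂ ∖ {0}) ; arg t ∈ I}`, in the coordinate `τ = log t`. -/
def sector (I : Set ℝ) : Set ℂ := {τ | τ.im ∈ I}

/-- The bounded sector `S_I(r) = {t ∈ S_I ; 0 < |t| < r}`, in the coordinate `τ = log t`. -/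
def sectorBelow (I : Set ℝ) (r : ℝ) : Set ℂ := {τ ∈ sector I | ‖Complex.exp τ‖ < r}

/-- The polydisc `D_R = {x ∈ ℂⁿ ; max_j |x_j| < R}`. -/
def polydisc (n : ℕ) (R : ℝ) : Set (Fin n → ℂ) := {x | ‖x‖ < R}

/-- `u` is a holomorphic solution of
`(t ∂/∂t)² u = F(t, x, {(t ∂/∂t)^i (∂/∂x)^α u}_{(i, α) ∈ Λ})` on `S_I(r) × D_R`. -/
structure IsSectorSolution {n : ℕ} (Ω : Set (ℂ × (Fin n → ℂ) × (Idx n → ℂ)))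
    (F : ℂ × (Fin n → ℂ) × (Idx n → ℂ) → ℂ) (I : Set ℝ) (r R : ℝ)
    (u : ℂ → (Fin n → ℂ) → ℂ) : Prop where
  holomorphic : AnalyticOnNhd ℂ (Function.uncurry u) (sectorBelow I r ×ˢ polydisc n R)
  mem : ∀ τ ∈ sectorBelow I r, ∀ x ∈ polydisc n R,
    (Complex.exp τ, x, jet eulerLog u τ x) ∈ Ω
  eq : ∀ τ ∈ sectorBelow I r, ∀ x ∈ polydisc n R,
    (eulerLog^[2] u) τ x = F (Complex.exp τ, x, jet eulerLog u τ x)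

/-- `v` is a holomorphic solution of the same equation in a neighborhood of
`(0, 0) ∈ ℂ × ℂⁿ`, with `v(0, x) ≡ 0`. -/
def IsLocalSolution {n : ℕ} (Ω : Set (ℂ × (Fin n → ℂ) × (Idx n → ℂ)))
    (F : ℂ × (Fin n → ℂ) × (Idx n → ℂ) → ℂ) (v : ℂ → (Fin n → ℂ) → ℂ) : Prop :=
  ∃ W : Set (ℂ × (Fin n → ℂ)), IsOpen W ∧ (0, 0) ∈ W ∧
    AnalyticOnNhd ℂ (Function.uncurry v) W ∧
    (∀ t x, (t, x) ∈ W → (t, x, jet eulerT v t x) ∈ Ω ∧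
      (eulerT^[2] v) t x = F (t, x, jet eulerT v t x)) ∧
    ∀ x, (0, x) ∈ W → v 0 x = 0

/-! Put t = e^τ, so that t∂/∂t becomes θ = ∂/∂τ, and split off the linear part of F at the origin.
The equation becomes (θ - l₁)(θ - l₂)u = H(t, x, jet of u), where l₁, l₂ are the characteristic
exponents and H is `reducedF F`. The hypotheses on F give H(t, x, 0) = O(|t|) and a Lipschitz bound
in z with constant O(|t| + |z|), plus a term O(|x|) that sees only the slots without x-derivatives
(`IsFuchsian.exists_lipschitz`).

On a ray arg t = φ, with s = log|t|, the homogeneous solutions exp(l s) blow up as s → -∞ because Re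
l < 0. Hence a bounded solution is controlled by its forcing term alone, through comparison with
supersolutions (`norm_le_of_supersolution`).

The loss of x-derivatives is absorbed on the cone c|t| < d⁴, d = R - |x|, with weight w = 1 -
c|t|/d⁴. By Cauchy's estimate an x-derivative costs a factor 1/(d w), and inverting one factor θ -
lᵢ gives back one power of w. A forcing of size |t| w⁻³ thus produces u of size |t| w⁻¹, θu of size
|t| w⁻² and a jet of size |t| d⁻² w⁻³. The Lipschitz factor O(|t| d⁻²) turns this into |t| d⁻⁴ ≤ 1/c
times the original size, so the nonlinear part contracts once c is large and R is small
(`HasReducedBounds.norm_sub_le_of_cone`).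

This contraction serves twice: it gives the holomorphic solution u₀ by successive approximation
(`IsFuchsian.exists_isLocalSolution`), and it shows that two solutions on a ray whose jets are
O(|t|) agree (`IsRaySolution.eq_of_norm_spatialJet_le`). What remains is to pass from o(1) to
O(|t|). Cauchy's estimate in τ makes θu small too, and since H is essentially quadratic, a bound m
on u and θu improves on a smaller polydisc to O(|t|) + O(m²); repeating this on polydiscs shrinking
geometrically gives O(|t|) (`IsRaySolution.exists_bound`). Agreement on one ray spreads over the
sector by the identity theorem, and the sector ℝ gives uniqueness of the germ u₀. -/

/-! ### Complex differentiability implies analyticity in several variables. -/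

section Osgood

open Metric MeasureTheory

variable {E : Type} [NormedAddCommGroup E] [NormedSpace ℂ E]

/-- Cauchy's estimate along a complex line. -/
theorem norm_fderiv_apply_le_of_ball {F : Type} [NormedAddCommGroup F] [NormedSpace ℂ F]
    {f : E → F} {z : E} {r M : ℝ} (hr : 0 < r)
    (hf : ∀ y ∈ closedBall z r, DifferentiableAt ℂ f y) (hM : ∀ y ∈ closedBall z r, ‖f y‖ ≤ M)
    (v : E) : ‖fderiv ℂ f z v‖ ≤ M / r * ‖v‖ := by
  rcases eq_or_ne v 0 with rfl | hv
  · simp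
  have hv' : 0 < ‖v‖ := norm_pos_iff.2 hv
  have hmem : ∀ w ∈ closedBall (0 : ℂ) (r / ‖v‖), z + w • v ∈ closedBall z r := by
    intro w hw
    rw [mem_closedBall_zero_iff, le_div_iff₀ hv'] at hw
    simpa [dist_eq_norm, norm_smul] using hw
  have hline : ∀ w : ℂ, HasDerivAt (fun w : ℂ => z + w • v) v w := fun w => by
    simpa using ((hasDerivAt_id w).smul_const v).const_add z
  have hd : ∀ w ∈ closedBall (0 : ℂ) (r / ‖v‖),
      DifferentiableAt ℂ (fun w : ℂ => f (z + w • v)) w := fun w hw =>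
    DifferentiableAt.comp w (hf _ (hmem w hw)) (hline w).differentiableAt
  have h0 : HasDerivAt (fun w : ℂ => f (z + w • v)) (fderiv ℂ f z v) 0 := by
    have h1 : HasFDerivAt f (fderiv ℂ f z) (z + (0 : ℂ) • v) := by
      simpa using (hf z (mem_closedBall_self hr.le)).hasFDerivAt
    exact h1.comp_hasDerivAt 0 (hline 0)
  have := Complex.norm_deriv_le_of_forall_mem_sphere_norm_le (c := 0) (R := r / ‖v‖) (C := M)
    (f := fun w : ℂ => f (z + w • v)) (div_pos hr hv')
    (DifferentiableOn.diffContOnCl fun w hw => (hd w (closure_ball_subset_closedBall hw)).differentiableWithinAt)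
    (fun w hw => hM _ (hmem w (sphere_subset_closedBall hw)))
  rw [h0.deriv] at this
  calc _ ≤ _ := this
    _ = _ := by field_simp

theorem norm_fderiv_le_of_ball {F : Type} [NormedAddCommGroup F] [NormedSpace ℂ F]
    {f : E → F} {z : E} {r M : ℝ} (hr : 0 < r)
    (hf : ∀ y ∈ closedBall z r, DifferentiableAt ℂ f y) (hM : ∀ y ∈ closedBall z r, ‖f y‖ ≤ M) :
    ‖fderiv ℂ f z‖ ≤ M / r :=
  ContinuousLinearMap.opNorm_le_bound _
    (div_nonneg ((norm_nonneg _).trans (hM z (mem_closedBall_self hr.le))) hr.le)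
    (norm_fderiv_apply_le_of_ball hr hf hM)

variable [FiniteDimensional ℂ E]

/-- Along the complex line through y in the direction v, Cauchy's formula writes the derivative of f
as a circle integral of f itself. That integral can be differentiated in y under the integral sign,
the derivative of the integrand being bounded by Cauchy's estimate. -/
theorem differentiableOn_fderiv_of_isOpen {F : Type} [NormedAddCommGroup F] [NormedSpace ℂ F]
    [FiniteDimensional ℂ F] {f : E → F} {U : Set E} (hU : IsOpen U)
    (hf : DifferentiableOn ℂ f U) : DifferentiableOn ℂ (fderiv ℂ f) U := by
  have : CompleteSpace F := FiniteDimensional.complete ℂ F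
  have : CompleteSpace E := FiniteDimensional.complete ℂ E
  have : ProperSpace E := FiniteDimensional.proper ℂ E
  have : ProperSpace F := FiniteDimensional.proper ℂ F
  have : ProperSpace (E →L[ℂ] F) := FiniteDimensional.proper ℂ _
  have hda : ∀ y ∈ U, DifferentiableAt ℂ f y := fun y hy => hf.differentiableAt (hU.mem_nhds hy)
  suffices H : ∀ v : E, ∀ z ∈ U, DifferentiableAt ℂ (fun y => fderiv ℂ f y v) z by
    intro z hz
    refine DifferentiableAt.differentiableWithinAt ?_
    -- A linear map is identified with its values on a basis, so one direction v at a time suffices.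
    let b := Module.finBasis ℂ E
    let e := (LinearMap.toContinuousLinearMap (𝕜 := ℂ) (E := E) (F' := F)).symm.trans
      (b.constr ℂ (M' := F)).symm
    let e' := e.toContinuousLinearEquiv
    have : DifferentiableAt ℂ (fun y => e' (fderiv ℂ f y)) z := by
      rw [differentiableAt_pi]
      intro i
      exact H (b i) z hz
    exact (e'.symm.differentiableAt.comp z this).congr_of_eventuallyEq
      (.of_forall fun y => (e'.symm_apply_apply _).symm)
  intro v z hz
  obtain ⟨R, hR, hRU⟩ := nhds_basis_closedBall.mem_iff.1 (hU.mem_nhds hz)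
  obtain ⟨M, hM⟩ := (isCompact_closedBall z R).exists_bound_of_continuousOn
    (hf.continuousOn.mono hRU)
  -- The circle moves y by at most R/3, so the integrand is evaluated within 2R/3 of z and a margin
  -- R/3 is left for Cauchy's estimate.
  set ρ : ℝ := R / 3 / (‖v‖ + 1) with hρ
  have hρ0 : 0 < ρ := by positivity
  have hρv : ρ * ‖v‖ ≤ R / 3 := by
    rw [hρ, div_mul_eq_mul_div, div_le_iff₀ (by positivity)]
    nlinarith [norm_nonneg v]
  have hmem : ∀ y ∈ ball z (R / 3), ∀ w ∈ closedBall (0 : ℂ) ρ,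
      y + w • v ∈ closedBall z (2 * R / 3) := by
    intro y hy w hw
    rw [mem_closedBall_zero_iff] at hw
    rw [mem_ball, dist_eq_norm] at hy
    rw [mem_closedBall, dist_eq_norm]
    calc ‖y + w • v - z‖ = ‖(y - z) + w • v‖ := by congr 1; abel
      _ ≤ ‖y - z‖ + ‖w‖ * ‖v‖ := (norm_add_le _ _).trans (by rw [norm_smul])
      _ ≤ R / 3 + ρ * ‖v‖ := by gcongr
      _ ≤ _ := by linarith
  have hmemU : ∀ y ∈ ball z (R / 3), ∀ w ∈ closedBall (0 : ℂ) ρ, y + w • v ∈ U :=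
    fun y hy w hw => hRU (closedBall_subset_closedBall (by linarith) (hmem y hy w hw))
  have hline : ∀ (y : E) (w : ℂ), HasDerivAt (fun w : ℂ => y + w • v) v w := fun y w => by
    simpa using ((hasDerivAt_id w).smul_const v).const_add y
  have hrep : ∀ y ∈ ball z (R / 3), fderiv ℂ f y v = (2 * ↑Real.pi * Complex.I : ℂ)⁻¹ •
      ∮ w in C(0, ρ), ((w - 0) ^ 2)⁻¹ • f (y + w • v) := by
    intro y hy
    have hVo : IsOpen ((fun w : ℂ => y + w • v) ⁻¹' U) :=
      hU.preimage (by fun_prop)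
    rw [Complex.two_pi_I_inv_smul_circleIntegral_sub_sq_inv_smul_of_differentiable hVo
      (fun w hw => hmemU y hy w hw) (fun w hw => ?_) (mem_ball_self hρ0)]
    · have h1 : HasFDerivAt f (fderiv ℂ f y) (y + (0 : ℂ) • v) := by
        have := (hda _ (hmemU y hy 0 (mem_closedBall_self hρ0.le))).hasFDerivAt
        simpa using this
      exact (h1.comp_hasDerivAt 0 (hline y 0)).deriv.symm
    · exact (DifferentiableAt.comp w (hda _ hw) (hline y w).differentiableAt).differentiableWithinAt
  have hball : ball z (R / 3) ∈ 𝓝 z := ball_mem_nhds z (by positivity)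
  suffices DifferentiableAt ℂ (fun y => (2 * ↑Real.pi * Complex.I : ℂ)⁻¹ •
      ∮ w in C(0, ρ), ((w - 0) ^ 2)⁻¹ • f (y + w • v)) z from
    this.congr_of_eventuallyEq (by filter_upwards [hball] with y hy using hrep y hy)
  refine DifferentiableAt.const_smul ?_ _
  have hcm : ∀ θ : ℝ, circleMap 0 ρ θ ∈ closedBall (0 : ℂ) ρ := fun θ =>
    circleMap_mem_closedBall 0 hρ0.le θ
  have hc0 : ∀ θ : ℝ, circleMap 0 ρ θ ≠ 0 := fun θ => circleMap_ne_center hρ0.ne'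
  have hker : Continuous fun θ : ℝ => ((circleMap 0 ρ θ - 0) ^ 2)⁻¹ :=
    Continuous.inv₀ (by fun_prop) (fun θ => by simpa using hc0 θ)
  have hder : Continuous fun θ : ℝ => deriv (circleMap 0 ρ) θ := by
    simp only [deriv_circleMap]; fun_prop
  refine (intervalIntegral.hasFDerivAt_integral_of_dominated_of_fderiv_le
    (F' := fun y θ => deriv (circleMap 0 ρ) θ • ((circleMap 0 ρ θ - 0) ^ 2)⁻¹ •
      fderiv ℂ f (y + circleMap 0 ρ θ • v))
    (bound := fun θ => ‖deriv (circleMap 0 ρ) θ‖ * (‖((circleMap 0 ρ θ - 0) ^ 2)⁻¹‖ * (M / (R / 3))))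
    hball ?_ ?_ ?_ ?_ ?_ ?_).differentiableAt
  · filter_upwards [hball] with y hy
    have : Continuous fun θ : ℝ => f (y + circleMap 0 ρ θ • v) :=
      hf.continuousOn.comp_continuous (by fun_prop) (fun θ => hmemU y hy _ (hcm θ))
    exact (hder.smul (hker.smul this)).aestronglyMeasurable
  · have : Continuous fun θ : ℝ => f (z + circleMap 0 ρ θ • v) :=
      hf.continuousOn.comp_continuous (by fun_prop)
        (fun θ => hmemU z (mem_ball_self (by positivity)) _ (hcm θ))
    exact (hder.smul (hker.smul this)).intervalIntegrable _ _
  -- Continuity of `fderiv` is not available yet; measurability holds without it.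
  · borelize E
    borelize (E →L[ℂ] F)
    have h1 : Measurable fun θ : ℝ => fderiv ℂ f (z + circleMap 0 ρ θ • v) :=
      (measurable_fderiv ℂ f).comp (by fun_prop : Continuous fun θ : ℝ => z + circleMap 0 ρ θ • v).measurable
    exact (hder.measurable.smul (hker.measurable.smul h1)).aestronglyMeasurable
  · refine ae_of_all _ fun θ _ y hy => ?_
    rw [norm_smul, norm_smul]
    gcongr
    refine norm_fderiv_le_of_ball (by positivity) (fun x hx => hda x (hRU ?_)) (fun x hx => hM x ?_)
    all_goals
      have := hmem y hy _ (hcm θ)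
      rw [mem_closedBall] at *
      linarith [dist_triangle x (y + circleMap 0 ρ θ • v) z]
  · exact (Continuous.mul hder.norm (hker.norm.mul continuous_const)).intervalIntegrable _ _
  · refine ae_of_all _ fun θ _ y hy => ?_
    refine HasFDerivAt.const_smul (HasFDerivAt.const_smul ?_ _) _
    exact (hasFDerivAt_comp_add_right _).2 (hda _ (hmemU y hy _ (hcm θ))).hasFDerivAt

theorem contDiffOn_infty_of_differentiableOn_isOpen {F : Type} [NormedAddCommGroup F]
    [NormedSpace ℂ F] [FiniteDimensional ℂ F] {f : E → F} {U : Set E} (hU : IsOpen U)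
    (hf : DifferentiableOn ℂ f U) (k : ℕ) : ContDiffOn ℂ k f U := by
  induction k generalizing F with
  | zero => exact contDiffOn_zero.2 hf.continuousOn
  | succ k ih =>
    have := ih (differentiableOn_fderiv_of_isOpen hU hf)
    push_cast
    rw [contDiffOn_succ_iff_fderiv_of_isOpen hU]
    exact ⟨hf, by simp, this⟩

/-- Each derivative uses up a width ε of the ball and costs a factor 1/ε. There is no factorial in
the bound, but choosing ε of order R/k recovers it, by k^k/k! ≤ e^k. -/
theorem norm_iteratedFDeriv_le_of_ball {F : Type} [NormedAddCommGroup F] [NormedSpace ℂ F]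
    [FiniteDimensional ℂ F] {f : E → F} {z : E} {R M ε : ℝ} (hε : 0 < ε) (k : ℕ)
    (hk : k * ε < R) (hf : DifferentiableOn ℂ f (ball z R)) (hM : ∀ y ∈ ball z R, ‖f y‖ ≤ M) :
    ‖iteratedFDeriv ℂ k f z‖ ≤ M / ε ^ k := by
  induction k generalizing F R M with
  | zero => simpa using hM z (mem_ball_self (by simpa using hk))
  | succ k ih =>
    push_cast at hk
    rw [← norm_iteratedFDeriv_fderiv]
    have hsub : ∀ y ∈ ball z (R - ε), ∀ x ∈ closedBall y ε, x ∈ ball z R := by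
      intro y hy x hx
      rw [mem_ball] at *
      rw [mem_closedBall] at hx
      linarith [dist_triangle x y z]
    have := ih (f := fderiv ℂ f) (R := R - ε) (M := M / ε) (by linarith)
      ((differentiableOn_fderiv_of_isOpen isOpen_ball hf).mono (ball_subset_ball (by linarith)))
      (fun y hy => norm_fderiv_le_of_ball hε
        (fun x hx => hf.differentiableAt (isOpen_ball.mem_nhds (hsub y hy x hx)))
        (fun x hx => hM x (hsub y hy x hx)))
    calc _ ≤ _ := this
      _ = _ := by rw [pow_succ']; field_simp

/-- This lets the Taylor series in one complex variable along a line sum the power series in several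
variables. -/
theorem iteratedDeriv_line {F : Type} [NormedAddCommGroup F] [NormedSpace ℂ F]
    [FiniteDimensional ℂ F] {f : E → F} {U : Set E} (hU : IsOpen U)
    (hf : DifferentiableOn ℂ f U) (z h : E) (k : ℕ) :
    ∀ w : ℂ, z + w • h ∈ U → iteratedDeriv k (fun w : ℂ => f (z + w • h)) w =
      iteratedFDeriv ℂ k f (z + w • h) fun _ => h := by
  induction k with
  | zero => intro w _; simp
  | succ k ih =>
    intro w hw
    have hopen : IsOpen ((fun w : ℂ => z + w • h) ⁻¹' U) := hU.preimage (by fun_prop)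
    have hev : iteratedDeriv k (fun w : ℂ => f (z + w • h)) =ᶠ[𝓝 w]
        fun w => iteratedFDeriv ℂ k f (z + w • h) fun _ => h := by
      filter_upwards [hopen.mem_nhds hw] with y hy using ih y hy
    rw [iteratedDeriv_succ, hev.deriv_eq, iteratedFDeriv_succ_apply_left]
    have hcd : ContDiffAt ℂ (k + 1 : ℕ) f (z + w • h) :=
      (contDiffOn_infty_of_differentiableOn_isOpen hU hf (k + 1)).contDiffAt (hU.mem_nhds hw)
    have hd : HasFDerivAt (iteratedFDeriv ℂ k f) (fderiv ℂ (iteratedFDeriv ℂ k f) (z + w • h))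
        (z + w • h) :=
      (hcd.differentiableAt_iteratedFDeriv (by exact_mod_cast Nat.lt_succ_self k)).hasFDerivAt
    have hline : HasDerivAt (fun w : ℂ => z + w • h) h w := by
      simpa using ((hasDerivAt_id w).smul_const h).const_add z
    have h2 := hd.comp_hasDerivAt w hline
    exact ((ContinuousMultilinearMap.apply ℂ (fun _ : Fin k => E) F fun _ => h).hasFDerivAt.comp_hasDerivAt
      w h2).deriv

/-- Osgood's lemma: a complex differentiable function on an open subset of a finite dimensional
space is analytic. -/
theorem analyticOnNhd_of_differentiableOn_isOpen {F : Type} [NormedAddCommGroup F]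
    [NormedSpace ℂ F] [FiniteDimensional ℂ F] {f : E → F} {U : Set E} (hU : IsOpen U)
    (hf : DifferentiableOn ℂ f U) : AnalyticOnNhd ℂ f U := by
  intro z hz
  have : CompleteSpace F := FiniteDimensional.complete ℂ F
  have : ProperSpace E := FiniteDimensional.proper ℂ E
  obtain ⟨R, hR, hRU⟩ := nhds_basis_closedBall.mem_iff.1 (hU.mem_nhds hz)
  obtain ⟨M, hM⟩ := (isCompact_closedBall z R).exists_bound_of_continuousOn
    (hf.continuousOn.mono hRU)
  have hM0 : 0 ≤ M := (norm_nonneg _).trans (hM z (mem_closedBall_self hR.le))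
  have hfb : DifferentiableOn ℂ f (ball z R) := hf.mono (ball_subset_closedBall.trans hRU)
  let p : FormalMultilinearSeries ℂ E F :=
    fun k => ((k.factorial : ℂ)⁻¹) • iteratedFDeriv ℂ k f z
  -- With ε = R/(k+1) the k steps fit into the ball, and (k+1)^k/k! ≤ e^(k+1) leaves a radius R/e.
  have hp : ∀ k, ‖p k‖ * (R / Real.exp 1) ^ k ≤ M * Real.exp 1 := by
    intro k
    have h1 := norm_iteratedFDeriv_le_of_ball (ε := R / (k + 1)) (by positivity) k
      (by rw [mul_div_assoc', div_lt_iff₀ (by positivity)]; nlinarith) hfb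
      (fun y hy => hM y (ball_subset_closedBall hy))
    have h2 := Real.pow_div_factorial_le_exp (k + 1 : ℝ) (by positivity) k
    have h3 : Real.exp (k + 1 : ℝ) = Real.exp 1 * Real.exp 1 ^ k := by
      rw [← Real.exp_nat_mul, ← Real.exp_add]; congr 1; ring
    have he : 0 < Real.exp 1 ^ k := by positivity
    have hfac : (0 : ℝ) < k.factorial := by positivity
    calc ‖p k‖ * (R / Real.exp 1) ^ k
        = (k.factorial : ℝ)⁻¹ * ‖iteratedFDeriv ℂ k f z‖ * (R / Real.exp 1) ^ k := by
          simp [p, norm_smul]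
      _ ≤ (k.factorial : ℝ)⁻¹ * (M / (R / (k + 1)) ^ k) * (R / Real.exp 1) ^ k := by gcongr
      _ = M * ((k + 1 : ℝ) ^ k / k.factorial) / Real.exp 1 ^ k := by
          rw [div_pow, div_pow]; field_simp
      _ ≤ M * Real.exp (k + 1 : ℝ) / Real.exp 1 ^ k := by gcongr
      _ = M * Real.exp 1 := by rw [h3]; field_simp
  have hr0 : 0 < R / Real.exp 1 := by positivity
  have hr1 : R / Real.exp 1 ≤ R := div_le_self hR.le (Real.one_le_exp zero_le_one)
  refine ⟨p, ENNReal.ofReal (R / Real.exp 1), ?_, by simpa using hr0, ?_⟩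
  · refine p.le_radius_of_bound (M * Real.exp 1) fun k => ?_
    rw [Real.coe_toNNReal _ hr0.le]
    exact hp k
  · intro y hy
    rw [Metric.eball_ofReal, mem_ball_zero_iff] at hy
    have hyR : ‖y‖ < R := hy.trans_le hr1
    -- The restriction to the line is holomorphic on a disc of radius ρ > 1, so its Taylor series
    -- may be evaluated at w = 1.
    obtain ⟨ρ, hρ1, hρ⟩ : ∃ ρ : ℝ, 1 < ρ ∧ ρ * ‖y‖ < R := by
      rcases eq_or_ne y 0 with rfl | hy0
      · exact ⟨2, by norm_num, by simpa using hR⟩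
      · have hy0' : 0 < ‖y‖ := norm_pos_iff.2 hy0
        obtain ⟨ρ, h1, h2⟩ := exists_between ((one_lt_div hy0').2 hyR)
        exact ⟨ρ, h1, (lt_div_iff₀ hy0').1 h2⟩
    have hmem : ∀ w ∈ ball (0 : ℂ) ρ, z + w • y ∈ ball z R := by
      intro w hw
      rw [mem_ball_zero_iff] at hw
      simp only [mem_ball, dist_eq_norm, add_sub_cancel_left, norm_smul]
      nlinarith [norm_nonneg y]
    have hd : DifferentiableOn ℂ (fun w : ℂ => f (z + w • y)) (ball 0 ρ) := fun w hw =>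
      (DifferentiableAt.comp w (hfb.differentiableAt (isOpen_ball.mem_nhds (hmem w hw)))
        (by fun_prop)).differentiableWithinAt
    have hs := Complex.hasSum_taylorSeries_on_ball hd (z := 1) (by simpa using hρ1)
    simp only [sub_zero, one_pow, one_smul] at hs
    convert hs using 2 with k
    rw [iteratedDeriv_line isOpen_ball hfb z y k 0 (by simpa using hR)]
    simp [p]

theorem analyticOnNhd_iff_differentiableOn_of_isOpen {F : Type} [NormedAddCommGroup F]
    [NormedSpace ℂ F] [FiniteDimensional ℂ F] {f : E → F} {U : Set E} (hU : IsOpen U) :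
    AnalyticOnNhd ℂ f U ↔ DifferentiableOn ℂ f U :=
  ⟨fun h => h.differentiableOn, analyticOnNhd_of_differentiableOn_isOpen hU⟩

/-- A series of analytic functions with a uniform summable bound is analytic. -/
theorem analyticOnNhd_tsum {f : ℕ → E → ℂ} {U : Set E} (hU : IsOpen U) {a : ℕ → ℝ}
    (ha : Summable a) (hf : ∀ k, AnalyticOnNhd ℂ (f k) U) (hfa : ∀ k, ∀ x ∈ U, ‖f k x‖ ≤ a k) :
    AnalyticOnNhd ℂ (fun x => ∑' k, f k x) U := by
  refine analyticOnNhd_of_differentiableOn_isOpen hU fun z hz => ?_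
  obtain ⟨R, hR, hRU⟩ := nhds_basis_ball.mem_iff.1 (hU.mem_nhds hz)
  have hsub : ∀ x ∈ ball z (R / 2), closedBall x (R / 3) ⊆ U := by
    intro x hx y hy
    refine hRU ?_
    rw [mem_ball] at *
    rw [mem_closedBall] at hy
    linarith [dist_triangle y x z]
  refine (hasFDerivAt_tsum_of_isPreconnected (u := fun k => a k / (R / 3))
    (f' := fun k x => fderiv ℂ (f k) x) (ha.div_const _)
    isOpen_ball (convex_ball z (R / 2)).isPreconnected (fun k x hx => ?_) (fun k x hx => ?_)
    (mem_ball_self (half_pos hR)) ?_ (mem_ball_self (half_pos hR))).differentiableAt.differentiableWithinAt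
  · exact (hf k x (hsub x hx (mem_closedBall_self (by positivity)))).differentiableAt.hasFDerivAt
  · exact norm_fderiv_le_of_ball (by positivity)
      (fun y hy => (hf k y (hsub x hx hy)).differentiableAt) (fun y hy => hfa k y (hsub x hx hy))
  · exact Summable.of_norm_bounded ha fun k => hfa k z hz

end Osgood

/-! ### Jets, and commutation of time and space derivatives. -/

section Jets

variable {n : ℕ}

theorem norm_single_one_le {ι : Type*} [Fintype ι] [DecidableEq ι] (j : ι) :
    ‖(Pi.single j 1 : ι → ℂ)‖ ≤ 1 :=
  (pi_norm_le_iff_of_nonneg zero_le_one).2 fun i => by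
    rcases eq_or_ne i j with rfl | h
    · simp
    · simp [h]

theorem update_eq_add_smul_single (x : Fin n → ℂ) (j : Fin n) (s : ℂ) :
    Function.update x j s = x + (s - x j) • (Pi.single j 1 : Fin n → ℂ) := by
  ext i
  rcases eq_or_ne i j with rfl | h
  · simp
  · simp [h]

theorem hasDerivAt_update_line (x : Fin n → ℂ) (j : Fin n) (s : ℂ) :
    HasDerivAt (fun s => Function.update x j s) (Pi.single j 1 : Fin n → ℂ) s := by
  simp only [update_eq_add_smul_single]
  simpa using (((hasDerivAt_id s).sub_const (x j)).smul_const
    (Pi.single j 1 : Fin n → ℂ)).const_add x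

theorem partialX_eq_fderiv {g : (Fin n → ℂ) → ℂ} {x : Fin n → ℂ} (hg : DifferentiableAt ℂ g x)
    (j : Fin n) : partialX j g x = fderiv ℂ g x (Pi.single j 1) := by
  have h1 : HasFDerivAt g (fderiv ℂ g x) (Function.update x j (x j)) := by
    simpa using hg.hasFDerivAt
  exact (h1.comp_hasDerivAt (x j) (hasDerivAt_update_line x j (x j))).deriv

theorem AnalyticOnNhd.partialX {g : (Fin n → ℂ) → ℂ} {U : Set (Fin n → ℂ)} (hU : IsOpen U)
    (hg : AnalyticOnNhd ℂ g U) (j : Fin n) : AnalyticOnNhd ℂ (partialX j g) U := by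
  have h := (ContinuousLinearMap.apply ℂ ℂ (Pi.single j 1 : Fin n → ℂ)).comp_analyticOnNhd hg.fderiv
  exact h.congr hU fun x hx => (partialX_eq_fderiv (hg x hx).differentiableAt j).symm

theorem partialX_congr {g h : (Fin n → ℂ) → ℂ} {U : Set (Fin n → ℂ)} (hU : IsOpen U)
    (hgh : Set.EqOn g h U) (j : Fin n) : Set.EqOn (partialX j g) (partialX j h) U := by
  intro x hx
  refine Filter.EventuallyEq.deriv_eq ?_
  have hc : Tendsto (fun s => Function.update x j s) (𝓝 (x j)) (𝓝 x) := by
    simpa using (hasDerivAt_update_line x j (x j)).continuousAt.tendsto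
  exact hc.eventually (by filter_upwards [hU.mem_nhds hx] with y hy using hgh hy)

/-- A relation between two families which each `∂/∂x_j` carries from level `k` to level `k + 1`
is carried by `(∂/∂x)^α` from level `0` to level `|α|`. -/
theorem multiPartialX_induction {S : Type*}
    {Q : ℕ → (S → (Fin n → ℂ) → ℂ) → (S → (Fin n → ℂ) → ℂ) → Prop}
    (hstep : ∀ k v w j, Q k v w → Q (k + 1) (fun s => partialX j (v s)) (fun s => partialX j (w s)))
    {v w : S → (Fin n → ℂ) → ℂ} (h0 : Q 0 v w) (α : Fin n → ℕ) :
    Q (∑ j, α j) (fun s => multiPartialX α (v s)) (fun s => multiPartialX α (w s)) := by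
  have hiter : ∀ (j : Fin n) (m k : ℕ) (v w : S → (Fin n → ℂ) → ℂ), Q k v w →
      Q (m + k) (fun s => (partialX j)^[m] (v s)) (fun s => (partialX j)^[m] (w s)) := by
    intro j m
    induction m with
    | zero => intro k v w h; simpa using h
    | succ m ih =>
      intro k v w h
      simp only [Function.iterate_succ_apply']
      have := hstep _ _ _ j (ih k v w h)
      rwa [show m + 1 + k = m + k + 1 by ring]
  have hfold : ∀ l : List (Fin n), Q (l.map α).sum
      (fun s => l.foldr (fun j h => (partialX j)^[α j] h) (v s))
      (fun s => l.foldr (fun j h => (partialX j)^[α j] h) (w s)) := by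
    intro l
    induction l with
    | nil => simpa using h0
    | cons j l ih =>
      simp only [List.foldr_cons, List.map_cons, List.sum_cons]
      exact hiter j (α j) _ _ _ ih
  have := hfold (List.finRange n)
  rwa [← List.ofFn_eq_map, List.sum_ofFn] at this

theorem multiPartialX_zero (g : (Fin n → ℂ) → ℂ) : multiPartialX (fun _ => 0) g = g := by
  have : ∀ l : List (Fin n), l.foldr (fun j h => (partialX j)^[0] h) g = g := by
    intro l
    induction l with
    | nil => rfl
    | cons j l ih => exact ih
  exact this _

theorem multiPartialX_congr {g h : (Fin n → ℂ) → ℂ} {U : Set (Fin n → ℂ)} (hU : IsOpen U)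
    (hgh : Set.EqOn g h U) (α : Fin n → ℕ) :
    Set.EqOn (multiPartialX α g) (multiPartialX α h) U :=
  multiPartialX_induction (S := Unit) (Q := fun _ v w => Set.EqOn (v ()) (w ()) U)
    (fun _ _ _ j hvw => partialX_congr hU hvw j) (v := fun _ => g) (w := fun _ => h) hgh α

/-- The operator `a(t) ∂/∂t`. -/
noncomputable def timeField (a : ℂ → ℂ) (v : ℂ → (Fin n → ℂ) → ℂ) : ℂ → (Fin n → ℂ) → ℂ :=
  fun t x => a t * deriv (fun s => v s x) t

theorem eulerLog_eq_timeField :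
    (eulerLog : (ℂ → (Fin n → ℂ) → ℂ) → _) = timeField fun _ => 1 := by
  ext v t x
  simp [eulerLog, timeField]

theorem hasDerivAt_time {v : ℂ → (Fin n → ℂ) → ℂ} {t : ℂ} {x : Fin n → ℂ}
    (hv : DifferentiableAt ℂ (Function.uncurry v) (t, x)) :
    HasDerivAt (fun s => v s x) (fderiv ℂ (Function.uncurry v) (t, x) (1, 0)) t := by
  have hline : HasDerivAt (fun s : ℂ => (s, x)) ((1 : ℂ), (0 : Fin n → ℂ)) t :=
    (hasDerivAt_id t).prodMk (hasDerivAt_const t x)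
  exact HasFDerivAt.comp_hasDerivAt (f := fun s : ℂ => (s, x)) t hv.hasFDerivAt hline

theorem partialX_slice_eq_fderiv {v : ℂ → (Fin n → ℂ) → ℂ} {t : ℂ} {x : Fin n → ℂ}
    (hv : DifferentiableAt ℂ (Function.uncurry v) (t, x)) (j : Fin n) :
    partialX j (v t) x = fderiv ℂ (Function.uncurry v) (t, x) (0, Pi.single j 1) := by
  have h1 : HasFDerivAt (v t) ((fderiv ℂ (Function.uncurry v) (t, x)).comp
      (ContinuousLinearMap.inr ℂ ℂ (Fin n → ℂ))) x :=
    HasFDerivAt.comp (f := fun y => (t, y)) x hv.hasFDerivAt (hasFDerivAt_prodMk_right t x)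
  rw [partialX_eq_fderiv h1.differentiableAt, h1.fderiv]
  simp

theorem AnalyticOnNhd.slice {v : ℂ → (Fin n → ℂ) → ℂ} {W : Set (ℂ × (Fin n → ℂ))}
    (hv : AnalyticOnNhd ℂ (Function.uncurry v) W) (t : ℂ) :
    AnalyticOnNhd ℂ (v t) {x | (t, x) ∈ W} := fun x hx => by
  have h1 : AnalyticAt ℂ (fun y : Fin n → ℂ => (t, y)) x := analyticAt_const.prod analyticAt_id
  exact AnalyticAt.comp (f := fun y : Fin n → ℂ => (t, y)) (hv (t, x) hx) h1

theorem AnalyticOnNhd.timeSlice {v : ℂ → (Fin n → ℂ) → ℂ} {W : Set (ℂ × (Fin n → ℂ))}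
    (hv : AnalyticOnNhd ℂ (Function.uncurry v) W) (x : Fin n → ℂ) :
    AnalyticOnNhd ℂ (fun t => v t x) {t | (t, x) ∈ W} := fun t ht => by
  have h1 : AnalyticAt ℂ (fun s : ℂ => (s, x)) t := analyticAt_id.prod analyticAt_const
  exact AnalyticAt.comp (f := fun s : ℂ => (s, x)) (hv (t, x) ht) h1

theorem isOpen_slice {W : Set (ℂ × (Fin n → ℂ))} (hW : IsOpen W) (t : ℂ) :
    IsOpen {x | (t, x) ∈ W} := hW.preimage (by fun_prop)

theorem AnalyticOnNhd.partialX_family {v : ℂ → (Fin n → ℂ) → ℂ} {W : Set (ℂ × (Fin n → ℂ))}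
    (hW : IsOpen W) (hv : AnalyticOnNhd ℂ (Function.uncurry v) W) (j : Fin n) :
    AnalyticOnNhd ℂ (Function.uncurry fun t => _root_.partialX j (v t)) W := by
  have h := (ContinuousLinearMap.apply ℂ ℂ
    ((0, Pi.single j 1) : ℂ × (Fin n → ℂ))).comp_analyticOnNhd hv.fderiv
  exact h.congr hW fun p hp => (partialX_slice_eq_fderiv (hv p hp).differentiableAt j).symm

theorem AnalyticOnNhd.timeField {v : ℂ → (Fin n → ℂ) → ℂ} {W : Set (ℂ × (Fin n → ℂ))}
    (hW : IsOpen W) (hv : AnalyticOnNhd ℂ (Function.uncurry v) W) {a : ℂ → ℂ}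
    (ha : Differentiable ℂ a) : AnalyticOnNhd ℂ (Function.uncurry (timeField a v)) W := by
  have h := (ContinuousLinearMap.apply ℂ ℂ
    ((1, 0) : ℂ × (Fin n → ℂ))).comp_analyticOnNhd hv.fderiv
  have ha' : AnalyticOnNhd ℂ (fun p : ℂ × (Fin n → ℂ) => a p.1) W := fun p _ =>
    AnalyticAt.comp (ha.analyticAt _) analyticAt_fst
  refine (ha'.mul h).congr hW fun p hp => ?_
  show a p.1 * fderiv ℂ (Function.uncurry v) p (1, 0) = a p.1 * deriv (fun s => v s p.2) p.1
  rw [(hasDerivAt_time (hv p hp).differentiableAt).deriv]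

theorem timeField_congr {v w : ℂ → (Fin n → ℂ) → ℂ} {W : Set (ℂ × (Fin n → ℂ))} (hW : IsOpen W)
    (hvw : Set.EqOn (Function.uncurry v) (Function.uncurry w) W) (a : ℂ → ℂ) :
    Set.EqOn (Function.uncurry (timeField a v)) (Function.uncurry (timeField a w)) W := by
  rintro ⟨t, x⟩ hp
  have hc : Tendsto (fun s : ℂ => (s, x)) (𝓝 t) (𝓝 (t, x)) :=
    (Continuous.prodMk_left x).continuousAt
  have : (fun s => v s x) =ᶠ[𝓝 t] fun s => w s x :=
    hc.eventually (p := fun q : ℂ × (Fin n → ℂ) => v q.1 q.2 = w q.1 q.2)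
      (by filter_upwards [hW.mem_nhds hp] with y hy using hvw hy)
  show a t * deriv (fun s => v s x) t = a t * deriv (fun s => w s x) t
  rw [this.deriv_eq]

/-- `a(t) ∂/∂t` commutes with `∂/∂x_j` on holomorphic functions. -/
theorem timeField_partialX_comm {v : ℂ → (Fin n → ℂ) → ℂ} {W : Set (ℂ × (Fin n → ℂ))}
    (hW : IsOpen W) (hv : AnalyticOnNhd ℂ (Function.uncurry v) W) (a : ℂ → ℂ)
    (j : Fin n) :
    Set.EqOn (Function.uncurry (timeField a fun t => partialX j (v t)))
      (Function.uncurry fun t => partialX j (timeField a v t)) W := by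
  rintro ⟨t, x⟩ hp
  have hcomm : fderiv ℂ (fderiv ℂ (Function.uncurry v)) (t, x) (1, 0) (0, Pi.single j 1) =
      fderiv ℂ (fderiv ℂ (Function.uncurry v)) (t, x) (0, Pi.single j 1) (1, 0) :=
    ContDiffAt.isSymmSndFDerivAt_of_omega (hv _ hp).contDiffAt _ _
  have hF : HasFDerivAt (fderiv ℂ (Function.uncurry v))
      (fderiv ℂ (fderiv ℂ (Function.uncurry v)) (t, x)) (t, x) :=
    (hv.fderiv _ hp).differentiableAt.hasFDerivAt
  have hct : Tendsto (fun s : ℂ => (s, x)) (𝓝 t) (𝓝 (t, x)) :=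
    (Continuous.prodMk_left x).continuousAt
  have hcx : Tendsto (fun y : Fin n → ℂ => (t, y)) (𝓝 x) (𝓝 (t, x)) :=
    (Continuous.prodMk_right t).continuousAt
  have e1 : (fun s => partialX j (v s) x) =ᶠ[𝓝 t]
      fun s => fderiv ℂ (Function.uncurry v) (s, x) (0, Pi.single j 1) :=
    hct.eventually (p := fun q : ℂ × (Fin n → ℂ) => partialX j (v q.1) q.2 =
      fderiv ℂ (Function.uncurry v) q (0, Pi.single j 1)) (by
      filter_upwards [hW.mem_nhds hp] with y hy
      exact partialX_slice_eq_fderiv (hv y hy).differentiableAt j)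
  have d1 : HasDerivAt (fun s => fderiv ℂ (Function.uncurry v) (s, x) (0, Pi.single j 1))
      (fderiv ℂ (fderiv ℂ (Function.uncurry v)) (t, x) (1, 0) (0, Pi.single j 1)) t := by
    have hline : HasDerivAt (fun s : ℂ => (s, x)) ((1 : ℂ), (0 : Fin n → ℂ)) t :=
      (hasDerivAt_id t).prodMk (hasDerivAt_const t x)
    have := HasFDerivAt.comp_hasDerivAt (f := fun s : ℂ => (s, x)) t hF hline
    simpa using this.clm_apply (hasDerivAt_const t ((0 : ℂ), (Pi.single j 1 : Fin n → ℂ)))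
  have e2 : Set.EqOn (timeField a v t)
      (fun y => a t * fderiv ℂ (Function.uncurry v) (t, y) (1, 0)) {y | (t, y) ∈ W} := by
    intro y hy
    show a t * _ = a t * _
    rw [(hasDerivAt_time (hv _ hy).differentiableAt).deriv]
  have d2 : HasFDerivAt (fun y => a t * fderiv ℂ (Function.uncurry v) (t, y) (1, 0))
      (a t • ((ContinuousLinearMap.apply ℂ ℂ ((1, 0) : ℂ × (Fin n → ℂ))).comp
        ((fderiv ℂ (fderiv ℂ (Function.uncurry v)) (t, x)).comp
          (ContinuousLinearMap.inr ℂ ℂ (Fin n → ℂ))))) x := by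
    have h1 := HasFDerivAt.comp (f := fun y => (t, y)) x hF (hasFDerivAt_prodMk_right t x)
    exact ((ContinuousLinearMap.apply ℂ ℂ ((1, 0) : ℂ × (Fin n → ℂ))).hasFDerivAt.comp x
      h1).const_mul (a t)
  show a t * deriv (fun s => partialX j (v s) x) t = partialX j (timeField a v t) x
  rw [e1.deriv_eq, d1.deriv, partialX_congr (isOpen_slice hW t) e2 j hp,
    partialX_eq_fderiv d2.differentiableAt, d2.fderiv, hcomm]
  simp

theorem AnalyticOnNhd.multiPartialX_family {v : ℂ → (Fin n → ℂ) → ℂ}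
    {W : Set (ℂ × (Fin n → ℂ))} (hW : IsOpen W) (hv : AnalyticOnNhd ℂ (Function.uncurry v) W)
    (α : Fin n → ℕ) : AnalyticOnNhd ℂ (Function.uncurry fun t => multiPartialX α (v t)) W :=
  multiPartialX_induction (S := ℂ) (Q := fun _ v _ => AnalyticOnNhd ℂ (Function.uncurry v) W)
    (fun _ _ _ j h => h.partialX_family hW j) (v := v) (w := v) hv α

theorem timeField_multiPartialX_comm {v : ℂ → (Fin n → ℂ) → ℂ} {W : Set (ℂ × (Fin n → ℂ))}
    (hW : IsOpen W) (hv : AnalyticOnNhd ℂ (Function.uncurry v) W) (a : ℂ → ℂ)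
    (α : Fin n → ℕ) :
    Set.EqOn (Function.uncurry (timeField a fun t => multiPartialX α (v t)))
      (Function.uncurry fun t => multiPartialX α (timeField a v t)) W := by
  refine (multiPartialX_induction (S := ℂ)
    (Q := fun _ v w => AnalyticOnNhd ℂ (Function.uncurry v) W ∧
      Set.EqOn (Function.uncurry (timeField a v)) (Function.uncurry w) W)
    (fun _ v w j h => ⟨h.1.partialX_family hW j, ?_⟩) (v := v) (w := timeField a v)
    ⟨hv, fun _ _ => rfl⟩ α).2
  refine (timeField_partialX_comm hW h.1 a j).trans ?_
  rintro ⟨t, x⟩ hp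
  exact partialX_congr (isOpen_slice hW t) (fun y hy => h.2 (x := (t, y)) hy) j hp

/-- The jet of a function of `x` (in the slots `(0, α)`) and its time derivative
(in the slots `(1, α)`). -/
noncomputable def spatialJet (a b : (Fin n → ℂ) → ℂ) (x : Fin n → ℂ) : Idx n → ℂ :=
  fun p => multiPartialX (fun j => (p.1.2 j : ℕ)) (if p.1.1 = 0 then a else b) x

theorem spatialJet_congr {a b a' b' : (Fin n → ℂ) → ℂ} {U : Set (Fin n → ℂ)} (hU : IsOpen U)
    (ha : Set.EqOn a a' U) (hb : Set.EqOn b b' U) :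
    Set.EqOn (spatialJet a b) (spatialJet a' b') U := by
  intro x hx
  ext p
  unfold spatialJet
  split_ifs
  · exact multiPartialX_congr hU ha _ hx
  · exact multiPartialX_congr hU hb _ hx

theorem spatialJet_zero (a b : (Fin n → ℂ) → ℂ) (x : Fin n → ℂ) (i : Fin 2) :
    spatialJet a b x (Idx.zero i) = if i = 0 then a x else b x := by
  have h : spatialJet a b x (Idx.zero i) = multiPartialX (fun _ => 0) (if i = 0 then a else b) x := rfl
  rw [h, multiPartialX_zero]
  split_ifs <;> rfl

/-- Since a(t)∂/∂t commutes with the x-derivatives, the jet at time t depends only on two functions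
of x, the slices of v and of its time derivative. All jet estimates can then be made in x with t
frozen. -/
theorem jet_timeField_eq_spatialJet {v : ℂ → (Fin n → ℂ) → ℂ} {W : Set (ℂ × (Fin n → ℂ))}
    (hW : IsOpen W) (hv : AnalyticOnNhd ℂ (Function.uncurry v) W) (a : ℂ → ℂ)
    {t : ℂ} {x : Fin n → ℂ} (hp : (t, x) ∈ W) :
    jet (timeField a) v t x = spatialJet (v t) (timeField a v t) x := by
  ext ⟨⟨i, α⟩, hi⟩
  unfold jet spatialJet
  fin_cases i
  · rfl
  · exact timeField_multiPartialX_comm hW hv a (fun j => (α j : ℕ)) hp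

theorem jet_eulerLog_eq_spatialJet {v : ℂ → (Fin n → ℂ) → ℂ} {W : Set (ℂ × (Fin n → ℂ))}
    (hW : IsOpen W) (hv : AnalyticOnNhd ℂ (Function.uncurry v) W) {t : ℂ} {x : Fin n → ℂ}
    (hp : (t, x) ∈ W) : jet eulerLog v t x = spatialJet (v t) (eulerLog v t) x := by
  rw [eulerLog_eq_timeField]
  exact jet_timeField_eq_spatialJet hW hv _ hp

theorem jet_eulerT_eq_spatialJet {v : ℂ → (Fin n → ℂ) → ℂ} {W : Set (ℂ × (Fin n → ℂ))}
    (hW : IsOpen W) (hv : AnalyticOnNhd ℂ (Function.uncurry v) W) {t : ℂ} {x : Fin n → ℂ}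
    (hp : (t, x) ∈ W) : jet eulerT v t x = spatialJet (v t) (eulerT v t) x :=
  jet_timeField_eq_spatialJet hW hv _ hp

theorem AnalyticOnNhd.eulerT {v : ℂ → (Fin n → ℂ) → ℂ} {W : Set (ℂ × (Fin n → ℂ))}
    (hW : IsOpen W) (hv : AnalyticOnNhd ℂ (Function.uncurry v) W) :
    AnalyticOnNhd ℂ (Function.uncurry (eulerT v)) W :=
  hv.timeField hW differentiable_id

theorem AnalyticOnNhd.eulerLog {v : ℂ → (Fin n → ℂ) → ℂ} {W : Set (ℂ × (Fin n → ℂ))}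
    (hW : IsOpen W) (hv : AnalyticOnNhd ℂ (Function.uncurry v) W) :
    AnalyticOnNhd ℂ (Function.uncurry (eulerLog v)) W := by
  rw [eulerLog_eq_timeField]
  exact hv.timeField hW (differentiable_const _)

theorem analyticOnNhd_spatialJet {v w : ℂ → (Fin n → ℂ) → ℂ} {W : Set (ℂ × (Fin n → ℂ))}
    (hW : IsOpen W) (hv : AnalyticOnNhd ℂ (Function.uncurry v) W)
    (hw : AnalyticOnNhd ℂ (Function.uncurry w) W) :
    AnalyticOnNhd ℂ (fun p : ℂ × (Fin n → ℂ) => spatialJet (v p.1) (w p.1) p.2) W := by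
  refine AnalyticOnNhd.pi fun q => ?_
  unfold spatialJet
  split_ifs
  · exact hv.multiPartialX_family hW _
  · exact hw.multiPartialX_family hW _

end Jets

/-! ### Weighted Cauchy estimates on slices of the cone. -/

section Cone

variable {n : ℕ}

/-- The set of all `x` in the polydisc of radius `R` with `y < (R - ‖x‖)⁴`. -/
def coneSlice (n : ℕ) (R y : ℝ) : Set (Fin n → ℂ) := {x | ‖x‖ < R ∧ y < (R - ‖x‖) ^ 4}

/-- A weight on `coneSlice n R y`, which vanishes at its boundary. -/
noncomputable def coneWeight (R y : ℝ) (x : Fin n → ℂ) : ℝ := 1 - y / (R - ‖x‖) ^ 4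

theorem isOpen_coneSlice (R y : ℝ) : IsOpen (coneSlice n R y) := by
  have h1 : IsOpen {x : Fin n → ℂ | ‖x‖ < R} := isOpen_lt (by fun_prop) (by fun_prop)
  have h2 : IsOpen {x : Fin n → ℂ | y < (R - ‖x‖) ^ 4} := isOpen_lt (by fun_prop) (by fun_prop)
  exact h1.inter h2

theorem coneSlice_zero (R : ℝ) : coneSlice n R 0 = polydisc n R := by
  ext x
  simp only [coneSlice, polydisc, Set.mem_ofPred_eq, and_iff_left_iff_imp]
  intro h
  have : 0 < R - ‖x‖ := sub_pos.2 h
  positivity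

theorem coneWeight_zero (R : ℝ) (x : Fin n → ℂ) : coneWeight R 0 x = 1 := by simp [coneWeight]

theorem coneWeight_pos {R y : ℝ} {x : Fin n → ℂ} (hx : x ∈ coneSlice n R y) :
    0 < coneWeight R y x := by
  have h1 : 0 < R - ‖x‖ := sub_pos.2 hx.1
  rw [coneWeight, sub_pos, div_lt_one (by positivity)]
  exact hx.2

theorem coneWeight_le_one {R y : ℝ} (hy : 0 ≤ y) (x : Fin n → ℂ) : coneWeight R y x ≤ 1 := by
  rw [coneWeight]
  have : 0 ≤ y / (R - ‖x‖) ^ 4 := by positivity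
  linarith

/-- With d = R - ‖x‖ and w the weight, a move by d w/8 leaves d' ≥ d(1 - w/8), so d'⁴ ≥ d⁴(1 - w/2)
by Bernoulli. As y = (1 - w)d⁴ ≤ (1 - w/2)² d⁴, the weight at the new point is still at least w/2.
Hence d w/8 is an admissible radius in Cauchy's estimate, on which neither d nor w falls below half
its value. -/
theorem mem_coneSlice_of_mem_closedBall {R y : ℝ} (hy : 0 ≤ y) {x x' : Fin n → ℂ}
    (hx : x ∈ coneSlice n R y)
    (hx' : x' ∈ Metric.closedBall x ((R - ‖x‖) * coneWeight R y x / 8)) :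
    x' ∈ coneSlice n R y ∧ (R - ‖x‖) / 2 ≤ R - ‖x'‖ ∧
      coneWeight R y x / 2 ≤ coneWeight R y x' := by
  have hd : 0 < R - ‖x‖ := sub_pos.2 hx.1
  have hw0 := coneWeight_pos hx
  have hw1 := coneWeight_le_one (R := R) hy x
  have hyw : y = (1 - coneWeight R y x) * (R - ‖x‖) ^ 4 := by
    rw [coneWeight]; field_simp; ring
  set d := R - ‖x‖ with hd_def
  set w := coneWeight R y x with hw
  have hnorm : ‖x'‖ ≤ ‖x‖ + d * w / 8 := by
    rw [Metric.mem_closedBall, dist_eq_norm] at hx'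
    have := norm_add_le x (x' - x)
    rw [add_sub_cancel] at this
    linarith
  have hd' : d * (1 - w / 8) ≤ R - ‖x'‖ := by linarith [hd_def]
  have h1 : 0 ≤ d * (1 - w / 8) := mul_nonneg hd.le (by linarith)
  have h2 : d / 2 ≤ R - ‖x'‖ := by nlinarith
  have hB : 1 - w / 2 ≤ (1 - w / 8) ^ 4 := by
    have := one_add_mul_le_pow (a := -(w / 8)) (by linarith) 4
    norm_num at this
    have e : (1 - w / 8) = 1 + -(w / 8) := by ring
    rw [e]; linarith
  have h4 : d ^ 4 * (1 - w / 2) ≤ (R - ‖x'‖) ^ 4 := by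
    calc d ^ 4 * (1 - w / 2) ≤ d ^ 4 * (1 - w / 8) ^ 4 := by gcongr
      _ = (d * (1 - w / 8)) ^ 4 := by ring
      _ ≤ _ := by gcongr
  have hd'0 : 0 < R - ‖x'‖ := by linarith
  have h5 : y ≤ (1 - w / 2) * (R - ‖x'‖) ^ 4 := by
    calc y = (1 - w) * d ^ 4 := hyw
      _ ≤ (1 - w / 2) * (d ^ 4 * (1 - w / 2)) := by
        have : 0 < d ^ 4 := by positivity
        nlinarith [mul_nonneg this.le (sq_nonneg w)]
      _ ≤ _ := mul_le_mul_of_nonneg_left h4 (by linarith)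
  have hd'4 : 0 < (R - ‖x'‖) ^ 4 := by positivity
  refine ⟨⟨sub_pos.1 hd'0, ?_⟩, h2, ?_⟩
  · nlinarith
  · rw [coneWeight]
    have : y / (R - ‖x'‖) ^ 4 ≤ 1 - w / 2 := (div_le_iff₀ hd'4).2 h5
    linarith

/-- Cauchy's estimate for `∂/∂x_j` in terms of the weight. -/
theorem norm_partialX_sub_le {R y B : ℝ} (hy : 0 ≤ y) (hB : 0 ≤ B) {k m : ℕ}
    {g h : (Fin n → ℂ) → ℂ} (hg : AnalyticOnNhd ℂ g (coneSlice n R y))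
    (hh : AnalyticOnNhd ℂ h (coneSlice n R y))
    (hgh : ∀ x ∈ coneSlice n R y, ‖g x - h x‖ ≤ B / ((R - ‖x‖) ^ k * coneWeight R y x ^ m))
    (j : Fin n) {x : Fin n → ℂ} (hx : x ∈ coneSlice n R y) :
    ‖partialX j g x - partialX j h x‖ ≤
      8 * 2 ^ (m + k) * B / ((R - ‖x‖) ^ (k + 1) * coneWeight R y x ^ (m + 1)) := by
  have hd : 0 < R - ‖x‖ := sub_pos.2 hx.1
  have hw0 := coneWeight_pos hx
  have hr : 0 < (R - ‖x‖) * coneWeight R y x / 8 := by positivity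
  rw [partialX_eq_fderiv (hg x hx).differentiableAt, partialX_eq_fderiv (hh x hx).differentiableAt,
    ← sub_apply, ← fderiv_fun_sub (hg x hx).differentiableAt
      (hh x hx).differentiableAt]
  have key := norm_fderiv_apply_le_of_ball (f := fun x => g x - h x) (z := x)
    (M := B / (((R - ‖x‖) / 2) ^ k * (coneWeight R y x / 2) ^ m)) hr
    (fun x' hx' => by
      have := (mem_coneSlice_of_mem_closedBall hy hx hx').1
      exact (hg x' this).differentiableAt.sub (hh x' this).differentiableAt)
    (fun x' hx' => by
      obtain ⟨h1, h2, h3⟩ := mem_coneSlice_of_mem_closedBall hy hx hx'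
      refine (hgh x' h1).trans ?_
      have h4 : 0 ≤ R - ‖x'‖ := by linarith
      gcongr) (Pi.single j 1)
  refine key.trans ?_
  have h1 : 0 ≤ B / (((R - ‖x‖) / 2) ^ k * (coneWeight R y x / 2) ^ m) /
      ((R - ‖x‖) * coneWeight R y x / 8) := by positivity
  refine (mul_le_of_le_one_right h1 (norm_single_one_le j)).trans_eq ?_
  rw [div_pow, div_pow, pow_add, pow_succ, pow_succ]
  field_simp

/-- The derivative after the k-th costs 8 · 2^(m + 2k), because d enters with exponent k and w with
exponent m + k. The constant bounds the product of these costs crudely by a power of a larger one.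
-/
theorem norm_multiPartialX_sub_le {R y B : ℝ} (hy : 0 ≤ y) (hB : 0 ≤ B) {m : ℕ}
    {g h : (Fin n → ℂ) → ℂ} (hg : AnalyticOnNhd ℂ g (coneSlice n R y))
    (hh : AnalyticOnNhd ℂ h (coneSlice n R y))
    (hgh : ∀ x ∈ coneSlice n R y, ‖g x - h x‖ ≤ B / coneWeight R y x ^ m)
    (α : Fin n → ℕ) {k : ℕ} (hk : ∑ j, α j = k) {x : Fin n → ℂ} (hx : x ∈ coneSlice n R y) :
    ‖multiPartialX α g x - multiPartialX α h x‖ ≤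
      (8 * 2 ^ (m + 2 * k)) ^ k * B / ((R - ‖x‖) ^ k * coneWeight R y x ^ (m + k)) := by
  subst hk
  refine (multiPartialX_induction (S := Unit) (Q := fun k v w =>
    AnalyticOnNhd ℂ (v ()) (coneSlice n R y) ∧ AnalyticOnNhd ℂ (w ()) (coneSlice n R y) ∧
    ∀ x ∈ coneSlice n R y, ‖v () x - w () x‖ ≤
      (8 * 2 ^ (m + 2 * k)) ^ k * B / ((R - ‖x‖) ^ k * coneWeight R y x ^ (m + k)))
    ?_ (v := fun _ => g) (w := fun _ => h) ⟨hg, hh, by simpa using hgh⟩ α).2.2 x hx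
  rintro k v w j ⟨h1, h2, h3⟩
  refine ⟨h1.partialX (isOpen_coneSlice R y) j, h2.partialX (isOpen_coneSlice R y) j,
    fun x hx => (norm_partialX_sub_le hy (by positivity) h1 h2 h3 j hx).trans ?_⟩
  have hd : 0 < R - ‖x‖ := sub_pos.2 hx.1
  have hw0 := coneWeight_pos hx
  rw [← add_assoc m k 1]
  rw [← mul_assoc]
  have h2 : (1 : ℝ) ≤ 2 := one_le_two
  have e : (8 * 2 ^ (m + k + k) : ℝ) * (8 * 2 ^ (m + 2 * k)) ^ k ≤
      (8 * 2 ^ (m + 2 * (k + 1))) ^ (k + 1) := by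
    rw [pow_succ', show m + k + k = m + 2 * k by ring]
    gcongr <;> omega
  gcongr

/-- The norm of the slots `(i, 0)` of a jet. -/
noncomputable def lowNorm (z : Idx n → ℂ) : ℝ := max ‖z (Idx.zero 0)‖ ‖z (Idx.zero 1)‖

theorem norm_spatialJet_sub_le {R y B : ℝ} (hR : R ≤ 1) (hy : 0 ≤ y) (hB : 0 ≤ B)
    {a b a' b' : (Fin n → ℂ) → ℂ} (ha : AnalyticOnNhd ℂ a (coneSlice n R y))
    (hb : AnalyticOnNhd ℂ b (coneSlice n R y)) (ha' : AnalyticOnNhd ℂ a' (coneSlice n R y))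
    (hb' : AnalyticOnNhd ℂ b' (coneSlice n R y))
    (haa : ∀ x ∈ coneSlice n R y, ‖a x - a' x‖ ≤ B / coneWeight R y x)
    (hbb : ∀ x ∈ coneSlice n R y, ‖b x - b' x‖ ≤ B / coneWeight R y x ^ 2)
    {x : Fin n → ℂ} (hx : x ∈ coneSlice n R y) :
    ‖spatialJet a b x - spatialJet a' b' x‖ ≤
      65536 * B / ((R - ‖x‖) ^ 2 * coneWeight R y x ^ 3) := by
  have hd : 0 < R - ‖x‖ := sub_pos.2 hx.1
  have hd1 : R - ‖x‖ ≤ 1 := by linarith [norm_nonneg x]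
  have hw0 := coneWeight_pos hx
  have hw1 := coneWeight_le_one (R := R) hy x
  -- The order constraint defining `Idx` enters here: `a` (m = 1) is differentiated at most twice in
  -- x and `b` (m = 2) at most once, so both lose at most w⁻³. The constant is 65536 = (8 · 2⁵)².
  have fin : ∀ m k : ℕ, k ≤ 2 → m + k ≤ 3 → m + 2 * k ≤ 5 →
      (8 * 2 ^ (m + 2 * k)) ^ k * B / ((R - ‖x‖) ^ k * coneWeight R y x ^ (m + k)) ≤
        65536 * B / ((R - ‖x‖) ^ 2 * coneWeight R y x ^ 3) := by
    intro m k h1 h2 h3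
    have e : (8 * 2 ^ (m + 2 * k) : ℝ) ^ k ≤ 65536 := by
      calc (8 * 2 ^ (m + 2 * k) : ℝ) ^ k ≤ (8 * 2 ^ 5) ^ k := by gcongr; norm_num
        _ ≤ (8 * 2 ^ 5) ^ 2 := by gcongr; norm_num
        _ = 65536 := by norm_num
    have e1 : (R - ‖x‖) ^ 2 ≤ (R - ‖x‖) ^ k := pow_le_pow_of_le_one hd.le hd1 h1
    have e2 : coneWeight R y x ^ 3 ≤ coneWeight R y x ^ (m + k) :=
      pow_le_pow_of_le_one hw0.le hw1 h2
    gcongr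
  refine (pi_norm_le_iff_of_nonneg (by positivity)).2 fun p => ?_
  have hp := p.2
  rw [Pi.sub_apply]
  unfold spatialJet
  split_ifs with h0
  · exact (norm_multiPartialX_sub_le (m := 1) hy hB ha ha' (by simpa using haa) _ rfl hx).trans
      (fin _ _ (by omega) (by omega) (by omega))
  · have : (p.1.1 : ℕ) ≠ 0 := fun h => h0 (Fin.ext h)
    exact (norm_multiPartialX_sub_le (m := 2) hy hB hb hb' hbb _ rfl hx).trans
      (fin _ _ (by omega) (by omega) (by omega))

theorem lowNorm_spatialJet_sub_le {B : ℝ} {a b a' b' : (Fin n → ℂ) → ℂ} {x : Fin n → ℂ}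
    (haa : ‖a x - a' x‖ ≤ B) (hbb : ‖b x - b' x‖ ≤ B) :
    lowNorm (spatialJet a b x - spatialJet a' b' x) ≤ B := by
  simp only [lowNorm, Pi.sub_apply, spatialJet_zero]
  exact max_le (by simpa using haa) (by simpa using hbb)

end Cone

/-! ### Bounded solutions of the linear equation on a ray. -/

section Comparison

/-- A solution of `g' = l g + f` that is bounded near `-∞` is dominated by every nonnegative
supersolution when `Re l < 0`. -/
theorem norm_le_of_supersolution {l : ℂ} (hl : l.re < 0) {g f : ℝ → ℂ} {b b' : ℝ → ℝ} {s₁ : ℝ}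
    (hg : ∀ s < s₁, HasDerivAt g (l * g s + f s) s) (hbdd : ∃ M T : ℝ, ∀ s < T, ‖g s‖ ≤ M)
    (hb : ∀ s < s₁, HasDerivAt b (b' s) s) (hb0 : ∀ s < s₁, 0 ≤ b s)
    (hf : ∀ s < s₁, ‖f s‖ ≤ b' s + -l.re * b s) {s : ℝ} (hs : s < s₁) : ‖g s‖ ≤ b s := by
  obtain ⟨M, T, hM⟩ := hbdd
  have hE : ∀ r : ℝ, HasDerivAt (fun r : ℝ => Complex.exp (-l * (r - s)))
      (Complex.exp (-l * (r - s)) * -l) r := fun r => by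
    have h1 : HasDerivAt (fun r : ℝ => -l * ((r : ℂ) - s)) (-l * 1) r :=
      ((Complex.ofRealCLM.hasDerivAt (x := r)).sub_const (s : ℂ)).const_mul (-l)
    simpa using h1.cexp
  have hEn : ∀ r : ℝ, ‖Complex.exp (-l * (r - s))‖ = Real.exp (-l.re * (r - s)) := fun r => by
    rw [Complex.norm_exp]; congr 1; simp
  have hN : ∀ r : ℝ, HasDerivAt (fun r : ℝ => Real.exp (-l.re * (r - s)))
      (Real.exp (-l.re * (r - s)) * -l.re) r := fun r => by
    simpa using (((hasDerivAt_id r).sub_const s).const_mul (-l.re)).exp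
  -- The integrating factor exp(-l(r - s)) removes the linear term, and the value at s₀ enters
  -- multiplied by exp(-Re l (s₀ - s)), which tends to 0 as s₀ → -∞ because Re l < 0.
  have key : ∀ s₀ < min s T, ‖g s‖ ≤ b s + Real.exp (-l.re * (s₀ - s)) * M := by
    intro s₀ hs₀
    obtain ⟨h1, h2⟩ := lt_min_iff.1 hs₀
    have hlt : ∀ r ∈ Set.Icc s₀ s, r < s₁ := fun r hr => hr.2.trans_lt hs
    have hφ : ∀ r ∈ Set.Icc s₀ s, HasDerivAt (fun r : ℝ => Complex.exp (-l * (r - s)) * g r)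
        (Complex.exp (-l * (r - s)) * f r) r := fun r hr => by
      exact ((hE r).fun_mul (hg r (hlt r hr))).congr_deriv (by ring)
    have hB : ∀ r ∈ Set.Icc s₀ s, HasDerivAt (fun r : ℝ => Real.exp (-l.re * (r - s)) * b r +
        Real.exp (-l.re * (s₀ - s)) * M)
        (Real.exp (-l.re * (r - s)) * (b' r + -l.re * b r)) r := fun r hr => by
      exact (((hN r).fun_mul (hb r (hlt r hr))).add_const _).congr_deriv (by ring)
    have := image_norm_le_of_norm_deriv_right_le_deriv_boundary'
      (f := fun r : ℝ => Complex.exp (-l * (r - s)) * g r)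
      (f' := fun r => Complex.exp (-l * (r - s)) * f r) (a := s₀) (b := s)
      (B := fun r => Real.exp (-l.re * (r - s)) * b r + Real.exp (-l.re * (s₀ - s)) * M)
      (B' := fun r => Real.exp (-l.re * (r - s)) * (b' r + -l.re * b r))
      (fun r hr => (hφ r hr).continuousAt.continuousWithinAt)
      (fun r hr => (hφ r (Set.Ico_subset_Icc_self hr)).hasDerivWithinAt)
      (by
        rw [norm_mul, hEn]
        have e1 := hb0 s₀ (h1.trans hs)
        have e2 : Real.exp (-l.re * (s₀ - s)) * ‖g s₀‖ ≤ Real.exp (-l.re * (s₀ - s)) * M := by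
          gcongr; exact hM s₀ h2
        have e3 : 0 ≤ Real.exp (-l.re * (s₀ - s)) * b s₀ := by positivity
        linarith)
      (fun r hr => (hB r hr).continuousAt.continuousWithinAt)
      (fun r hr => (hB r (Set.Ico_subset_Icc_self hr)).hasDerivWithinAt)
      (fun r hr => by
        rw [norm_mul, hEn]
        gcongr
        exact hf r (hlt r (Set.Ico_subset_Icc_self hr)))
      (Set.right_mem_Icc.2 h1.le)
    simpa using this
  have hlim : Tendsto (fun s₀ : ℝ => b s + Real.exp (-l.re * (s₀ - s)) * M) atBot
      (𝓝 (b s + 0 * M)) := by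
    refine tendsto_const_nhds.add (Tendsto.mul_const M (Real.tendsto_exp_atBot.comp ?_))
    exact (tendsto_atBot_add_const_right _ (-s) tendsto_id).const_mul_atBot (neg_pos.2 hl)
  have := ge_of_tendsto hlim
    (by filter_upwards [eventually_lt_atBot (min s T)] with s₀ h using key s₀ h)
  simpa using this

variable {l₁ l₂ : ℂ} {A B f : ℝ → ℂ} {s₁ : ℝ}

/-- The operator factors as (θ - l₁)(θ - l₂), so G = B - l₂A solves a first order equation with
forcing f, and A solves one with forcing G. -/
theorem hasDerivAt_sub_mul_of_system (hA : ∀ s < s₁, HasDerivAt A (B s) s)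
    (hB : ∀ s < s₁, HasDerivAt B ((l₁ + l₂) * B s + -(l₁ * l₂) * A s + f s) s) :
    ∀ s < s₁, HasDerivAt (fun s => B s - l₂ * A s) (l₁ * (B s - l₂ * A s) + f s) s := by
  intro s hs
  exact ((hB s hs).fun_sub ((hA s hs).const_mul l₂)).congr_deriv (by ring)

theorem norm_sub_mul_bounded (hbd : ∃ M T : ℝ, ∀ s < T, ‖A s‖ ≤ M ∧ ‖B s‖ ≤ M) :
    ∃ M T : ℝ, ∀ s < T, ‖B s - l₂ * A s‖ ≤ M := by
  obtain ⟨M, T, h⟩ := hbd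
  refine ⟨M + ‖l₂‖ * M, T, fun s hs => (norm_sub_le _ _).trans ?_⟩
  rw [norm_mul]
  have := h s hs
  gcongr
  exacts [this.2, this.1]

/-- The constant in `norm_le_of_system_of_norm_le`. -/
noncomputable def systemConst (l₁ l₂ : ℂ) : ℝ :=
  1 / -l₁.re + (1 + ‖l₂‖) * (1 / -l₁.re / -l₂.re)

theorem systemConst_nonneg (hl₁ : l₁.re < 0) (hl₂ : l₂.re < 0) : 0 ≤ systemConst l₁ l₂ := by
  have h1 : 0 < -l₁.re := neg_pos.2 hl₁
  have h2 : 0 < -l₂.re := neg_pos.2 hl₂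
  unfold systemConst
  positivity

/-- Bounded forcing: a bounded solution of `θ²A - (l₁ + l₂) θA + l₁ l₂ A = f`. -/
theorem norm_le_of_system_of_norm_le (hl₁ : l₁.re < 0) (hl₂ : l₂.re < 0)
    (hA : ∀ s < s₁, HasDerivAt A (B s) s)
    (hB : ∀ s < s₁, HasDerivAt B ((l₁ + l₂) * B s + -(l₁ * l₂) * A s + f s) s)
    (hbd : ∃ M T : ℝ, ∀ s < T, ‖A s‖ ≤ M ∧ ‖B s‖ ≤ M) {M : ℝ} (hM : 0 ≤ M)
    (hf : ∀ s < s₁, ‖f s‖ ≤ M) {s : ℝ} (hs : s < s₁) :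
    ‖A s‖ ≤ systemConst l₁ l₂ * M ∧ ‖B s‖ ≤ systemConst l₁ l₂ * M := by
  have h1 : 0 < -l₁.re := neg_pos.2 hl₁
  have h2 : 0 < -l₂.re := neg_pos.2 hl₂
  have hG : ∀ s < s₁, ‖B s - l₂ * A s‖ ≤ M / -l₁.re := fun s hs =>
    norm_le_of_supersolution hl₁ (hasDerivAt_sub_mul_of_system hA hB) (norm_sub_mul_bounded hbd)
      (b := fun _ => M / -l₁.re) (b' := fun _ => 0) (fun s _ => hasDerivAt_const s _)
      (fun _ _ => by positivity) (fun s hs => by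
        rw [zero_add, mul_div_cancel₀ _ h1.ne']
        exact hf s hs) hs
  have hAs : ‖A s‖ ≤ M / -l₁.re / -l₂.re :=
    norm_le_of_supersolution hl₂ (f := fun s => B s - l₂ * A s)
      (fun s hs => by convert hA s hs using 1; ring)
      (let ⟨M, T, h⟩ := hbd; ⟨M, T, fun s hs => (h s hs).1⟩)
      (b := fun _ => M / -l₁.re / -l₂.re) (b' := fun _ => 0) (fun s _ => hasDerivAt_const s _)
      (fun _ _ => by positivity) (fun s hs => by
        rw [zero_add, mul_div_cancel₀ _ h2.ne']
        exact hG s hs) hs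
  have hBs : ‖B s‖ ≤ M / -l₁.re + ‖l₂‖ * (M / -l₁.re / -l₂.re) := by
    calc ‖B s‖ = ‖(B s - l₂ * A s) + l₂ * A s‖ := by congr 1; ring
      _ ≤ ‖B s - l₂ * A s‖ + ‖l₂‖ * ‖A s‖ := (norm_add_le _ _).trans (by rw [norm_mul])
      _ ≤ _ := by gcongr; exact hG s hs
  have e : systemConst l₁ l₂ * M = M / -l₁.re + (1 + ‖l₂‖) * (M / -l₁.re / -l₂.re) := by
    unfold systemConst; ring
  have p1 : 0 ≤ M / -l₁.re := by positivity
  have p2 : 0 ≤ M / -l₁.re / -l₂.re := by positivity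
  have p3 : 0 ≤ ‖l₂‖ * (M / -l₁.re / -l₂.re) := by positivity
  rw [e]
  constructor <;> nlinarith

/-- Forcing of size `eˢ (1 - κ eˢ)⁻³`. -/
theorem norm_le_of_system_of_norm_le_weight (hl₁ : l₁.re < 0) (hl₂ : l₂.re < 0)
    (hA : ∀ s < s₁, HasDerivAt A (B s) s)
    (hB : ∀ s < s₁, HasDerivAt B ((l₁ + l₂) * B s + -(l₁ * l₂) * A s + f s) s)
    (hbd : ∃ M T : ℝ, ∀ s < T, ‖A s‖ ≤ M ∧ ‖B s‖ ≤ M) {κ L : ℝ} (hκ : 0 ≤ κ) (hL : 0 ≤ L)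
    (hs₁ : ∀ s < s₁, κ * Real.exp s < 1)
    (hf : ∀ s < s₁, ‖f s‖ ≤ L * Real.exp s / (1 - κ * Real.exp s) ^ 3) {s : ℝ} (hs : s < s₁) :
    ‖A s‖ ≤ (1 + ‖l₂‖) * L * Real.exp s / (1 - κ * Real.exp s) ∧
      ‖B s‖ ≤ (1 + ‖l₂‖) * L * Real.exp s / (1 - κ * Real.exp s) ^ 2 := by
  have h1 : 0 < -l₁.re := neg_pos.2 hl₁
  have h2 : 0 < -l₂.re := neg_pos.2 hl₂
  have hw : ∀ s < s₁, 0 < 1 - κ * Real.exp s := fun s hs => sub_pos.2 (hs₁ s hs)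
  have hwd : ∀ s : ℝ, HasDerivAt (fun s => 1 - κ * Real.exp s) (-(κ * Real.exp s)) s := fun s => by
    simpa using ((Real.hasDerivAt_exp s).const_mul κ).const_sub 1
  have hed : ∀ s : ℝ, HasDerivAt (fun s => L * Real.exp s) (L * Real.exp s) s := fun s =>
    (Real.hasDerivAt_exp s).const_mul L
  -- With w = 1 - κeˢ, the derivative of Leˢw⁻² is Leˢ(1 + κeˢ)w⁻³, which already dominates the
  -- forcing: one integration gains one power of w.
  have hG : ∀ s < s₁, ‖B s - l₂ * A s‖ ≤ L * Real.exp s / (1 - κ * Real.exp s) ^ 2 := fun s hs =>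
    norm_le_of_supersolution hl₁ (hasDerivAt_sub_mul_of_system hA hB) (norm_sub_mul_bounded hbd)
      (b := fun s => L * Real.exp s / (1 - κ * Real.exp s) ^ 2)
      (b' := fun s => L * Real.exp s * (1 + κ * Real.exp s) / (1 - κ * Real.exp s) ^ 3)
      (fun s hs => by
        have := hw s hs
        refine ((hed s).fun_div ((hwd s).fun_pow 2) (pow_ne_zero 2 this.ne')).congr_deriv ?_
        rw [div_eq_div_iff (pow_ne_zero 2 (pow_ne_zero 2 this.ne')) (pow_ne_zero 3 this.ne')]
        push_cast
        ring)
      (fun s hs => by have := hw s hs; positivity) (fun s hs => by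
        have := hw s hs
        refine (hf s hs).trans ?_
        have e1 : L * Real.exp s / (1 - κ * Real.exp s) ^ 3 ≤
            L * Real.exp s * (1 + κ * Real.exp s) / (1 - κ * Real.exp s) ^ 3 := by
          refine div_le_div_of_nonneg_right ?_ (by positivity)
          have : 0 ≤ κ * Real.exp s := by positivity
          exact le_mul_of_one_le_right (by positivity) (by linarith)
        have e2 : 0 ≤ -l₁.re * (L * Real.exp s / (1 - κ * Real.exp s) ^ 2) := by positivity
        linarith) hs
  -- The second power is gained in the same way: the derivative of Leˢw⁻¹ is exactly Leˢw⁻².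
  have hAs : ‖A s‖ ≤ L * Real.exp s / (1 - κ * Real.exp s) :=
    norm_le_of_supersolution hl₂ (f := fun s => B s - l₂ * A s)
      (fun s hs => by convert hA s hs using 1; ring)
      (let ⟨M, T, h⟩ := hbd; ⟨M, T, fun s hs => (h s hs).1⟩)
      (b := fun s => L * Real.exp s / (1 - κ * Real.exp s))
      (b' := fun s => L * Real.exp s / (1 - κ * Real.exp s) ^ 2)
      (fun s hs => by
        have := hw s hs
        refine ((hed s).fun_div (hwd s) this.ne').congr_deriv ?_
        field_simp
        ring)
      (fun s hs => by have := hw s hs; positivity) (fun s hs => by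
        have := hw s hs
        have e2 : 0 ≤ -l₂.re * (L * Real.exp s / (1 - κ * Real.exp s)) := by positivity
        linarith [hG s hs]) hs
  have hws := hw s hs
  have hw1 : 1 - κ * Real.exp s ≤ 1 := by
    have : 0 ≤ κ * Real.exp s := by positivity
    linarith
  have hAs2 : ‖A s‖ ≤ L * Real.exp s / (1 - κ * Real.exp s) ^ 2 := by
    refine hAs.trans ?_
    gcongr
    exact pow_le_of_le_one hws.le hw1 two_ne_zero
  constructor
  · refine hAs.trans ?_
    rw [mul_assoc, mul_div_assoc (1 + ‖l₂‖)]
    exact le_mul_of_one_le_left (by positivity) (by linarith [norm_nonneg l₂])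
  · calc ‖B s‖ = ‖(B s - l₂ * A s) + l₂ * A s‖ := by congr 1; ring
      _ ≤ ‖B s - l₂ * A s‖ + ‖l₂‖ * ‖A s‖ := (norm_add_le _ _).trans (by rw [norm_mul])
      _ ≤ L * Real.exp s / (1 - κ * Real.exp s) ^ 2 +
          ‖l₂‖ * (L * Real.exp s / (1 - κ * Real.exp s) ^ 2) := by gcongr; exact hG s hs
      _ = _ := by ring

end Comparison

/-! ### Size and Lipschitz bounds for the nonlinear part. -/

section Nonlinearity

variable {n : ℕ}

theorem partialZ_eq_fderiv {F : ℂ × (Fin n → ℂ) × (Idx n → ℂ) → ℂ} {t : ℂ} {x : Fin n → ℂ}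
    {z : Idx n → ℂ} (hF : DifferentiableAt ℂ F (t, x, z)) (p : Idx n) :
    partialZ F p t x z = fderiv ℂ F (t, x, z) (0, 0, Pi.single p 1) := by
  have hu : HasDerivAt (fun s => Function.update z p s) (Pi.single p 1 : Idx n → ℂ) (z p) :=
    hasDerivAt_update z p (z p)
  have hl : HasDerivAt (fun s => (t, x, Function.update z p s))
      ((0 : ℂ), (0 : Fin n → ℂ), (Pi.single p 1 : Idx n → ℂ)) (z p) :=
    (hasDerivAt_const _ t).prodMk ((hasDerivAt_const _ x).prodMk hu)
  have h1 : HasFDerivAt F (fderiv ℂ F (t, x, z)) (t, x, Function.update z p (z p)) := by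
    simpa using hF.hasFDerivAt
  exact (HasFDerivAt.comp_hasDerivAt (f := fun s => (t, x, Function.update z p s)) (z p) h1 hl).deriv

/-- `F` minus its linear part at the origin in the slots `(i, 0)`. -/
noncomputable def reducedF (F : ℂ × (Fin n → ℂ) × (Idx n → ℂ) → ℂ) :
    ℂ × (Fin n → ℂ) × (Idx n → ℂ) → ℂ :=
  fun q => F q - ∑ i : Fin 2, partialZ F (Idx.zero i) 0 0 0 * q.2.2 (Idx.zero i)

theorem Idx.eq_zero_of_sum_eq_zero {p : Idx n} (hp : ∑ j, (p.1.2 j : ℕ) = 0) :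
    p = Idx.zero p.1.1 := by
  ext j
  · rfl
  · rw [Finset.sum_eq_zero_iff] at hp
    simpa [Idx.zero] using hp j (Finset.mem_univ j)

theorem IsFuchsian.analyticOnNhd_reducedF {Ω : Set (ℂ × (Fin n → ℂ) × (Idx n → ℂ))}
    {F : ℂ × (Fin n → ℂ) × (Idx n → ℂ) → ℂ} (hF : IsFuchsian Ω F) :
    AnalyticOnNhd ℂ (reducedF F) Ω := by
  refine hF.holomorphic.sub ?_
  refine (analyticOnNhd_iff_differentiableOn_of_isOpen hF.isOpen).2 ?_
  fun_prop

theorem fderiv_reducedF {Ω : Set (ℂ × (Fin n → ℂ) × (Idx n → ℂ))}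
    {F : ℂ × (Fin n → ℂ) × (Idx n → ℂ) → ℂ} (hF : IsFuchsian Ω F) {q} (hq : q ∈ Ω)
    (v : Idx n → ℂ) : fderiv ℂ (reducedF F) q (0, 0, v) =
      fderiv ℂ F q (0, 0, v) - ∑ i : Fin 2, partialZ F (Idx.zero i) 0 0 0 * v (Idx.zero i) := by
  have h2 : HasFDerivAt (fun q : ℂ × (Fin n → ℂ) × (Idx n → ℂ) =>
      ∑ i : Fin 2, partialZ F (Idx.zero i) 0 0 0 * q.2.2 (Idx.zero i))
      (∑ i : Fin 2, partialZ F (Idx.zero i) 0 0 0 •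
        (((ContinuousLinearMap.proj (R := ℂ) (φ := fun _ : Idx n => ℂ) (Idx.zero i)).comp (ContinuousLinearMap.snd ℂ _ _)).comp
          (ContinuousLinearMap.snd ℂ ℂ _))) q := by
    refine HasFDerivAt.fun_sum fun i _ => HasFDerivAt.const_mul ?_ _
    exact (((ContinuousLinearMap.proj (R := ℂ) (φ := fun _ : Idx n => ℂ) (Idx.zero i)).comp
      (ContinuousLinearMap.snd ℂ (Fin n → ℂ) (Idx n → ℂ))).comp
        (ContinuousLinearMap.snd ℂ ℂ ((Fin n → ℂ) × (Idx n → ℂ)))).hasFDerivAt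
  have h3 : HasFDerivAt (reducedF F) _ q :=
    (hF.holomorphic q hq).differentiableAt.hasFDerivAt.fun_sub h2
  rw [h3.fderiv]
  simp

/-- Size and Lipschitz estimates for the nonlinear part near the origin. -/
theorem IsFuchsian.exists_lipschitz {Ω : Set (ℂ × (Fin n → ℂ) × (Idx n → ℂ))}
    {F : ℂ × (Fin n → ℂ) × (Idx n → ℂ) → ℂ} (hF : IsFuchsian Ω F) :
    ∃ r : ℝ, 0 < r ∧ r ≤ 1 ∧ ∃ C : ℝ, 0 < C ∧
      (∀ t x z, ‖t‖ < r → ‖x‖ < r → ‖z‖ < r → (t, x, z) ∈ Ω) ∧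
      (∀ t x, ‖t‖ < r → ‖x‖ < r → ‖reducedF F (t, x, 0)‖ ≤ C * ‖t‖) ∧
      ∀ t x z z', ‖t‖ < r → ‖x‖ < r → ‖z‖ < r → ‖z'‖ < r →
        ‖reducedF F (t, x, z) - reducedF F (t, x, z')‖ ≤
          C * ((‖t‖ + max ‖z‖ ‖z'‖) * ‖z - z'‖ + ‖x‖ * lowNorm (z - z')) := by
  have hH := hF.analyticOnNhd_reducedF
  set H := reducedF F with hHdef
  obtain ⟨K, s, hs, hK⟩ := ((hH.fderiv _ hF.zero_mem).contDiffAt (n := 1)).exists_lipschitzOnWith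
  obtain ⟨K', s', hs', hK'⟩ := ((hH _ hF.zero_mem).contDiffAt (n := 1)).exists_lipschitzOnWith
  obtain ⟨r₀, hr₀, hball⟩ := Metric.nhds_basis_ball.mem_iff.1
    (inter_mem (inter_mem hs hs') (hF.isOpen.mem_nhds hF.zero_mem))
  set r := min r₀ 1
  have hr : 0 < r := lt_min hr₀ one_pos
  have hmem : ∀ t x z, ‖t‖ < r → ‖x‖ < r → ‖z‖ < r → (t, x, z) ∈ s ∩ s' ∩ Ω := by
    intro t x z ht hx hz
    refine hball ?_
    have : ((0, 0, 0) : ℂ × (Fin n → ℂ) × (Idx n → ℂ)) = 0 := rfl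
    rw [this, mem_ball_zero_iff]
    have hle : r ≤ r₀ := min_le_left _ _
    simp only [Prod.norm_def, max_lt_iff]
    exact ⟨ht.trans_le hle, hx.trans_le hle, hz.trans_le hle⟩
  have n0 : ‖(0 : ℂ)‖ < r := by simpa using hr
  have n1 : ‖(0 : Fin n → ℂ)‖ < r := by simpa using hr
  have n2 : ‖(0 : Idx n → ℂ)‖ < r := by simpa using hr
  set N : ℝ := (Fintype.card (Idx n) : ℝ) with hNdef
  have hN : 0 ≤ N := Nat.cast_nonneg _
  -- the derivative in the direction of a coordinate at points `(0, x, 0)`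
  have hcoord : ∀ x : Fin n → ℂ, ‖x‖ < r → ∀ (v : Idx n → ℂ) (p : Idx n),
      ‖v p * fderiv ℂ H (0, x, 0) (0, 0, Pi.single p 1)‖ ≤ K * ‖x‖ * lowNorm v := by
    intro x hx v p
    have hlow : 0 ≤ lowNorm v := (norm_nonneg _).trans (le_max_left _ _)
    have hx' := (hmem 0 x 0 n0 hx n2)
    have h0' := (hmem 0 0 0 n0 n1 n2)
    rcases Nat.eq_zero_or_pos (∑ j, (p.1.2 j : ℕ)) with hp | hp
    · have hpz := Idx.eq_zero_of_sum_eq_zero hp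
      have hvp : ‖v p‖ ≤ lowNorm v := by
        rw [hpz]
        have : ∀ i : Fin 2, ‖v (Idx.zero i)‖ ≤ lowNorm v := by
          intro i
          fin_cases i
          exacts [le_max_left _ _, le_max_right _ _]
        exact this _
      -- In the slots (i, 0) the subtracted linear part cancels the derivative only at the origin,
      -- which is where the term in ‖x‖ comes from.
      have hzero : fderiv ℂ H (0, 0, 0) (0, 0, Pi.single p 1) = 0 := by
        rw [hHdef, fderiv_reducedF hF h0'.2,
          ← partialZ_eq_fderiv (hF.holomorphic _ h0'.2).differentiableAt, sub_eq_zero, hpz]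
        generalize p.1.1 = k
        have hne : (Idx.zero 0 : Idx n) ≠ Idx.zero 1 := by
          intro h
          have := congrArg (fun q : Idx n => q.1.1) h
          simp [Idx.zero] at this
        fin_cases k
        · simp [Fin.sum_univ_two, Pi.single_apply, hne.symm]
        · simp [Fin.sum_univ_two, Pi.single_apply, hne]
      have hd : ‖fderiv ℂ H (0, x, 0) (0, 0, Pi.single p 1)‖ ≤ K * ‖x‖ := by
        have e1 := hK.norm_sub_le hx'.1.1 h0'.1.1
        have e2 : ‖((0, x, 0) : ℂ × (Fin n → ℂ) × (Idx n → ℂ)) - (0, 0, 0)‖ = ‖x‖ := by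
          simp [Prod.norm_def]
        rw [e2] at e1
        have e3 := ContinuousLinearMap.le_of_opNorm_le _ e1
          ((0 : ℂ), (0 : Fin n → ℂ), (Pi.single p 1 : Idx n → ℂ))
        have e4 : ‖((0 : ℂ), (0 : Fin n → ℂ), (Pi.single p 1 : Idx n → ℂ))‖ ≤ 1 := by
          simpa [Prod.norm_def] using norm_single_one_le p
        rw [sub_apply, hzero, sub_zero] at e3
        exact e3.trans (mul_le_of_le_one_right (by positivity) e4)
      rw [norm_mul, mul_comm]
      gcongr
    -- In slots with x-derivatives the Fuchs condition gives vanishing at every (0, x, 0), so the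
    -- term in ‖x‖ involves `lowNorm` only.
    · have : fderiv ℂ H (0, x, 0) (0, 0, Pi.single p 1) = 0 := by
        rw [hHdef, fderiv_reducedF hF hx'.2,
          ← partialZ_eq_fderiv (hF.holomorphic _ hx'.2).differentiableAt,
          hF.partialZ_zero p hp x hx'.2, zero_sub, neg_eq_zero]
        refine Finset.sum_eq_zero fun i _ => ?_
        have : Idx.zero i ≠ p := by
          rintro rfl
          simp [Idx.zero] at hp
        simp [this]
      rw [this]
      simp only [mul_zero, norm_zero]
      positivity
  have hdir : ∀ x : Fin n → ℂ, ‖x‖ < r → ∀ v : Idx n → ℂ,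
      ‖fderiv ℂ H (0, x, 0) (0, 0, v)‖ ≤ N * (K * ‖x‖ * lowNorm v) := by
    intro x hx v
    have e := LinearMap.pi_apply_eq_sum_univ
      (((fderiv ℂ H (0, x, 0)).comp ((ContinuousLinearMap.inr ℂ ℂ _).comp
        (ContinuousLinearMap.inr ℂ (Fin n → ℂ) (Idx n → ℂ)))) : (Idx n → ℂ) →ₗ[ℂ] ℂ) v
    have e' : fderiv ℂ H (0, x, 0) (0, 0, v) =
        ∑ p, v p * fderiv ℂ H (0, x, 0) (0, 0, Pi.single p 1) := by
      have hs : ∀ p : Idx n, (fun q => if p = q then (1 : ℂ) else 0) = Pi.single p 1 := by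
        intro p
        ext q
        simp [Pi.single_apply, eq_comm]
      simpa [hs] using e
    rw [e']
    refine (norm_sum_le _ _).trans ((Finset.sum_le_sum fun p _ => hcoord x hx v p).trans_eq ?_)
    simp [hNdef]
  refine ⟨r, hr, min_le_right _ _, K + K' + N * K + 1, by positivity,
    fun t x z ht hx hz => (hmem t x z ht hx hz).2, fun t x ht hx => ?_, ?_⟩
  · have e1 := hK'.norm_sub_le (hmem t x 0 ht hx n2).1.2 (hmem 0 x 0 n0 hx n2).1.2
    have e2 : H (0, x, 0) = 0 := by
      simp [hHdef, reducedF, hF.apply_zero x (hmem 0 x 0 n0 hx n2).2]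
    have e3 : ‖((t, x, 0) : ℂ × (Fin n → ℂ) × (Idx n → ℂ)) - (0, x, 0)‖ = ‖t‖ := by
      simp [Prod.norm_def]
    rw [e2, e3, sub_zero] at e1
    refine e1.trans ?_
    gcongr
    have : (0 : ℝ) ≤ K := K.2
    nlinarith [mul_nonneg hN this]
  · intro t x z z' ht hx hz hz'
    set m := max ‖z‖ ‖z'‖
    have hseg : ∀ σ ∈ Set.Icc (0 : ℝ) 1, ‖z' + (σ : ℂ) • (z - z')‖ ≤ m := by
      intro σ hσ
      have e : z' + (σ : ℂ) • (z - z') = ((1 - σ : ℝ) : ℂ) • z' + (σ : ℂ) • z := by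
        push_cast
        module
      rw [e]
      refine (norm_add_le _ _).trans ?_
      rw [norm_smul, norm_smul, Complex.norm_real, Complex.norm_real, Real.norm_of_nonneg hσ.1,
        Real.norm_of_nonneg (sub_nonneg.2 hσ.2)]
      have := hσ.1
      have := sub_nonneg.2 hσ.2
      calc (1 - σ) * ‖z'‖ + σ * ‖z‖ ≤ (1 - σ) * m + σ * m := by
            gcongr
            exacts [le_max_right _ _, le_max_left _ _]
        _ = m := by ring
    have hm : m < r := max_lt hz hz'
    have hder : ∀ σ ∈ Set.Icc (0 : ℝ) 1, HasDerivAt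
        (fun σ : ℝ => H (t, x, z' + (σ : ℂ) • (z - z')))
        (fderiv ℂ H (t, x, z' + (σ : ℂ) • (z - z')) (0, 0, z - z')) σ := by
      intro σ hσ
      have hl : HasDerivAt (fun σ : ℝ => ((t, x, z' + (σ : ℂ) • (z - z')) :
          ℂ × (Fin n → ℂ) × (Idx n → ℂ))) (0, 0, z - z') σ := by
        refine (hasDerivAt_const _ t).prodMk ((hasDerivAt_const _ x).prodMk ?_)
        simpa using ((Complex.ofRealCLM.hasDerivAt (x := σ)).smul_const (z - z')).const_add z'
      have hd := (hH _ (hmem t x _ ht hx ((hseg σ hσ).trans_lt hm)).2).differentiableAt.hasFDerivAt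
      exact (hd.restrictScalars ℝ).comp_hasDerivAt σ hl
    -- The derivative on the segment is compared with the one at (0, x, 0), at distance at most ‖t‖
    -- + m.
    have hbound : ∀ σ ∈ Set.Icc (0 : ℝ) 1,
        ‖fderiv ℂ H (t, x, z' + (σ : ℂ) • (z - z')) (0, 0, z - z')‖ ≤
          K * (‖t‖ + m) * ‖z - z'‖ + N * (K * ‖x‖ * lowNorm (z - z')) := by
      intro σ hσ
      have e1 := hK.norm_sub_le (hmem t x _ ht hx ((hseg σ hσ).trans_lt hm)).1.1
        (hmem 0 x 0 n0 hx n2).1.1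
      have e2 : ‖((t, x, z' + (σ : ℂ) • (z - z')) : ℂ × (Fin n → ℂ) × (Idx n → ℂ)) - (0, x, 0)‖ ≤
          ‖t‖ + m := by
        have := hseg σ hσ
        have hm0 : 0 ≤ m := (norm_nonneg _).trans this
        rw [Prod.norm_def, Prod.norm_def]
        refine max_le ?_ (max_le ?_ ?_)
        · simpa using hm0
        · simp only [Prod.snd_sub, Prod.fst_sub, sub_self, norm_zero]
          positivity
        · simp only [Prod.snd_sub, sub_zero]
          linarith [norm_nonneg t]
      have e3 := ContinuousLinearMap.le_of_opNorm_le _ (e1.trans (mul_le_mul_of_nonneg_left e2 K.2))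
        ((0 : ℂ), (0 : Fin n → ℂ), z - z')
      have e4 : ‖((0 : ℂ), (0 : Fin n → ℂ), z - z')‖ = ‖z - z'‖ := by simp [Prod.norm_def]
      rw [e4, sub_apply] at e3
      calc _ ≤ _ := norm_le_norm_sub_add _ (fderiv ℂ H (0, x, 0) (0, 0, z - z'))
        _ ≤ _ := add_le_add e3 (hdir x hx _)
    have := norm_image_sub_le_of_norm_deriv_le_segment_01'
      (fun σ hσ => (hder σ hσ).hasDerivWithinAt) (fun σ hσ => hbound σ (Set.Ico_subset_Icc_self hσ))
    simp only [Complex.ofReal_one, one_smul, add_sub_cancel, Complex.ofReal_zero, zero_smul,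
      add_zero] at this
    refine this.trans ?_
    have hlow : 0 ≤ lowNorm (z - z') := (norm_nonneg _).trans (le_max_left _ _)
    have hm0 : 0 ≤ m := (norm_nonneg _).trans (le_max_left _ _)
    have hK0 : (0 : ℝ) ≤ K := K.2
    have hK0' : (0 : ℝ) ≤ K' := K'.2
    rw [mul_add, ← mul_assoc]
    have f1 : K * (‖t‖ + m) * ‖z - z'‖ ≤ (K + K' + N * K + 1) * (‖t‖ + m) * ‖z - z'‖ := by
      gcongr
      nlinarith [mul_nonneg hN hK0]
    have f2 : N * (K * ‖x‖ * lowNorm (z - z')) ≤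
        (K + K' + N * K + 1) * (‖x‖ * lowNorm (z - z')) := by
      rw [mul_assoc, ← mul_assoc]
      gcongr
      nlinarith [mul_nonneg hN hK0]
    linarith

end Nonlinearity

/-! ### Decay and uniqueness of solutions on a ray. -/

section RaySolutions

variable {n : ℕ}

/-- `l₁, l₂` are the characteristic exponents at the origin, and the nonlinear part of `F` obeys
size and Lipschitz estimates with constant `C` on the polydisc of radius `r`. -/
structure HasReducedBounds (F : ℂ × (Fin n → ℂ) × (Idx n → ℂ) → ℂ) (l₁ l₂ : ℂ) (r C : ℝ) :
    Prop where
  re₁ : l₁.re < 0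
  re₂ : l₂.re < 0
  coeff_zero : partialZ F (Idx.zero 0) 0 0 0 = -(l₁ * l₂)
  coeff_one : partialZ F (Idx.zero 1) 0 0 0 = l₁ + l₂
  r_pos : 0 < r
  r_le_one : r ≤ 1
  C_pos : 0 < C
  norm_le : ∀ t x, ‖t‖ < r → ‖x‖ < r → ‖reducedF F (t, x, 0)‖ ≤ C * ‖t‖
  lipschitz : ∀ t x z z', ‖t‖ < r → ‖x‖ < r → ‖z‖ < r → ‖z'‖ < r →
    ‖reducedF F (t, x, z) - reducedF F (t, x, z')‖ ≤
      C * ((‖t‖ + max ‖z‖ ‖z'‖) * ‖z - z'‖ + ‖x‖ * lowNorm (z - z'))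

/-- The quadratic formula, with d a square root of the discriminant; a double root is simply listed
twice. -/
theorem exists_charExponents {F : ℂ × (Fin n → ℂ) × (Idx n → ℂ) → ℂ}
    (hexp : ∀ l : ℂ, IsCharExponent F 0 l → l.re < 0) :
    ∃ l₁ l₂ : ℂ, l₁.re < 0 ∧ l₂.re < 0 ∧ partialZ F (Idx.zero 0) 0 0 0 = -(l₁ * l₂) ∧
      partialZ F (Idx.zero 1) 0 0 0 = l₁ + l₂ := by
  set c₀ := partialZ F (Idx.zero 0) 0 0 0 with h₀
  set c₁ := partialZ F (Idx.zero 1) 0 0 0 with h₁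
  obtain ⟨d, hd⟩ := IsAlgClosed.exists_pow_nat_eq (c₁ ^ 2 + 4 * c₀) (n := 2) two_pos
  refine ⟨(c₁ + d) / 2, (c₁ - d) / 2, hexp _ ?_, hexp _ ?_, ?_, ?_⟩
  · rw [IsCharExponent, Fin.sum_univ_two, ← h₀, ← h₁]
    simp only [Fin.val_zero, Fin.val_one]
    linear_combination hd / 4
  · rw [IsCharExponent, Fin.sum_univ_two, ← h₀, ← h₁]
    simp only [Fin.val_zero, Fin.val_one]
    linear_combination hd / 4
  · linear_combination -hd / 4
  · ring

variable {F : ℂ × (Fin n → ℂ) × (Idx n → ℂ) → ℂ} {l₁ l₂ : ℂ} {r C : ℝ}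

theorem HasReducedBounds.apply_spatialJet (hH : HasReducedBounds F l₁ l₂ r C) (t : ℂ)
    (x : Fin n → ℂ) (a b : (Fin n → ℂ) → ℂ) : F (t, x, spatialJet a b x) =
      (l₁ + l₂) * b x + -(l₁ * l₂) * a x + reducedF F (t, x, spatialJet a b x) := by
  simp only [reducedF, Fin.sum_univ_two, hH.coeff_zero, hH.coeff_one, spatialJet_zero]
  simp
  ring

theorem spatialJet_zero_zero (x : Fin n → ℂ) : spatialJet (fun _ => 0) (fun _ => 0) x = 0 := by
  have h : ∀ α : Fin n → ℕ, Set.EqOn (multiPartialX α fun _ : Fin n → ℂ => (0 : ℂ)) 0 Set.univ := by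
    intro α
    refine multiPartialX_induction (S := Unit) (Q := fun _ v _ => Set.EqOn (v ()) 0 Set.univ)
      (fun _ v w j hv => ?_) (v := fun _ _ => 0) (w := fun _ _ => 0) (fun _ _ => rfl) α
    refine (partialX_congr isOpen_univ hv j).trans fun x _ => ?_
    simp [partialX]
  ext p
  simp only [spatialJet, ite_self, Pi.zero_apply]
  exact h _ (Set.mem_univ x)

/-- A solution of the equation on the ray `arg t = φ`, with `A = u`, `B = t ∂u/∂t`. -/
structure IsRaySolution (F : ℂ × (Fin n → ℂ) × (Idx n → ℂ) → ℂ) (φ R T : ℝ)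
    (A B : ℝ → (Fin n → ℂ) → ℂ) : Prop where
  analytic_left : ∀ s < T, AnalyticOnNhd ℂ (A s) (polydisc n R)
  analytic_right : ∀ s < T, AnalyticOnNhd ℂ (B s) (polydisc n R)
  hasDerivAt_left : ∀ s < T, ∀ x ∈ polydisc n R, HasDerivAt (fun s => A s x) (B s x) s
  hasDerivAt_right : ∀ s < T, ∀ x ∈ polydisc n R, HasDerivAt (fun s => B s x)
    (F (Complex.exp (s + φ * Complex.I), x, spatialJet (A s) (B s) x)) s

theorem norm_exp_ray (s φ : ℝ) : ‖Complex.exp (s + φ * Complex.I)‖ = Real.exp s := by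
  rw [Complex.norm_exp]; simp

theorem IsRaySolution.mono {φ R R' T T' : ℝ} {A B : ℝ → (Fin n → ℂ) → ℂ}
    (h : IsRaySolution F φ R T A B) (hR : R' ≤ R) (hT : T' ≤ T) : IsRaySolution F φ R' T' A B where
  analytic_left s hs := (h.analytic_left s (hs.trans_le hT)).mono fun _ hx => lt_of_lt_of_le hx hR
  analytic_right s hs := (h.analytic_right s (hs.trans_le hT)).mono fun _ hx => lt_of_lt_of_le hx hR
  hasDerivAt_left s hs x hx := h.hasDerivAt_left s (hs.trans_le hT) x (lt_of_lt_of_le hx hR)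
  hasDerivAt_right s hs x hx := h.hasDerivAt_right s (hs.trans_le hT) x (lt_of_lt_of_le hx hR)

/-- The case y = 0 of the cone estimate, where the slice is the whole polydisc and the weight is 1,
applied to the difference from the zero functions. -/
theorem norm_spatialJet_le_of_norm_le {ρ ρ' m : ℝ} (hρ : ρ < ρ') (hρ' : ρ' ≤ 1) (hm : 0 ≤ m)
    {a b : (Fin n → ℂ) → ℂ} (ha : AnalyticOnNhd ℂ a (polydisc n ρ'))
    (hb : AnalyticOnNhd ℂ b (polydisc n ρ')) (ham : ∀ x ∈ polydisc n ρ', ‖a x‖ ≤ m)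
    (hbm : ∀ x ∈ polydisc n ρ', ‖b x‖ ≤ m) {x : Fin n → ℂ} (hx : x ∈ polydisc n ρ) :
    ‖spatialJet a b x‖ ≤ 65536 * m / (ρ' - ρ) ^ 2 := by
  have hx1 : ‖x‖ < ρ := hx
  have h := norm_spatialJet_sub_le (y := 0) (B := m) (a := a) (b := b) (a' := fun _ => 0)
    (b' := fun _ => 0) hρ' le_rfl hm (by rwa [coneSlice_zero]) (by rwa [coneSlice_zero])
    (fun _ _ => analyticAt_const) (fun _ _ => analyticAt_const)
    (by simpa [coneSlice_zero, coneWeight_zero] using ham)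
    (by simpa [coneSlice_zero, coneWeight_zero] using hbm) (x := x)
    (by rw [coneSlice_zero]; exact hx1.trans hρ)
  rw [spatialJet_zero_zero, sub_zero, coneWeight_zero, one_pow, mul_one] at h
  refine h.trans ?_
  have : 0 < ρ' - ρ := sub_pos.2 hρ
  gcongr

/-- A bound on a polydisc improves on a smaller polydisc to the size of `t` plus the square of
the bound. -/
theorem IsRaySolution.improve_bound (hH : HasReducedBounds F l₁ l₂ r C) {φ ρ ρ' T m : ℝ}
    {A B : ℝ → (Fin n → ℂ) → ℂ} (h : IsRaySolution F φ ρ' T A B) (hρ : ρ < ρ')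
    (hρr : ρ' ≤ r) (hρC : systemConst l₁ l₂ * (C * ρ') ≤ 1 / 2)
    (hT : Real.exp T ≤ r) (hm0 : 0 ≤ m)
    (hm : ∀ s < T, ∀ x ∈ polydisc n ρ', ‖A s x‖ ≤ m ∧ ‖B s x‖ ≤ m)
    (hmr : 65536 * m / (ρ' - ρ) ^ 2 < r) :
    ∀ s < T, ∀ x ∈ polydisc n ρ,
      ‖A s x‖ ≤ 2 * systemConst l₁ l₂ * C * (2 * Real.exp T + (65536 * m / (ρ' - ρ) ^ 2) ^ 2) ∧
      ‖B s x‖ ≤ 2 * systemConst l₁ l₂ * C * (2 * Real.exp T + (65536 * m / (ρ' - ρ) ^ 2) ^ 2) := by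
  set j := 65536 * m / (ρ' - ρ) ^ 2 with hj
  set K := systemConst l₁ l₂ with hK
  have hK0 : 0 ≤ K := systemConst_nonneg hH.re₁ hH.re₂
  have hC0 := hH.C_pos
  have hj0 : 0 ≤ j := by positivity
  have hj1 : j ≤ 1 := hmr.le.trans hH.r_le_one
  have hsub : ∀ x ∈ polydisc n ρ, x ∈ polydisc n ρ' := fun x hx => lt_trans hx hρ
  have hJ : ∀ s < T, ∀ x ∈ polydisc n ρ, ‖spatialJet (A s) (B s) x‖ ≤ j := fun s hs x hx =>
    norm_spatialJet_le_of_norm_le hρ (hρr.trans hH.r_le_one) hm0 (h.analytic_left s hs)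
      (h.analytic_right s hs) (fun x hx => (hm s hs x hx).1) (fun x hx => (hm s hs x hx).2) hx
  have hr := hH.r_pos
  have n2 : ‖(0 : Idx n → ℂ)‖ < r := by simpa using hr
  set β := K * C * (2 * Real.exp T + j ^ 2) with hβ
  have hβ0 : 0 ≤ β := by positivity
  -- The term of the Lipschitz bound that is not small with t or the jet is C‖x‖ `lowNorm`. It
  -- involves no x-derivatives, so it costs no radius, and for ρ' small it contributes at most a/2.
  have step : ∀ a : ℝ, 0 ≤ a → (∀ s < T, ∀ x ∈ polydisc n ρ, ‖A s x‖ ≤ a ∧ ‖B s x‖ ≤ a) →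
      ∀ s < T, ∀ x ∈ polydisc n ρ, ‖A s x‖ ≤ β + a / 2 ∧ ‖B s x‖ ≤ β + a / 2 := by
    intro a ha hab s hs x hx
    have hxρ : ‖x‖ < ρ' := hsub x hx
    have hforce : ∀ s < T, ‖reducedF F (Complex.exp (s + φ * Complex.I), x,
        spatialJet (A s) (B s) x)‖ ≤ C * (2 * Real.exp T + j ^ 2 + ρ' * a) := by
      intro s hs
      have ht : ‖Complex.exp (s + φ * Complex.I)‖ < r := by
        rw [norm_exp_ray]
        exact (Real.exp_lt_exp.2 hs).trans_le hT
      have hxr : ‖x‖ < r := hxρ.trans_le hρr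
      have hJs := hJ s hs x hx
      have e1 := hH.norm_le _ x ht hxr
      have e2 := hH.lipschitz _ x (spatialJet (A s) (B s) x) 0 ht hxr (hJs.trans_lt hmr) n2
      have e3 : lowNorm (spatialJet (A s) (B s) x - 0) ≤ a := by
        rw [← spatialJet_zero_zero x]
        exact lowNorm_spatialJet_sub_le (by simpa using (hab s hs x hx).1)
          (by simpa using (hab s hs x hx).2)
      have e4 : ‖Complex.exp (s + φ * Complex.I)‖ ≤ Real.exp T := by
        rw [norm_exp_ray]
        exact (Real.exp_lt_exp.2 hs).le
      rw [sub_zero, norm_zero, max_eq_left (norm_nonneg _)] at e2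
      rw [sub_zero] at e3
      have hTp := Real.exp_pos T
      have hT1 : Real.exp T ≤ 1 := hT.trans hH.r_le_one
      have e5 : 0 ≤ lowNorm (spatialJet (A s) (B s) x) := (norm_nonneg _).trans (le_max_left _ _)
      have e6 : 0 ≤ ρ' := (norm_nonneg x).trans hxρ.le
      calc ‖reducedF F (Complex.exp (s + φ * Complex.I), x, spatialJet (A s) (B s) x)‖
          ≤ _ := norm_le_norm_sub_add _ (reducedF F (Complex.exp (s + φ * Complex.I), x, 0))
        _ ≤ _ := add_le_add e2 e1
        _ ≤ C * ((Real.exp T + j) * j + ρ' * a) + C * Real.exp T := by gcongr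
        _ ≤ C * (2 * Real.exp T + j ^ 2 + ρ' * a) := by
          rw [← mul_add]
          refine mul_le_mul_of_nonneg_left ?_ hC0.le
          nlinarith
    have hρ'0 : 0 ≤ ρ' := (norm_nonneg x).trans hxρ.le
    have := norm_le_of_system_of_norm_le hH.re₁ hH.re₂ (A := fun s => A s x) (B := fun s => B s x)
      (f := fun s => reducedF F (Complex.exp (s + φ * Complex.I), x, spatialJet (A s) (B s) x))
      (s₁ := T) (fun s hs => h.hasDerivAt_left s hs x (hsub x hx))
      (fun s hs => by
        rw [← hH.apply_spatialJet]
        exact h.hasDerivAt_right s hs x (hsub x hx))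
      ⟨m, T, fun s hs => hm s hs x (hsub x hx)⟩ (by positivity) hforce hs
    have e : K * (C * (2 * Real.exp T + j ^ 2 + ρ' * a)) ≤ β + a / 2 := by
      rw [hβ]
      nlinarith
    exact ⟨this.1.trans e, this.2.trans e⟩
  -- Repeating a ↦ β + a/2 from a = m on the same polydisc absorbs that term and leaves 2β in the
  -- limit.
  have iter : ∀ k : ℕ, ∀ s < T, ∀ x ∈ polydisc n ρ,
      ‖A s x‖ ≤ 2 * β + m * (1 / 2) ^ k ∧ ‖B s x‖ ≤ 2 * β + m * (1 / 2) ^ k := by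
    intro k
    induction k with
    | zero =>
      intro s hs x hx
      have := hm s hs x (hsub x hx)
      simp only [pow_zero, mul_one]
      exact ⟨by linarith [this.1], by linarith [this.2]⟩
    | succ k ih =>
      intro s hs x hx
      have := step _ (by positivity) ih s hs x hx
      rw [pow_succ]
      exact ⟨by linarith [this.1], by linarith [this.2]⟩
  have hlim : Tendsto (fun k : ℕ => 2 * β + m * (1 / 2) ^ k) atTop (𝓝 (2 * β + m * 0)) :=
    tendsto_const_nhds.add ((tendsto_pow_atTop_nhds_zero_of_lt_one (by norm_num)
      (by norm_num)).const_mul m)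
  intro s hs x hx
  have e : 2 * β + m * 0 = 2 * K * C * (2 * Real.exp T + j ^ 2) := by rw [hβ]; ring
  rw [e] at hlim
  exact ⟨ge_of_tendsto' hlim fun k => (iter k s hs x hx).1,
    ge_of_tendsto' hlim fun k => (iter k s hs x hx).2⟩

/-- A solution on a ray that is small enough is `O(|t|)`. -/
theorem IsRaySolution.exists_bound (hH : HasReducedBounds F l₁ l₂ r C) {R : ℝ} (hR : 0 < R)
    (hRr : R ≤ r) (hRC : systemConst l₁ l₂ * (C * R) ≤ 1 / 2) :
    ∃ ε : ℝ, 0 < ε ∧ ∃ M : ℝ, 0 < M ∧ ∀ (φ T : ℝ) (A B : ℝ → (Fin n → ℂ) → ℂ), Real.exp T ≤ r →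
      IsRaySolution F φ R T A B →
      (∀ s < T, ∀ x ∈ polydisc n R, ‖A s x‖ ≤ ε ∧ ‖B s x‖ ≤ ε) →
      ∀ s < T, ∀ x ∈ polydisc n (R / 2), ‖A s x‖ ≤ M * Real.exp s ∧ ‖B s x‖ ≤ M * Real.exp s := by
  set K := systemConst l₁ l₂ with hK
  have hK0 : 0 ≤ K := systemConst_nonneg hH.re₁ hH.re₂
  have hC0 := hH.C_pos
  have hr := hH.r_pos
  set K₁ := 4 * K * C + 1 with hK₁
  set K₂ := 2 * K * C * 65536 ^ 2 + 1 with hK₂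
  have hK₁0 : 0 < K₁ := by positivity
  have hK₂0 : 0 < K₂ := by positivity
  -- The first bound keeps the jets inside the ball of radius r, where the Lipschitz estimate holds;
  -- the second makes the quadratic term at each stage at most half of the next target.
  set ε := min (r * R ^ 2 / 2 ^ 21) (R ^ 4 / (K₂ * 2 ^ 15)) with hε
  have hε0 : 0 < ε := lt_min (by positivity) (by positivity)
  have hε1 : 2 ^ 20 * ε < r * R ^ 2 := by
    have : ε ≤ r * R ^ 2 / 2 ^ 21 := min_le_left _ _
    have h2 : 0 < r * R ^ 2 := by positivity
    rw [le_div_iff₀ (by positivity)] at this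
    linarith
  have hε2 : K₂ * ε * 2 ^ 15 ≤ R ^ 4 := by
    have : ε ≤ R ^ 4 / (K₂ * 2 ^ 15) := min_le_right _ _
    rw [le_div_iff₀ (by positivity)] at this
    linarith
  have main : ∀ (φ T : ℝ) (A B : ℝ → (Fin n → ℂ) → ℂ), Real.exp T ≤ r →
      IsRaySolution F φ R T A B →
      (∀ s < T, ∀ x ∈ polydisc n R, ‖A s x‖ ≤ ε ∧ ‖B s x‖ ≤ ε) →
      ∀ s < T, ∀ x ∈ polydisc n (R / 2), ‖A s x‖ ≤ 2 * K₁ * Real.exp T ∧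
        ‖B s x‖ ≤ 2 * K₁ * Real.exp T := by
    intro φ T A B hT h hsmall
    have hTp := Real.exp_pos T
    -- The radii decrease to R/2 with gaps (R/4)2⁻ᵏ, so passing to jets costs a factor of order 4ᵏ.
    -- A bound ε64⁻ᵏ gives jets of order 16⁻ᵏ, whose square 256⁻ᵏ is below the next target. The
    -- first alternative records that the term of size eᵀ has become dominant, which is the desired
    -- bound.
    have claim : ∀ k : ℕ, (∀ s < T, ∀ x ∈ polydisc n (R / 2), ‖A s x‖ ≤ 2 * K₁ * Real.exp T ∧
        ‖B s x‖ ≤ 2 * K₁ * Real.exp T) ∨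
        ∀ s < T, ∀ x ∈ polydisc n (R / 2 + R / 2 * (1 / 2) ^ k), ‖A s x‖ ≤ ε * (1 / 64) ^ k ∧
          ‖B s x‖ ≤ ε * (1 / 64) ^ k := by
      intro k
      induction k with
      | zero => exact Or.inr (by simpa using hsmall)
      | succ k ih =>
        rcases ih with ih | ih
        · exact Or.inl ih
        set ρ' := R / 2 + R / 2 * (1 / 2) ^ k with hρ'
        set ρ := R / 2 + R / 2 * (1 / 2) ^ (k + 1) with hρ
        have hpk : (0 : ℝ) < (1 / 2) ^ k := by positivity
        have hpk1 : ((1 : ℝ) / 2) ^ k ≤ 1 := pow_le_one₀ (by norm_num) (by norm_num)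
        have hdiff : ρ' - ρ = R / 4 * (1 / 2) ^ k := by rw [hρ, hρ', pow_succ]; ring
        have hρ'R : ρ' ≤ R := by rw [hρ']; nlinarith
        have hlt : ρ < ρ' := by
          have : 0 < ρ' - ρ := by rw [hdiff]; positivity
          linarith
        have hj : 65536 * (ε * (1 / 64) ^ k) / (ρ' - ρ) ^ 2 =
            2 ^ 20 * ε / R ^ 2 * (1 / 16) ^ k := by
          have e : ((1 : ℝ) / 64) ^ k = (1 / 16) ^ k * ((1 / 2) ^ k) ^ 2 := by
            rw [← pow_mul, mul_comm k 2, pow_mul, ← mul_pow]; norm_num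
          rw [hdiff, e]
          field_simp
          ring
        have h16 : ((1 : ℝ) / 16) ^ k ≤ 1 := pow_le_one₀ (by norm_num) (by norm_num)
        have hjr : 65536 * (ε * (1 / 64) ^ k) / (ρ' - ρ) ^ 2 < r := by
          rw [hj]
          have : 2 ^ 20 * ε / R ^ 2 < r := (div_lt_iff₀ (by positivity)).2 hε1
          have h0 : 0 ≤ 2 ^ 20 * ε / R ^ 2 := by positivity
          nlinarith
        have hCρ : K * (C * ρ') ≤ 1 / 2 := by
          refine le_trans ?_ hRC
          gcongr
        have himp := (h.mono hρ'R le_rfl).improve_bound hH hlt (hρ'R.trans hRr) hCρ hT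
          (by positivity) ih hjr
        rw [hj] at himp
        have hbound : 2 * K * C * (2 * Real.exp T + (2 ^ 20 * ε / R ^ 2 * (1 / 16) ^ k) ^ 2) ≤
            K₁ * Real.exp T + ε * (1 / 64) ^ (k + 1) / 2 := by
          have e1 : ((1 : ℝ) / 16) ^ k * (1 / 16) ^ k ≤ (1 / 64) ^ k := by
            rw [← mul_pow]
            gcongr
            norm_num
          have e2 : 2 * K * C * (2 ^ 20 * ε / R ^ 2 * (1 / 16) ^ k) ^ 2 ≤
              ε * (1 / 64) ^ (k + 1) / 2 := by
            have e3 : 2 * K * C * (2 ^ 20 * ε / R ^ 2 * (1 / 16) ^ k) ^ 2 =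
                (2 * K * C * 65536 ^ 2) * ε * 256 / R ^ 4 * ε *
                  ((1 / 16) ^ k * (1 / 16) ^ k) := by
              field_simp
              ring
            have e4 : (2 * K * C * 65536 ^ 2) * ε * 256 / R ^ 4 ≤ 1 / 128 := by
              rw [div_le_iff₀ (by positivity)]
              have : (2 * K * C * 65536 ^ 2) * ε ≤ K₂ * ε := by
                gcongr
                rw [hK₂]; linarith
              linarith
            rw [e3]
            calc _ ≤ 1 / 128 * ε * (1 / 64) ^ k := by gcongr
              _ = _ := by rw [pow_succ]; ring
          have e5 : 4 * K * C * Real.exp T ≤ K₁ * Real.exp T := by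
            gcongr
            rw [hK₁]; linarith
          linarith
        rcases le_total (K₁ * Real.exp T) (ε * (1 / 64) ^ (k + 1) / 2) with hle | hle
        · refine Or.inr fun s hs x hx => ?_
          have := himp s hs x hx
          exact ⟨by linarith [this.1], by linarith [this.2]⟩
        · refine Or.inl fun s hs x hx => ?_
          have hx' : x ∈ polydisc n ρ :=
            lt_of_lt_of_le hx (by
              have : 0 ≤ R / 2 * (1 / 2) ^ (k + 1) := by positivity
              linarith : R / 2 ≤ ρ)
          have := himp s hs x hx'
          exact ⟨by linarith [this.1], by linarith [this.2]⟩
    obtain ⟨k, hk⟩ := exists_pow_lt_of_lt_one (show 0 < 2 * K₁ * Real.exp T / ε by positivity)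
      (show (1 / 64 : ℝ) < 1 by norm_num)
    rcases claim k with hk' | hk'
    · exact hk'
    · intro s hs x hx
      have hx' : x ∈ polydisc n (R / 2 + R / 2 * (1 / 2) ^ k) :=
        lt_of_lt_of_le hx (by
          have : 0 ≤ R / 2 * (1 / 2) ^ k := by positivity
          linarith : R / 2 ≤ R / 2 + R / 2 * (1 / 2) ^ k)
      have := hk' s hs x hx'
      rw [lt_div_iff₀ hε0] at hk
      exact ⟨by linarith [this.1], by linarith [this.2]⟩
  refine ⟨ε, hε0, 2 * K₁ * Real.exp 1, by positivity, fun φ T A B hT h hsmall s hs x hx => ?_⟩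
  -- Cutting the ray just after s turns a bound by eᵀ into one by eˢ; the extra 1 keeps s strictly
  -- below the cut and costs a factor e.
  have h1 := main φ (min T (s + 1)) A B ((Real.exp_le_exp.2 (min_le_left _ _)).trans hT)
    (h.mono le_rfl (min_le_left _ _))
    (fun s hs => hsmall s (hs.trans_le (min_le_left _ _))) s (lt_min hs (by linarith)) x hx
  have h2 : Real.exp (min T (s + 1)) ≤ Real.exp 1 * Real.exp s := by
    rw [← Real.exp_add, add_comm 1 s]
    exact Real.exp_le_exp.2 (min_le_right _ _)
  have h3 : 2 * K₁ * Real.exp (min T (s + 1)) ≤ 2 * K₁ * Real.exp 1 * Real.exp s := by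
    rw [mul_assoc (2 * K₁)]
    gcongr
  exact ⟨h1.1.trans h3, h1.2.trans h3⟩

/-- Jets that differ by a weighted bound have a much smaller difference of nonlinear parts. -/
theorem HasReducedBounds.norm_sub_le_of_cone (hH : HasReducedBounds F l₁ l₂ r C)
    {M R E L κ ω : ℝ} {c : ℝ} (hM : 0 ≤ M) (hE : 0 ≤ E) (hL : 0 ≤ L) (hκ : 0 < κ) (hω : 0 < ω)
    (hc : 64 * (C * (1 + M) * 65536 * κ) ≤ c) (hc0 : 0 < c) (hR : 64 * (C * R * κ) ≤ 1)
    (hR1 : R ≤ 1)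
    {t : ℂ} {x : Fin n → ℂ} {z z' : Idx n → ℂ} (ht : ‖t‖ = E) (hx : ‖x‖ < R)
    (htr : ‖t‖ < r) (hxr : ‖x‖ < r) (hzr : ‖z‖ < r) (hzr' : ‖z'‖ < r)
    (hcE : c * E ≤ (R - ‖x‖) ^ 4) (hz : ‖z‖ ≤ M * E / (R - ‖x‖) ^ 2)
    (hz' : ‖z'‖ ≤ M * E / (R - ‖x‖) ^ 2)
    (hd : ‖z - z'‖ ≤ 65536 * (κ * L * E) / ((R - ‖x‖) ^ 2 * ω ^ 3))
    (hlow : lowNorm (z - z') ≤ κ * L * E / ω ^ 3) :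
    ‖reducedF F (t, x, z) - reducedF F (t, x, z')‖ ≤ L / 32 * E / ω ^ 3 := by
  have hC := hH.C_pos
  set d := R - ‖x‖ with hdd
  have hd0 : 0 < d := sub_pos.2 hx
  have hd1 : d ≤ 1 := by linarith [norm_nonneg x]
  have hd2 : d ^ 2 ≤ 1 := pow_le_one₀ hd0.le hd1
  have h1 : ‖t‖ + max ‖z‖ ‖z'‖ ≤ (1 + M) * E / d ^ 2 := by
    have e1 : E ≤ E / d ^ 2 := le_div_self hE (by positivity) hd2
    calc ‖t‖ + max ‖z‖ ‖z'‖ ≤ E / d ^ 2 + M * E / d ^ 2 :=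
          add_le_add (ht.le.trans e1) (max_le hz hz')
      _ = _ := by ring
  -- This is the reason for the exponent 4 in the cone: d⁻² comes from the two x-derivatives and d⁻²
  -- from the bound on the jets in the Lipschitz factor.
  have h2 : E / d ^ 4 ≤ 1 / c := by
    rw [div_le_div_iff₀ (by positivity) hc0]
    linarith
  have hq : 0 ≤ L * E / ω ^ 3 := by positivity
  calc ‖reducedF F (t, x, z) - reducedF F (t, x, z')‖
      ≤ C * ((‖t‖ + max ‖z‖ ‖z'‖) * ‖z - z'‖ + ‖x‖ * lowNorm (z - z')) :=
        hH.lipschitz t x z z' htr hxr hzr hzr'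
    _ ≤ C * ((1 + M) * E / d ^ 2 * (65536 * (κ * L * E) / (d ^ 2 * ω ^ 3)) +
          R * (κ * L * E / ω ^ 3)) := by
        have : 0 ≤ lowNorm (z - z') := (norm_nonneg _).trans (le_max_left _ _)
        have hR0 : 0 ≤ R := (norm_nonneg x).trans hx.le
        gcongr
    _ = (C * (1 + M) * 65536 * κ * (E / d ^ 4) + C * R * κ) * (L * E / ω ^ 3) := by
        field_simp
    _ ≤ (1 / 64 + 1 / 64) * (L * E / ω ^ 3) := by
        gcongr
        · calc C * (1 + M) * 65536 * κ * (E / d ^ 4) ≤ C * (1 + M) * 65536 * κ * (1 / c) := by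
                gcongr
            _ ≤ 1 / 64 := by
                rw [mul_one_div, div_le_div_iff₀ hc0 (by norm_num)]
                linarith
        · linarith
    _ = L / 32 * E / ω ^ 3 := by ring

/-- Two solutions on a ray whose jets are `O(|t|)` coincide near the origin. -/
theorem IsRaySolution.eq_of_norm_spatialJet_le (hH : HasReducedBounds F l₁ l₂ r C) {R M : ℝ}
    (hRr : R ≤ r) (hRC : 64 * (C * R * (1 + ‖l₂‖)) ≤ 1) (hM : 0 ≤ M) {φ T : ℝ}
    (hT : Real.exp T ≤ r) (hMT : M * Real.exp T < r) {A B A' B' : ℝ → (Fin n → ℂ) → ℂ}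
    (h : IsRaySolution F φ R T A B) (h' : IsRaySolution F φ R T A' B')
    (hJ : ∀ s < T, ∀ x ∈ polydisc n R, ‖spatialJet (A s) (B s) x‖ ≤ M * Real.exp s)
    (hJ' : ∀ s < T, ∀ x ∈ polydisc n R, ‖spatialJet (A' s) (B' s) x‖ ≤ M * Real.exp s) :
    ∃ c : ℝ, 0 < c ∧ ∀ s < T, ∀ x ∈ coneSlice n R (c * Real.exp s), A s x = A' s x := by
  set κ := 1 + ‖l₂‖ with hκ
  have hκ0 : 0 < κ := by positivity
  have hC := hH.C_pos
  have hR1 : R ≤ 1 := hRr.trans hH.r_le_one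
  set c := 64 * (C * (1 + M) * 65536 * κ) with hc
  have hc0 : 0 < c := by positivity
  refine ⟨c, hc0, ?_⟩
  have hpd : ∀ s x, x ∈ coneSlice n R (c * Real.exp s) → x ∈ polydisc n R := fun s x hx => hx.1
  have hE1 : ∀ s < T, Real.exp s < r := fun s hs => (Real.exp_lt_exp.2 hs).trans_le hT
  have hJr : ∀ s < T, M * Real.exp s < r := fun s hs => by
    refine lt_of_le_of_lt ?_ hMT
    gcongr
  set Δ : ℝ → (Fin n → ℂ) → ℂ := fun s x =>
    reducedF F (Complex.exp (s + φ * Complex.I), x, spatialJet (A s) (B s) x) -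
      reducedF F (Complex.exp (s + φ * Complex.I), x, spatialJet (A' s) (B' s) x) with hΔ
  -- a bound for the difference of the nonlinear parts gives a bound for the difference
  have solve : ∀ L : ℝ, 0 ≤ L → (∀ s < T, ∀ x ∈ coneSlice n R (c * Real.exp s),
      ‖Δ s x‖ ≤ L * Real.exp s / coneWeight R (c * Real.exp s) x ^ 3) →
      ∀ s < T, ∀ x ∈ coneSlice n R (c * Real.exp s),
        ‖A s x - A' s x‖ ≤ κ * L * Real.exp s / coneWeight R (c * Real.exp s) x ∧
        ‖B s x - B' s x‖ ≤ κ * L * Real.exp s / coneWeight R (c * Real.exp s) x ^ 2 := by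
    intro L hL hΔL s hs x hx
    have hd : 0 < R - ‖x‖ := sub_pos.2 hx.1
    have hd4 : 0 < (R - ‖x‖) ^ 4 := by positivity
    have hx1 : x ∈ polydisc n R := hx.1
    -- For fixed x, the second entry is the value of s at which the ray leaves the cone.
    set s₁ := min T (Real.log ((R - ‖x‖) ^ 4 / c)) with hs₁
    have hlog : ∀ s < s₁, c * Real.exp s < (R - ‖x‖) ^ 4 := by
      intro s hs
      have := (Real.lt_log_iff_exp_lt (by positivity)).1 (hs.trans_le (min_le_right _ _))
      rw [lt_div_iff₀ hc0] at this
      linarith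
    have hss : s < s₁ := by
      refine lt_min hs ((Real.lt_log_iff_exp_lt (by positivity)).2 ?_)
      rw [lt_div_iff₀ hc0]
      linarith [hx.2]
    have hw : ∀ s, coneWeight R (c * Real.exp s) x = 1 - c / (R - ‖x‖) ^ 4 * Real.exp s :=
      fun s => by rw [coneWeight]; ring
    have hT' : ∀ s < s₁, s < T := fun s hs => hs.trans_le (min_le_left _ _)
    have := norm_le_of_system_of_norm_le_weight hH.re₁ hH.re₂ (A := fun s => A s x - A' s x)
      (B := fun s => B s x - B' s x) (f := fun s => Δ s x) (s₁ := s₁)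
      (κ := c / (R - ‖x‖) ^ 4) (L := L)
      (fun s hs => (h.hasDerivAt_left s (hT' s hs) x hx1).sub
        (h'.hasDerivAt_left s (hT' s hs) x hx1))
      (fun s hs => by
        have e1 := h.hasDerivAt_right s (hT' s hs) x hx1
        have e2 := h'.hasDerivAt_right s (hT' s hs) x hx1
        rw [hH.apply_spatialJet] at e1 e2
        exact (e1.fun_sub e2).congr_deriv (by simp only [hΔ]; ring))
      (by
        refine ⟨2 * (M * Real.exp T), T, fun s hs => ?_⟩
        have hle : M * Real.exp s ≤ M * Real.exp T := by gcongr
        have key : ∀ {a b : (Fin n → ℂ) → ℂ}, ‖spatialJet a b x‖ ≤ M * Real.exp s →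
            ‖a x‖ ≤ M * Real.exp T ∧ ‖b x‖ ≤ M * Real.exp T := by
          intro a b hab
          have f0 := norm_le_pi_norm (spatialJet a b x) (Idx.zero 0)
          have f1 := norm_le_pi_norm (spatialJet a b x) (Idx.zero 1)
          rw [spatialJet_zero] at f0 f1
          simp only [if_true, one_ne_zero, if_false] at f0 f1
          exact ⟨by linarith, by linarith⟩
        have k1 := key (hJ s hs x hx1)
        have k2 := key (hJ' s hs x hx1)
        exact ⟨(norm_sub_le _ _).trans (by linarith [k1.1, k2.1]),
          (norm_sub_le _ _).trans (by linarith [k1.2, k2.2])⟩)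
      (by positivity) hL
      (fun s hs => by
        rw [div_mul_eq_mul_div, div_lt_one hd4]
        exact hlog s hs)
      (fun s hs => by
        rw [← hw]
        exact hΔL s (hT' s hs) x ⟨hx.1, hlog s hs⟩) hss
    rwa [← hw] at this
  have step : ∀ L : ℝ, 0 ≤ L → (∀ s < T, ∀ x ∈ coneSlice n R (c * Real.exp s),
      ‖Δ s x‖ ≤ L * Real.exp s / coneWeight R (c * Real.exp s) x ^ 3) →
      ∀ s < T, ∀ x ∈ coneSlice n R (c * Real.exp s),
        ‖Δ s x‖ ≤ L / 32 * Real.exp s / coneWeight R (c * Real.exp s) x ^ 3 := by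
    intro L hL hΔL s hs x hx
    have hd : 0 < R - ‖x‖ := sub_pos.2 hx.1
    have hd1 : (R - ‖x‖) ^ 2 ≤ 1 := pow_le_one₀ hd.le (by linarith [norm_nonneg x])
    have hw0 := coneWeight_pos hx
    have hy : 0 ≤ c * Real.exp s := by positivity
    have hw1 := coneWeight_le_one (R := R) hy x
    have hsol := solve L hL hΔL s hs
    have hJd : ∀ {z : Idx n → ℂ}, ‖z‖ ≤ M * Real.exp s →
        ‖z‖ ≤ M * Real.exp s / (R - ‖x‖) ^ 2 := fun hz =>
      hz.trans (le_div_self (by positivity) (by positivity) hd1)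
    have hw23 : κ * L * Real.exp s / coneWeight R (c * Real.exp s) x ^ 2 ≤
        κ * L * Real.exp s / coneWeight R (c * Real.exp s) x ^ 3 := by
      have := pow_le_pow_of_le_one hw0.le hw1 (show 2 ≤ 3 by norm_num)
      gcongr
    have hw13 : κ * L * Real.exp s / coneWeight R (c * Real.exp s) x ≤
        κ * L * Real.exp s / coneWeight R (c * Real.exp s) x ^ 3 := by
      have := pow_le_of_le_one hw0.le hw1 (show 3 ≠ 0 by norm_num)
      gcongr
    refine hH.norm_sub_le_of_cone hM (Real.exp_pos s).le hL hκ0 hw0 hc.ge hc0 hRC hR1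
      (norm_exp_ray s φ) hx.1 (by rw [norm_exp_ray]; exact hE1 s hs) (lt_of_lt_of_le hx.1 hRr)
      ((hJ s hs x hx.1).trans_lt (hJr s hs)) ((hJ' s hs x hx.1).trans_lt (hJr s hs)) hx.2.le
      (hJd (hJ s hs x hx.1)) (hJd (hJ' s hs x hx.1)) ?_ ?_
    · exact norm_spatialJet_sub_le hR1 hy (by positivity)
        ((h.analytic_left s hs).mono (hpd s)) ((h.analytic_right s hs).mono (hpd s))
        ((h'.analytic_left s hs).mono (hpd s)) ((h'.analytic_right s hs).mono (hpd s))
        (fun x hx => (hsol x hx).1) (fun x hx => (hsol x hx).2) hx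
    · exact lowNorm_spatialJet_sub_le ((hsol x hx).1.trans hw13) ((hsol x hx).2.trans hw23)
  set L₀ := C * ((1 + M) * (2 * M) + R * (2 * M)) with hL₀
  -- The iteration starts from the a priori O(|t|) bound on both jets. No sign is imposed on R, so
  -- the constant is replaced by its maximum with 0.
  have base : ∀ s < T, ∀ x ∈ coneSlice n R (c * Real.exp s),
      ‖Δ s x‖ ≤ max L₀ 0 * Real.exp s / coneWeight R (c * Real.exp s) x ^ 3 := by
    intro s hs x hx
    have hw0 := coneWeight_pos hx
    have hy : 0 ≤ c * Real.exp s := by positivity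
    have hw1 := coneWeight_le_one (R := R) hy x
    have hE := Real.exp_pos s
    have hEr := hE1 s hs
    have hx1 : ‖x‖ < R := hx.1
    have hJs := hJ s hs x hx.1
    have hJs' := hJ' s hs x hx.1
    have hd : ‖spatialJet (A s) (B s) x - spatialJet (A' s) (B' s) x‖ ≤ 2 * M * Real.exp s :=
      (norm_sub_le _ _).trans (by linarith)
    have hlow : lowNorm (spatialJet (A s) (B s) x - spatialJet (A' s) (B' s) x) ≤
        2 * M * Real.exp s :=
      max_le ((norm_le_pi_norm _ _).trans hd) ((norm_le_pi_norm _ _).trans hd)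
    have e := hH.lipschitz (Complex.exp (s + φ * Complex.I)) x (spatialJet (A s) (B s) x)
      (spatialJet (A' s) (B' s) x) (by rw [norm_exp_ray]; exact hEr) (lt_of_lt_of_le hx.1 hRr)
      (hJs.trans_lt (hJr s hs)) (hJs'.trans_lt (hJr s hs))
    rw [norm_exp_ray] at e
    calc ‖Δ s x‖ ≤ _ := e
      _ ≤ C * ((1 + M) * (2 * M * Real.exp s) + R * (2 * M * Real.exp s)) := by
          have e1 : Real.exp s + max ‖spatialJet (A s) (B s) x‖ ‖spatialJet (A' s) (B' s) x‖ ≤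
              1 + M := by
            have : Real.exp s ≤ 1 := hEr.le.trans hH.r_le_one
            have : max ‖spatialJet (A s) (B s) x‖ ‖spatialJet (A' s) (B' s) x‖ ≤ M :=
              (max_le hJs hJs').trans (mul_le_of_le_one_right hM this)
            linarith
          have e0 : 0 ≤ lowNorm (spatialJet (A s) (B s) x - spatialJet (A' s) (B' s) x) :=
            (norm_nonneg _).trans (le_max_left _ _)
          have hR0 : 0 ≤ R := (norm_nonneg x).trans hx1.le
          gcongr
      _ = L₀ * Real.exp s := by rw [hL₀]; ring
      _ ≤ max L₀ 0 * Real.exp s := by gcongr; exact le_max_left _ _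
      _ ≤ _ := by
          refine le_div_self ?_ (by positivity) (pow_le_one₀ hw0.le hw1)
          exact mul_nonneg (le_max_right _ _) hE.le
  have iter : ∀ k : ℕ, ∀ s < T, ∀ x ∈ coneSlice n R (c * Real.exp s),
      ‖Δ s x‖ ≤ max L₀ 0 * (1 / 32) ^ k * Real.exp s / coneWeight R (c * Real.exp s) x ^ 3 := by
    intro k
    induction k with
    | zero => simpa using base
    | succ k ih =>
      have := step _ (mul_nonneg (le_max_right _ _) (by positivity)) ih
      rw [pow_succ, ← mul_assoc]
      simpa [div_eq_mul_inv] using this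
  have zero : ∀ s < T, ∀ x ∈ coneSlice n R (c * Real.exp s), ‖Δ s x‖ ≤
      0 * Real.exp s / coneWeight R (c * Real.exp s) x ^ 3 := by
    intro s hs x hx
    have hlim : Tendsto (fun k : ℕ => max L₀ 0 * (1 / 32) ^ k * Real.exp s /
        coneWeight R (c * Real.exp s) x ^ 3) atTop
        (𝓝 (max L₀ 0 * 0 * Real.exp s / coneWeight R (c * Real.exp s) x ^ 3)) :=
      ((((tendsto_pow_atTop_nhds_zero_of_lt_one (by norm_num) (by norm_num)).const_mul
        _).mul_const _).div_const _)
    rw [mul_zero] at hlim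
    exact ge_of_tendsto' hlim fun k => iter k s hs x hx
  -- Iterating the factor 1/32 has shown that the nonlinear parts agree, so `solve` with L = 0 gives
  -- equality of the solutions.
  intro s hs x hx
  have := (solve 0 le_rfl zero s hs x hx).1
  simp only [mul_zero, zero_mul, zero_div] at this
  exact sub_eq_zero.1 (norm_le_zero_iff.1 this)

end RaySolutions

/-! ### From rays to sectors. -/

section SectorSolutions

variable {n : ℕ} {Ω : Set (ℂ × (Fin n → ℂ) × (Idx n → ℂ))}
  {F : ℂ × (Fin n → ℂ) × (Idx n → ℂ) → ℂ} {I : Set ℝ} {r₀ R₀ : ℝ} {u : ℂ → (Fin n → ℂ) → ℂ}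

theorem isOpen_polydisc (R : ℝ) : IsOpen (polydisc n R) := isOpen_lt (by fun_prop) (by fun_prop)

theorem isOpen_sectorBelow (hI : IsOpen I) (r : ℝ) : IsOpen (sectorBelow I r) := by
  have h1 : IsOpen {τ : ℂ | τ.im ∈ I} := hI.preimage Complex.continuous_im
  have h2 : IsOpen {τ : ℂ | ‖Complex.exp τ‖ < r} := isOpen_lt (by fun_prop) (by fun_prop)
  exact h1.inter h2

theorem convex_sectorBelow (hI : I.OrdConnected) {r : ℝ} (hr : 0 < r) :
    Convex ℝ (sectorBelow I r) := by
  have h1 : Convex ℝ {τ : ℂ | τ.im ∈ I} := hI.convex.linear_preimage Complex.imLm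
  have h2 : Convex ℝ {τ : ℂ | τ.re < Real.log r} :=
    (convex_Iio (𝕜 := ℝ) (Real.log r)).linear_preimage Complex.reLm
  have e : sectorBelow I r = {τ : ℂ | τ.im ∈ I} ∩ {τ : ℂ | τ.re < Real.log r} := by
    ext τ
    have : ‖Complex.exp τ‖ < r ↔ τ.re < Real.log r := by
      rw [Complex.norm_exp, Real.lt_log_iff_exp_lt hr]
    exact and_congr Iff.rfl this
  rw [e]
  exact h1.inter h2

theorem mem_sectorBelow_ray {φ s r : ℝ} (hφ : φ ∈ I) (hs : Real.exp s < r) :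
    (s + φ * Complex.I : ℂ) ∈ sectorBelow I r := by
  refine ⟨?_, ?_⟩
  · simpa [sector] using hφ
  · rwa [norm_exp_ray]

theorem IsSectorSolution.isRaySolution (hu : IsSectorSolution Ω F I r₀ R₀ u) (hI : IsOpen I)
    {φ T : ℝ} (hφ : φ ∈ I) (hT : Real.exp T ≤ r₀) :
    IsRaySolution F φ R₀ T (fun s => u (s + φ * Complex.I))
      (fun s => eulerLog u (s + φ * Complex.I)) := by
  have hW : IsOpen (sectorBelow I r₀ ×ˢ polydisc n R₀) :=
    (isOpen_sectorBelow hI r₀).prod (isOpen_polydisc R₀)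
  have hmem : ∀ s < T, (s + φ * Complex.I : ℂ) ∈ sectorBelow I r₀ := fun s hs =>
    mem_sectorBelow_ray hφ ((Real.exp_lt_exp.2 hs).trans_le hT)
  have hder : ∀ {v : ℂ → (Fin n → ℂ) → ℂ},
      AnalyticOnNhd ℂ (Function.uncurry v) (sectorBelow I r₀ ×ˢ polydisc n R₀) →
      ∀ s < T, ∀ x ∈ polydisc n R₀, HasDerivAt (fun s : ℝ => v (s + φ * Complex.I) x)
        (eulerLog v (s + φ * Complex.I) x) s := by
    intro v hv s hs x hx
    have h1 : HasDerivAt (fun τ => v τ x) (eulerLog v (s + φ * Complex.I) x)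
        (s + φ * Complex.I) :=
      (hasDerivAt_time (hv (_, x) ⟨hmem s hs, hx⟩).differentiableAt).differentiableAt.hasDerivAt
    exact (h1.comp_add_const (s : ℂ) (φ * Complex.I)).comp_ofReal
  refine ⟨fun s hs => ?_, fun s hs => ?_, hder hu.holomorphic, fun s hs x hx => ?_⟩
  · exact (hu.holomorphic.slice _).mono fun x hx => ⟨hmem s hs, hx⟩
  · exact ((hu.holomorphic.eulerLog hW).slice _).mono fun x hx => ⟨hmem s hs, hx⟩
  · have h1 := hder (hu.holomorphic.eulerLog hW) s hs x hx
    have h2 : eulerLog (eulerLog u) (s + φ * Complex.I) x = _ := hu.eq _ (hmem s hs) x hx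
    rwa [h2, jet_eulerLog_eq_spatialJet hW hu.holomorphic ⟨hmem s hs, hx⟩] at h1

/-- `u(t, x) = o(1)` uniformly in `x` as `t → 0` in the sector. -/
def IsSmallAtZero (I : Set ℝ) (R : ℝ) (u : ℂ → (Fin n → ℂ) → ℂ) : Prop :=
  ∀ ε : ℝ, 0 < ε → ∃ T : ℝ, ∀ τ ∈ sector I, τ.re < T → ∀ x ∈ polydisc n R, ‖u τ x‖ ≤ ε

theorem isSmallAtZero_of_tendsto {R : ℝ}
    (hsmall : Tendsto (fun τ => ⨆ x ∈ polydisc n R, ‖u τ x‖ₑ)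
      (comap Complex.exp (𝓝 0) ⊓ 𝓟 (sector I)) (𝓝 0)) : IsSmallAtZero I R u := by
  intro ε hε
  have h1 := hsmall.eventually (Iic_mem_nhds (show (0 : ENNReal) < ENNReal.ofReal ε by simpa using hε))
  rw [eventually_inf_principal, eventually_comap] at h1
  obtain ⟨ρ, hρ, hball⟩ := Metric.eventually_nhds_iff.1 h1
  refine ⟨Real.log ρ, fun τ hτ hre x hx => ?_⟩
  have h2 : dist (Complex.exp τ) 0 < ρ := by
    rw [dist_zero_right, Complex.norm_exp]
    exact (Real.lt_log_iff_exp_lt hρ).1 hre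
  have h3 : (⨆ x ∈ polydisc n R, ‖u τ x‖ₑ) ≤ ENNReal.ofReal ε := hball h2 τ rfl hτ
  have h4 := (le_iSup₂ (f := fun x (_ : x ∈ polydisc n R) => ‖u τ x‖ₑ) x hx).trans h3
  rwa [← ofReal_norm, ENNReal.ofReal_le_ofReal_iff hε.le] at h4

theorem IsSmallAtZero.mono {R R' : ℝ} (h : IsSmallAtZero I R u) (hR : R' ≤ R) :
    IsSmallAtZero I R' u := fun ε hε =>
  let ⟨T, hT⟩ := h ε hε
  ⟨T, fun τ hτ hre x hx => hT τ hτ hre x (lt_of_lt_of_le hx hR)⟩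

/-- In the coordinate τ the sector is a half-strip, so discs of one fixed radius η about the points
of the ray stay inside it as s → -∞. Cauchy's estimate on them carries the smallness of u over to
θu. -/
theorem IsSectorSolution.exists_ray_bound (hu : IsSectorSolution Ω F I r₀ R₀ u) (hI : IsOpen I)
    (hr₀ : 0 < r₀) {R : ℝ} (hR : R ≤ R₀) (hsmall : IsSmallAtZero I R u) {φ : ℝ} (hφ : φ ∈ I)
    {ε : ℝ} (hε : 0 < ε) : ∃ T : ℝ, ∀ s < T, ∀ x ∈ polydisc n R,
      ‖u (s + φ * Complex.I) x‖ ≤ ε ∧ ‖eulerLog u (s + φ * Complex.I) x‖ ≤ ε := by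
  obtain ⟨η₀, hη₀, hball⟩ := Metric.isOpen_iff.1 hI φ hφ
  set η := min (η₀ / 2) 1
  have hη : 0 < η := lt_min (by positivity) one_pos
  have hη1 : η ≤ 1 := min_le_right _ _
  obtain ⟨T, hT⟩ := hsmall (ε * η) (by positivity)
  refine ⟨min T (Real.log r₀) - 1, fun s hs x hx => ?_⟩
  have hnear : ∀ τ ∈ Metric.closedBall (s + φ * Complex.I : ℂ) η,
      τ ∈ sectorBelow I r₀ ∧ τ.re < T := by
    intro τ hτ
    rw [Metric.mem_closedBall, dist_eq_norm] at hτ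
    have hre := (Complex.abs_re_le_norm _).trans hτ
    have him := (Complex.abs_im_le_norm _).trans hτ
    simp only [Complex.sub_re, Complex.add_re, Complex.ofReal_re, Complex.mul_re, Complex.I_re,
      mul_zero, Complex.ofReal_im, Complex.I_im, mul_one, sub_self, add_zero] at hre
    simp only [Complex.sub_im, Complex.add_im, Complex.ofReal_im, Complex.mul_im, Complex.I_im,
      mul_one, Complex.ofReal_re, Complex.I_re, mul_zero, add_zero, zero_add] at him
    have h1 := (abs_le.1 hre).2
    have h2 : τ.re < min T (Real.log r₀) := by linarith
    refine ⟨⟨hball ?_, ?_⟩, h2.trans_le (min_le_left _ _)⟩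
    · rw [Metric.mem_ball, Real.dist_eq]
      have : η ≤ η₀ / 2 := min_le_left _ _
      linarith
    · rw [Complex.norm_exp]
      exact (Real.lt_log_iff_exp_lt hr₀).1 (h2.trans_le (min_le_right _ _))
  have hb : ∀ τ ∈ Metric.closedBall (s + φ * Complex.I : ℂ) η, ‖u τ x‖ ≤ ε * η := fun τ hτ =>
    hT τ (hnear τ hτ).1.1 (hnear τ hτ).2 x hx
  have hxR : x ∈ polydisc n R₀ := lt_of_lt_of_le hx hR
  refine ⟨(hb _ (Metric.mem_closedBall_self hη.le)).trans (mul_le_of_le_one_right hε.le hη1), ?_⟩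
  have hd : DifferentiableOn ℂ (fun τ => u τ x) (Metric.closedBall (s + φ * Complex.I : ℂ) η) :=
    ((hu.holomorphic.timeSlice x).mono fun τ hτ => ⟨(hnear τ hτ).1, hxR⟩).differentiableOn
  have := Complex.norm_deriv_le_of_forall_mem_sphere_norm_le (f := fun τ => u τ x) hη
    (DifferentiableOn.diffContOnCl (hd.mono Metric.closure_ball_subset_closedBall))
    (fun τ hτ => hb τ (Metric.sphere_subset_closedBall hτ))
  rwa [mul_div_cancel_right₀ _ hη.ne'] at this

variable {l₁ l₂ : ℂ} {r C : ℝ}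

/-- Two solutions on a sector that tend to zero coincide near `x = 0`. -/
theorem IsSectorSolution.eq_of_isSmallAtZero (hH : HasReducedBounds F l₁ l₂ r C)
    (hI : IsOpen I) (hne : I.Nonempty) (hconn : I.OrdConnected) (hr₀ : 0 < r₀)
    {u' : ℂ → (Fin n → ℂ) → ℂ} (hu : IsSectorSolution Ω F I r₀ R₀ u)
    (hu' : IsSectorSolution Ω F I r₀ R₀ u') {R₁ : ℝ} (hR₁ : 0 < R₁) (hR₁₀ : R₁ ≤ R₀)
    (hs : IsSmallAtZero I R₁ u) (hs' : IsSmallAtZero I R₁ u') :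
    ∃ δ : ℝ, 0 < δ ∧ ∀ τ ∈ sectorBelow I r₀, ∀ x ∈ polydisc n δ, u τ x = u' τ x := by
  obtain ⟨φ, hφ⟩ := hne
  have hC := hH.C_pos
  have hr := hH.r_pos
  set K := systemConst l₁ l₂ with hK
  have hK0 : 0 ≤ K := systemConst_nonneg hH.re₁ hH.re₂
  -- The two smallness conditions on R are those of the O(|t|) bound and of the contraction; the sum
  -- in the denominator below meets both.
  obtain ⟨R, hR0, hRR₁, hRr, hRK, hRl⟩ : ∃ R : ℝ, 0 < R ∧ R ≤ R₁ ∧ R ≤ r ∧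
      K * (C * R) ≤ 1 / 2 ∧ 64 * (C * R * (1 + ‖l₂‖)) ≤ 1 := by
    set R := min (min R₁ r) (1 / (64 * C * (1 + ‖l₂‖ + K))) with hRdef
    have hden : 0 < 64 * C * (1 + ‖l₂‖ + K) := by positivity
    have hR0 : 0 < R := lt_min (lt_min hR₁ hr) (by positivity)
    have h3 : R ≤ 1 / (64 * C * (1 + ‖l₂‖ + K)) := min_le_right _ _
    rw [le_div_iff₀ hden] at h3
    have e1 : 0 ≤ C * R * K := by positivity
    have e2 : 0 ≤ C * R * (1 + ‖l₂‖) := by positivity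
    exact ⟨R, hR0, (min_le_left _ _).trans (min_le_left _ _),
      (min_le_left _ _).trans (min_le_right _ _), by linarith, by linarith⟩
  obtain ⟨ε, hε, M, hM, hbound⟩ := IsRaySolution.exists_bound hH hR0 hRr hRK
  have hRR₀ : R ≤ R₀ := hRR₁.trans hR₁₀
  obtain ⟨T₁, hT₁⟩ := hu.exists_ray_bound hI hr₀ hRR₀ (hs.mono hRR₁) hφ hε
  obtain ⟨T₂, hT₂⟩ := hu'.exists_ray_bound hI hr₀ hRR₀ (hs'.mono hRR₁) hφ hε
  set M' := 65536 * M / (R / 2 - R / 4) ^ 2 with hM'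
  have hM'0 : 0 < M' := by
    have : 0 < R / 2 - R / 4 := by linarith
    positivity
  set T := min (min T₁ T₂) (min (Real.log r₀) (Real.log (r / (2 * (1 + M'))))) with hT
  have hq : 0 < r / (2 * (1 + M')) := by positivity
  have hTr₀ : Real.exp T ≤ r₀ :=
    (Real.le_log_iff_exp_le hr₀).1 ((min_le_right _ _).trans (min_le_left _ _))
  have hTr : Real.exp T * (2 * (1 + M')) ≤ r := by
    rw [← le_div_iff₀ (by positivity)]
    exact (Real.le_log_iff_exp_le hq).1 ((min_le_right _ _).trans (min_le_right _ _))
  have hTp := Real.exp_pos T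
  have hprod : 0 < Real.exp T * M' := by positivity
  have hTr1 : Real.exp T ≤ r := by linarith
  have hray := (hu.isRaySolution hI hφ hTr₀).mono hRR₀ le_rfl
  have hray' := (hu'.isRaySolution hI hφ hTr₀).mono hRR₀ le_rfl
  have hb := hbound φ T _ _ hTr1 hray
    (fun s hs => hT₁ s (hs.trans_le ((min_le_left _ _).trans (min_le_left _ _))))
  have hb' := hbound φ T _ _ hTr1 hray'
    (fun s hs => hT₂ s (hs.trans_le ((min_le_left _ _).trans (min_le_right _ _))))
  have hjet : ∀ {A B : ℝ → (Fin n → ℂ) → ℂ}, IsRaySolution F φ R T A B →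
      (∀ s < T, ∀ x ∈ polydisc n (R / 2), ‖A s x‖ ≤ M * Real.exp s ∧ ‖B s x‖ ≤ M * Real.exp s) →
      ∀ s < T, ∀ x ∈ polydisc n (R / 4), ‖spatialJet (A s) (B s) x‖ ≤ M' * Real.exp s := by
    intro A B hAB hABM s hs x hx
    have hsub : polydisc n (R / 2) ⊆ polydisc n R := fun y (hy : ‖y‖ < R / 2) =>
      (hy.trans_le (by linarith) : ‖y‖ < R)
    refine (norm_spatialJet_le_of_norm_le (ρ := R / 4) (ρ' := R / 2) (by linarith)
      (by linarith [hH.r_le_one]) (m := M * Real.exp s) (by positivity)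
      ((hAB.analytic_left s hs).mono hsub) ((hAB.analytic_right s hs).mono hsub)
      (fun x hx => (hABM s hs x hx).1) (fun x hx => (hABM s hs x hx).2) hx).trans_eq ?_
    rw [hM']; ring
  have hR4 : R / 4 ≤ R := by linarith
  have hRl4 : 64 * (C * (R / 4) * (1 + ‖l₂‖)) ≤ 1 := by
    refine le_trans ?_ hRl
    gcongr
  obtain ⟨c, hc, heq⟩ := IsRaySolution.eq_of_norm_spatialJet_le hH (R := R / 4) (M := M')
    (hR4.trans hRr) hRl4 hM'0.le hTr1 (by linarith) (hray.mono hR4 le_rfl)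
    (hray'.mono hR4 le_rfl) (hjet hray hb) (hjet hray' hb')
  -- For ‖x‖ < R/8 the distance R/4 - ‖x‖ is at least R/8, so one initial piece of the ray lies in
  -- the cone for all such x.
  refine ⟨R / 8, by positivity, fun τ hτ x hx => ?_⟩
  have hxd : R / 8 ≤ R / 4 - ‖x‖ := by
    have : ‖x‖ < R / 8 := hx
    linarith
  set T' := min T (Real.log ((R / 8) ^ 4 / c)) with hT'
  have hray_eq : ∀ s < T', u (s + φ * Complex.I) x = u' (s + φ * Complex.I) x := by
    intro s hs
    refine heq s (hs.trans_le (min_le_left _ _)) x ⟨by linarith, ?_⟩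
    have h1 := (Real.lt_log_iff_exp_lt (by positivity)).1 (hs.trans_le (min_le_right _ _))
    rw [lt_div_iff₀ hc] at h1
    calc c * Real.exp s < (R / 8) ^ 4 := by linarith
      _ ≤ _ := by gcongr
  have hxR₀ : x ∈ polydisc n R₀ := by
    have : ‖x‖ < R / 8 := hx
    show ‖x‖ < R₀
    linarith
  have han : ∀ {v : ℂ → (Fin n → ℂ) → ℂ}, IsSectorSolution Ω F I r₀ R₀ v →
      AnalyticOnNhd ℂ (fun τ => v τ x) (sectorBelow I r₀) := fun hv =>
    (hv.holomorphic.timeSlice x).mono fun τ hτ => ⟨hτ, hxR₀⟩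
  have hz₀ : ((T' - 1 : ℝ) + φ * Complex.I : ℂ) ∈ sectorBelow I r₀ := by
    refine mem_sectorBelow_ray hφ (lt_of_lt_of_le (Real.exp_lt_exp.2 ?_) hTr₀)
    have : T' ≤ T := min_le_left _ _
    linarith
  -- For fixed x the two functions of τ agree on a piece of a ray, which has an accumulation point,
  -- hence on the whole convex half-strip.
  refine (han hu).eqOn_of_preconnected_of_frequently_eq (han hu')
    (convex_sectorBelow hconn hr₀).isPreconnected hz₀ ?_ hτ
  have htend : Tendsto (fun s : ℝ => (s + φ * Complex.I : ℂ)) (𝓝[≠] (T' - 1))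
      (𝓝[≠] ((T' - 1 : ℝ) + φ * Complex.I : ℂ)) := by
    refine tendsto_nhdsWithin_iff.2 ⟨?_, ?_⟩
    · exact ((by fun_prop : Continuous fun s : ℝ => (s + φ * Complex.I : ℂ)).tendsto _).mono_left
        nhdsWithin_le_nhds
    · filter_upwards [self_mem_nhdsWithin] with s hs h
      refine hs ?_
      have : (s + φ * Complex.I : ℂ) = (T' - 1 : ℝ) + φ * Complex.I := h
      exact_mod_cast add_right_cancel this
  refine htend.frequently (Eventually.frequently ?_)
  have : ∀ᶠ s in 𝓝 (T' - 1), s < T' := eventually_lt_nhds (by linarith)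
  filter_upwards [this.filter_mono nhdsWithin_le_nhds] with s hs using hray_eq s hs

end SectorSolutions

/-! ### Local holomorphic solutions in the logarithmic coordinate. -/

section LocalSolutions

variable {n : ℕ} {Ω : Set (ℂ × (Fin n → ℂ) × (Idx n → ℂ))}
  {F : ℂ × (Fin n → ℂ) × (Idx n → ℂ) → ℂ} {v : ℂ → (Fin n → ℂ) → ℂ}

theorem eulerLog_comp_exp {τ : ℂ} {x : Fin n → ℂ}
    (hv : DifferentiableAt ℂ (Function.uncurry v) (Complex.exp τ, x)) :
    eulerLog (fun τ x => v (Complex.exp τ) x) τ x = eulerT v (Complex.exp τ) x := by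
  have h1 : HasDerivAt (fun s => v s x) (deriv (fun s => v s x) (Complex.exp τ)) (Complex.exp τ) :=
    (hasDerivAt_time hv).differentiableAt.hasDerivAt
  have h2 := h1.comp τ (Complex.hasDerivAt_exp τ)
  show deriv (fun s => v (Complex.exp s) x) τ = _
  rw [show (fun s => v (Complex.exp s) x) = (fun s => v s x) ∘ Complex.exp from rfl, h2.deriv,
    eulerT, mul_comm]

/-- A local solution, read in the coordinate `log t`, is a solution on small sectors that
tends to zero. -/
theorem IsLocalSolution.exists_isSectorSolution (hv : IsLocalSolution Ω F v) :
    ∃ ρ : ℝ, 0 < ρ ∧ (∀ x, ‖x‖ < ρ → v 0 x = 0) ∧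
      ∀ (I : Set ℝ), IsOpen I → ∀ ρ' ≤ ρ, 0 < ρ' →
        IsSectorSolution Ω F I ρ' ρ' (fun τ x => v (Complex.exp τ) x) ∧
        IsSmallAtZero I ρ' (fun τ x => v (Complex.exp τ) x) := by
  obtain ⟨W, hW, h0, han, heq, hzero⟩ := hv
  obtain ⟨K, s, hs, hK⟩ := ((han _ h0).contDiffAt (n := 1)).exists_lipschitzOnWith
  obtain ⟨ρ, hρ, hball⟩ := Metric.nhds_basis_ball.mem_iff.1 (inter_mem hs (hW.mem_nhds h0))
  have hmem : ∀ (t : ℂ) (x : Fin n → ℂ), ‖t‖ < ρ → ‖x‖ < ρ → (t, x) ∈ s ∩ W := by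
    intro t x ht hx
    refine hball ?_
    have : ((0, 0) : ℂ × (Fin n → ℂ)) = 0 := rfl
    rw [this, mem_ball_zero_iff, Prod.norm_def]
    exact max_lt ht hx
  refine ⟨ρ, hρ, fun x hx => hzero x (hmem 0 x (by simpa using hρ) hx).2,
    fun I hI ρ' hρ' hρ'0 => ?_⟩
  have hS : ∀ τ ∈ sectorBelow I ρ', ∀ x ∈ polydisc n ρ', (Complex.exp τ, x) ∈ W :=
    fun τ hτ x hx => (hmem _ _ (hτ.2.trans_le hρ') (lt_of_lt_of_le hx hρ')).2
  have hWS : IsOpen (sectorBelow I ρ' ×ˢ polydisc n ρ') :=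
    (isOpen_sectorBelow hI ρ').prod (isOpen_polydisc ρ')
  have hcomp : ∀ {w : ℂ → (Fin n → ℂ) → ℂ}, AnalyticOnNhd ℂ (Function.uncurry w) W →
      AnalyticOnNhd ℂ (Function.uncurry fun τ x => w (Complex.exp τ) x)
        (sectorBelow I ρ' ×ˢ polydisc n ρ') := by
    rintro w hw ⟨τ, x⟩ ⟨hτ, hx⟩
    have h1 : AnalyticAt ℂ (fun p : ℂ × (Fin n → ℂ) => (Complex.exp p.1, p.2)) (τ, x) :=
      (analyticAt_cexp.comp analyticAt_fst).prod analyticAt_snd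
    exact AnalyticAt.comp (f := fun p : ℂ × (Fin n → ℂ) => (Complex.exp p.1, p.2))
      (hw (Complex.exp τ, x) (hS τ hτ x hx)) h1
  have hcan := hcomp han
  have hlog : ∀ {w : ℂ → (Fin n → ℂ) → ℂ}, AnalyticOnNhd ℂ (Function.uncurry w) W →
      ∀ τ ∈ sectorBelow I ρ', ∀ x ∈ polydisc n ρ',
      eulerLog (fun τ x => w (Complex.exp τ) x) τ x = eulerT w (Complex.exp τ) x :=
    fun hw τ hτ x hx => eulerLog_comp_exp (hw _ (hS τ hτ x hx)).differentiableAt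
  have hjet : ∀ τ ∈ sectorBelow I ρ', ∀ x ∈ polydisc n ρ',
      jet eulerLog (fun τ x => v (Complex.exp τ) x) τ x = jet eulerT v (Complex.exp τ) x := by
    intro τ hτ x hx
    rw [jet_eulerLog_eq_spatialJet hWS hcan ⟨hτ, hx⟩,
      jet_eulerT_eq_spatialJet hW han (hS τ hτ x hx)]
    exact spatialJet_congr (isOpen_polydisc ρ') (fun _ _ => rfl)
      (fun y hy => hlog han τ hτ y hy) hx
  refine ⟨⟨hcan, fun τ hτ x hx => ?_, fun τ hτ x hx => ?_⟩, ?_⟩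
  · rw [hjet τ hτ x hx]
    exact (heq _ _ (hS τ hτ x hx)).1
  · rw [hjet τ hτ x hx, ← (heq _ _ (hS τ hτ x hx)).2]
    show eulerLog (eulerLog fun τ x => v (Complex.exp τ) x) τ x = eulerT (eulerT v) (Complex.exp τ) x
    rw [← hlog (han.eulerT hW) τ hτ x hx, eulerLog_eq_timeField]
    refine timeField_congr hWS (fun p hp => ?_) _ (x := (τ, x)) ⟨hτ, hx⟩
    rw [← eulerLog_eq_timeField]
    exact hlog han p.1 hp.1 p.2 hp.2
  · intro ε hε
    set q := min ρ (ε / (K + 1)) with hq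
    have hq0 : 0 < q := lt_min hρ (by positivity)
    refine ⟨Real.log q, fun τ _ hre x hx => ?_⟩
    have hexp : ‖Complex.exp τ‖ < q := by
      rw [Complex.norm_exp]
      exact (Real.lt_log_iff_exp_lt hq0).1 hre
    have hxρ : ‖x‖ < ρ := lt_of_lt_of_le hx hρ'
    have h1 := hmem (Complex.exp τ) x (hexp.trans_le (min_le_left _ _)) hxρ
    have h2 := hmem 0 x (by simpa using hρ) hxρ
    have e1 := hK.norm_sub_le h1.1 h2.1
    have e2 : Function.uncurry v (0, x) = 0 := hzero x h2.2
    have e3 : ‖((Complex.exp τ, x) : ℂ × (Fin n → ℂ)) - (0, x)‖ = ‖Complex.exp τ‖ := by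
      simp [Prod.norm_def]
    rw [e2, e3, sub_zero] at e1
    refine e1.trans ?_
    have e4 : ‖Complex.exp τ‖ ≤ ε / (K + 1) := hexp.le.trans (min_le_right _ _)
    rw [le_div_iff₀ (by positivity)] at e4
    have := norm_nonneg (Complex.exp τ)
    linarith

end LocalSolutions

/-! ### Holomorphic inversion of the Fuchsian operator. -/

section FuchsInverse

open MeasureTheory

variable {n : ℕ}

/-- The solution `g` of `(t ∂/∂t - l) g = f` that is holomorphic at `t = 0`, for `Re l < 0`. -/
noncomputable def fuchsInv (l : ℂ) (f : ℂ → (Fin n → ℂ) → ℂ) : ℂ → (Fin n → ℂ) → ℂ :=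
  fun t x => ∫ ρ in (0 : ℝ)..1, (ρ : ℂ) ^ (-l - 1) * f (ρ * t) x

/-- Contraction of the variable `t` by the factor `ρ`. -/
noncomputable def contractT (n : ℕ) (ρ : ℝ) : ℂ × (Fin n → ℂ) →L[ℂ] ℂ × (Fin n → ℂ) :=
  (ρ : ℂ) • (ContinuousLinearMap.inl ℂ ℂ (Fin n → ℂ)).comp (ContinuousLinearMap.fst ℂ ℂ _) +
    (ContinuousLinearMap.inr ℂ ℂ (Fin n → ℂ)).comp (ContinuousLinearMap.snd ℂ ℂ _)

theorem contractT_apply (ρ : ℝ) (p : ℂ × (Fin n → ℂ)) : contractT n ρ p = (ρ * p.1, p.2) := by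
  simp [contractT]

theorem continuous_contractT : Continuous (contractT n) := by
  unfold contractT
  fun_prop

theorem norm_contractT_le {ρ : ℝ} (h : ρ ∈ Set.Icc (0 : ℝ) 1) : ‖contractT n ρ‖ ≤ 1 := by
  refine ContinuousLinearMap.opNorm_le_bound _ zero_le_one fun p => ?_
  rw [contractT_apply, one_mul, Prod.norm_def, Prod.norm_def]
  refine max_le_max ?_ le_rfl
  rw [norm_mul, Complex.norm_real, Real.norm_of_nonneg h.1]
  exact mul_le_of_le_one_left (norm_nonneg _) h.2

/-- The set contains with `(t, x)` the whole segment from `(0, x)` to `(t, x)`. -/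
def IsStarT (D : Set (ℂ × (Fin n → ℂ))) : Prop :=
  ∀ p ∈ D, ∀ ρ ∈ Set.Icc (0 : ℝ) 1, contractT n ρ p ∈ D

variable {D : Set (ℂ × (Fin n → ℂ))} {l : ℂ} {f : ℂ → (Fin n → ℂ) → ℂ}

theorem intervalIntegrable_kernel (hl : l.re < 0) :
    IntervalIntegrable (fun ρ : ℝ => (ρ : ℂ) ^ (-l - 1)) volume 0 1 :=
  intervalIntegral.intervalIntegrable_cpow' (by simp; linarith)

/-- Differentiation under the integral sign. The kernel is integrable at ρ = 0 because Re(-l - 1) >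
-1, and the derivative of f is bounded on the compact set of all contractions of a closed ball about
p, which lies in D because D is star-shaped in t. -/
theorem hasFDerivAt_fuchsInv (hl : l.re < 0) (hD : IsOpen D) (hstar : IsStarT D)
    (hf : AnalyticOnNhd ℂ (Function.uncurry f) D) {p : ℂ × (Fin n → ℂ)} (hp : p ∈ D) :
    IntervalIntegrable (fun ρ : ℝ => (ρ : ℂ) ^ (-l - 1) •
        (fderiv ℂ (Function.uncurry f) (contractT n ρ p)).comp (contractT n ρ)) volume 0 1 ∧
    HasFDerivAt (Function.uncurry (fuchsInv l f))
      (∫ ρ in (0 : ℝ)..1, (ρ : ℂ) ^ (-l - 1) •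
        (fderiv ℂ (Function.uncurry f) (contractT n ρ p)).comp (contractT n ρ)) p := by
  obtain ⟨ε, hε, hball⟩ := Metric.nhds_basis_closedBall.mem_iff.1 (hD.mem_nhds hp)
  have hcont2 : Continuous fun q : ℝ × (ℂ × (Fin n → ℂ)) => contractT n q.1 q.2 := by
    simp only [contractT_apply]; fun_prop
  have hcompact : IsCompact ((fun q : ℝ × (ℂ × (Fin n → ℂ)) => contractT n q.1 q.2) ''
      (Set.Icc (0 : ℝ) 1 ×ˢ Metric.closedBall p ε)) :=
    (isCompact_Icc.prod (isCompact_closedBall p ε)).image hcont2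
  have hsub : ((fun q : ℝ × (ℂ × (Fin n → ℂ)) => contractT n q.1 q.2) ''
      (Set.Icc (0 : ℝ) 1 ×ˢ Metric.closedBall p ε)) ⊆ D := by
    rintro _ ⟨⟨ρ, q⟩, ⟨hρ, hq⟩, rfl⟩
    exact hstar q (hball hq) ρ hρ
  obtain ⟨M, hM⟩ := hcompact.exists_bound_of_continuousOn (hf.fderiv.continuousOn.mono hsub)
  have hM' : ∀ ρ ∈ Set.Icc (0 : ℝ) 1, ∀ q ∈ Metric.closedBall p ε,
      ‖fderiv ℂ (Function.uncurry f) (contractT n ρ q)‖ ≤ M :=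
    fun ρ hρ q hq => hM _ ⟨(ρ, q), ⟨hρ, hq⟩, rfl⟩
  have hcr : ∀ q, Continuous fun ρ : ℝ => contractT n ρ q := fun q =>
    hcont2.comp (Continuous.prodMk_left q)
  have hmaps : ∀ q ∈ D, Set.MapsTo (fun ρ : ℝ => contractT n ρ q) (Set.uIcc 0 1) D := by
    intro q hq ρ hρ
    rw [Set.uIcc_of_le zero_le_one] at hρ
    exact hstar q hq ρ hρ
  have hker := intervalIntegrable_kernel hl
  have hint : ∀ q ∈ D, IntervalIntegrable (fun ρ : ℝ => (ρ : ℂ) ^ (-l - 1) *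
      Function.uncurry f (contractT n ρ q)) volume 0 1 := fun q hq =>
    hker.mul_continuousOn (hf.continuousOn.comp (hcr q).continuousOn (hmaps q hq))
  have hF'meas : AEStronglyMeasurable (fun ρ : ℝ => (ρ : ℂ) ^ (-l - 1) •
      (fderiv ℂ (Function.uncurry f) (contractT n ρ p)).comp (contractT n ρ))
      (volume.restrict (Set.uIoc 0 1)) := by
    refine hker.def'.aestronglyMeasurable.smul ?_
    refine ContinuousOn.aestronglyMeasurable ?_ measurableSet_uIoc
    exact (ContinuousOn.clm_comp (hf.fderiv.continuousOn.comp (hcr p).continuousOn (hmaps p hp))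
      continuous_contractT.continuousOn).mono Set.uIoc_subset_uIcc
  have hbound : ∀ ρ ∈ Set.uIoc (0 : ℝ) 1, ∀ q ∈ Metric.ball p ε, ‖(ρ : ℂ) ^ (-l - 1) •
      (fderiv ℂ (Function.uncurry f) (contractT n ρ q)).comp (contractT n ρ)‖ ≤
        ‖(ρ : ℂ) ^ (-l - 1)‖ * M := by
    intro ρ hρ q hq
    rw [Set.uIoc_of_le zero_le_one] at hρ
    have hρ' : ρ ∈ Set.Icc (0 : ℝ) 1 := ⟨hρ.1.le, hρ.2⟩
    have h1 := hM' ρ hρ' q (Metric.ball_subset_closedBall hq)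
    rw [norm_smul]
    gcongr
    refine (ContinuousLinearMap.opNorm_comp_le _ _).trans ?_
    calc _ ≤ M * 1 := by
          gcongr
          · exact (norm_nonneg _).trans h1
          · exact norm_contractT_le hρ'
      _ = M := mul_one M
  have hbint : IntervalIntegrable (fun ρ : ℝ => ‖(ρ : ℂ) ^ (-l - 1)‖ * M) volume 0 1 :=
    hker.norm.mul_const M
  refine ⟨?_, ?_⟩
  · refine hbint.mono_fun hF'meas ?_
    refine (ae_restrict_iff' measurableSet_uIoc).2 (ae_of_all _ fun ρ hρ => ?_)
    exact (hbound ρ hρ p (Metric.mem_ball_self hε)).trans (le_abs_self _)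
  · have e : Function.uncurry (fuchsInv l f) = fun q => ∫ ρ in (0 : ℝ)..1, (ρ : ℂ) ^ (-l - 1) *
        Function.uncurry f (contractT n ρ q) := by
      ext ⟨t, x⟩
      simp [fuchsInv, contractT_apply]
    rw [e]
    refine intervalIntegral.hasFDerivAt_integral_of_dominated_of_fderiv_le
      (Metric.ball_mem_nhds p hε) ?_ (hint p hp) hF'meas (ae_of_all _ hbound) hbint
      (ae_of_all _ fun ρ hρ q hq => ?_)
    · filter_upwards [hD.mem_nhds hp] with q hq
      exact (hint q hq).def'.aestronglyMeasurable
    · have hq' : contractT n ρ q ∈ D := by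
        refine hstar q (hball (Metric.ball_subset_closedBall hq)) ρ ?_
        rw [Set.uIoc_of_le zero_le_one] at hρ
        exact ⟨hρ.1.le, hρ.2⟩
      exact ((hf _ hq').differentiableAt.hasFDerivAt.comp q
        (contractT n ρ).hasFDerivAt).const_mul _

theorem analyticOnNhd_fuchsInv (hl : l.re < 0) (hD : IsOpen D) (hstar : IsStarT D)
    (hf : AnalyticOnNhd ℂ (Function.uncurry f) D) :
    AnalyticOnNhd ℂ (Function.uncurry (fuchsInv l f)) D :=
  analyticOnNhd_of_differentiableOn_isOpen hD fun _ hp =>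
    (hasFDerivAt_fuchsInv hl hD hstar hf hp).2.differentiableAt.differentiableWithinAt

theorem fuchsInv_apply_zero {x : Fin n → ℂ} (h : f 0 x = 0) : fuchsInv l f 0 x = 0 := by
  simp [fuchsInv, h]

/-- Integration by parts in ρ. The boundary term at ρ = 0 vanishes because Re(-l) > 0, and the one
at ρ = 1 is f(t, x). -/
theorem eulerT_fuchsInv (hl : l.re < 0) (hD : IsOpen D) (hstar : IsStarT D)
    (hf : AnalyticOnNhd ℂ (Function.uncurry f) D) {t : ℂ} {x : Fin n → ℂ} (hp : (t, x) ∈ D) :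
    eulerT (fuchsInv l f) t x = l * fuchsInv l f t x + f t x := by
  obtain ⟨hint', hder⟩ := hasFDerivAt_fuchsInv hl hD hstar hf hp
  have hl0 : l ≠ 0 := by rintro rfl; simp at hl
  have hmem : ∀ ρ ∈ Set.Icc (0 : ℝ) 1, ((ρ * t, x) : ℂ × (Fin n → ℂ)) ∈ D := fun ρ hρ => by
    have := hstar _ hp ρ hρ
    rwa [contractT_apply] at this
  set q : ℝ → ℂ := fun ρ => fderiv ℂ (Function.uncurry f) (ρ * t, x) (1, 0) with hq
  have hcont : ContinuousOn (fun ρ : ℝ => ((ρ * t, x) : ℂ × (Fin n → ℂ))) (Set.Icc 0 1) := by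
    fun_prop
  have hfc : ContinuousOn (fun ρ : ℝ => f (ρ * t) x) (Set.Icc 0 1) :=
    hf.continuousOn.comp hcont hmem
  have hqc : ContinuousOn q (Set.Icc 0 1) :=
    ContinuousOn.clm_apply (hf.fderiv.continuousOn.comp hcont hmem) continuousOn_const
  have hker := intervalIntegrable_kernel hl
  have hpc : Continuous fun ρ : ℝ => (ρ : ℂ) ^ (-l) := by
    refine continuous_iff_continuousAt.2 fun ρ =>
      Complex.continuousAt_ofReal_cpow_const ρ (-l) (Or.inl (by simpa using hl))
  -- the derivative in `t`
  have h1 : deriv (fun s => fuchsInv l f s x) t = ∫ ρ in (0 : ℝ)..1, (ρ : ℂ) ^ (-l) * q ρ := by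
    have e1 := hasDerivAt_time hder.differentiableAt
    rw [hder.fderiv, ContinuousLinearMap.intervalIntegral_apply hint'] at e1
    rw [e1.deriv]
    refine intervalIntegral.integral_congr_ae (ae_of_all _ fun ρ hρ => ?_)
    rw [Set.uIoc_of_le zero_le_one] at hρ
    have hρ0 : (ρ : ℂ) ≠ 0 := by exact_mod_cast hρ.1.ne'
    have e2 : (ρ : ℂ) ^ (-l) = (ρ : ℂ) ^ (-l - 1) * ρ := by
      conv_lhs => rw [show -l = (-l - 1) + 1 by ring]
      rw [Complex.cpow_add _ _ hρ0, Complex.cpow_one]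
    have e3 : ((ρ : ℂ) * 1, (0 : Fin n → ℂ)) = (ρ : ℂ) • ((1 : ℂ), (0 : Fin n → ℂ)) := by
      simp
    simp only [smul_apply, ContinuousLinearMap.comp_apply, contractT_apply]
    rw [e3, map_smul, smul_eq_mul, smul_eq_mul, e2]
    ring
  -- integration by parts
  have h2 : ∫ ρ in (0 : ℝ)..1, (-l * ((ρ : ℂ) ^ (-l - 1) * f (ρ * t) x) +
      t * ((ρ : ℂ) ^ (-l) * q ρ)) = f t x := by
    have hI1 : IntervalIntegrable (fun ρ : ℝ => -l * ((ρ : ℂ) ^ (-l - 1) * f (ρ * t) x))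
        volume 0 1 :=
      (hker.mul_continuousOn (by rwa [Set.uIcc_of_le zero_le_one])).const_mul _
    have hI2 : IntervalIntegrable (fun ρ : ℝ => t * ((ρ : ℂ) ^ (-l) * q ρ)) volume 0 1 := by
      refine ContinuousOn.intervalIntegrable ?_
      rw [Set.uIcc_of_le zero_le_one]
      exact continuousOn_const.mul (hpc.continuousOn.mul hqc)
    rw [intervalIntegral.integral_eq_sub_of_hasDerivAt_of_le
      (f := fun ρ : ℝ => (ρ : ℂ) ^ (-l) * f (ρ * t) x) zero_le_one
      (hpc.continuousOn.mul hfc) (fun ρ hρ => ?_) (hI1.add hI2)]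
    · simp [hl0]
    · have hρ' : ρ ∈ Set.Icc (0 : ℝ) 1 := Set.Ioo_subset_Icc_self hρ
      have d1 : HasDerivAt (fun ρ : ℝ => (ρ : ℂ) ^ (-l)) (-l * (ρ : ℂ) ^ (-l - 1)) ρ :=
        hasDerivAt_ofReal_cpow_const hρ.1.ne' (neg_ne_zero.2 hl0)
      have d2 : HasDerivAt (fun ρ : ℝ => f (ρ * t) x) (t * q ρ) ρ := by
        have e1 : HasDerivAt (fun s => f s x) (q ρ) ((ρ : ℂ) * t) :=
          hasDerivAt_time (hf _ (hmem ρ hρ')).differentiableAt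
        have e2 : HasDerivAt (fun ρ : ℝ => (ρ : ℂ) * t) t ρ := by
          simpa using (Complex.ofRealCLM.hasDerivAt (x := ρ)).mul_const t
        exact (HasDerivAt.scomp ρ e1 e2 : _)
      exact (d1.fun_mul d2).congr_deriv (by ring)
  rw [intervalIntegral.integral_add, intervalIntegral.integral_const_mul,
    intervalIntegral.integral_const_mul, ← h1] at h2
  · show t * deriv (fun s => fuchsInv l f s x) t = _
    rw [← h2]
    show _ = l * (∫ ρ in (0 : ℝ)..1, (ρ : ℂ) ^ (-l - 1) * f (ρ * t) x) + _
    ring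
  · exact (hker.mul_continuousOn (by rwa [Set.uIcc_of_le zero_le_one])).const_mul _
  · refine ContinuousOn.intervalIntegrable ?_
    rw [Set.uIcc_of_le zero_le_one]
    exact continuousOn_const.mul (hpc.continuousOn.mul hqc)

/-- The holomorphic solution of `(t ∂/∂t - l₁) (t ∂/∂t - l₂) v = f`. -/
noncomputable def fuchsSolve (l₁ l₂ : ℂ) (f : ℂ → (Fin n → ℂ) → ℂ) : ℂ → (Fin n → ℂ) → ℂ :=
  fuchsInv l₂ (fuchsInv l₁ f)

theorem analyticOnNhd_fuchsSolve {l₁ l₂ : ℂ} (hl₁ : l₁.re < 0) (hl₂ : l₂.re < 0) (hD : IsOpen D)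
    (hstar : IsStarT D) (hf : AnalyticOnNhd ℂ (Function.uncurry f) D) :
    AnalyticOnNhd ℂ (Function.uncurry (fuchsSolve l₁ l₂ f)) D :=
  analyticOnNhd_fuchsInv hl₂ hD hstar (analyticOnNhd_fuchsInv hl₁ hD hstar hf)

theorem eulerT_eulerT_fuchsSolve {l₁ l₂ : ℂ} (hl₁ : l₁.re < 0) (hl₂ : l₂.re < 0) (hD : IsOpen D)
    (hstar : IsStarT D) (hf : AnalyticOnNhd ℂ (Function.uncurry f) D) {t : ℂ} {x : Fin n → ℂ}
    (hp : (t, x) ∈ D) : eulerT (eulerT (fuchsSolve l₁ l₂ f)) t x =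
      (l₁ + l₂) * eulerT (fuchsSolve l₁ l₂ f) t x + -(l₁ * l₂) * fuchsSolve l₁ l₂ f t x +
        f t x := by
  have hg := analyticOnNhd_fuchsInv hl₁ hD hstar hf
  have hv := analyticOnNhd_fuchsSolve hl₁ hl₂ hD hstar hf
  have h1 : Set.EqOn (Function.uncurry (eulerT (fuchsSolve l₁ l₂ f))) (Function.uncurry fun t x =>
      l₂ * fuchsSolve l₁ l₂ f t x + fuchsInv l₁ f t x) D := fun p hp =>
    eulerT_fuchsInv hl₂ hD hstar hg (t := p.1) (x := p.2) hp
  have h2 : eulerT (eulerT (fuchsSolve l₁ l₂ f)) t x = eulerT (fun t x =>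
      l₂ * fuchsSolve l₁ l₂ f t x + fuchsInv l₁ f t x) t x :=
    timeField_congr hD h1 id hp
  have h3 : eulerT (fun t x => l₂ * fuchsSolve l₁ l₂ f t x + fuchsInv l₁ f t x) t x =
      l₂ * eulerT (fuchsSolve l₁ l₂ f) t x + eulerT (fuchsInv l₁ f) t x := by
    have d1 := (hasDerivAt_time (hv _ hp).differentiableAt).differentiableAt
    have d2 := (hasDerivAt_time (hg _ hp).differentiableAt).differentiableAt
    simp only [eulerT]
    rw [deriv_fun_add (d1.const_mul l₂) d2, deriv_const_mul _ d1]
    ring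
  have h4 : eulerT (fuchsSolve l₁ l₂ f) t x = l₂ * fuchsSolve l₁ l₂ f t x + fuchsInv l₁ f t x :=
    h1 hp
  rw [h2, h3, eulerT_fuchsInv hl₁ hD hstar hf hp]
  linear_combination (-l₁) * h4

end FuchsInverse

/-! ### Cone estimates for the linear solution operator. -/

section Existence

variable {n : ℕ}

/-- The set of `(t, x)` with `c |t| < (R - |x|)⁴`, `|x| < R`. -/
def coneDomain (n : ℕ) (R c : ℝ) : Set (ℂ × (Fin n → ℂ)) :=
  {p | ‖p.2‖ < R ∧ c * ‖p.1‖ < (R - ‖p.2‖) ^ 4}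

theorem isOpen_coneDomain (R c : ℝ) : IsOpen (coneDomain n R c) := by
  have h1 : IsOpen {p : ℂ × (Fin n → ℂ) | ‖p.2‖ < R} := isOpen_lt (by fun_prop) (by fun_prop)
  have h2 : IsOpen {p : ℂ × (Fin n → ℂ) | c * ‖p.1‖ < (R - ‖p.2‖) ^ 4} :=
    isOpen_lt (by fun_prop) (by fun_prop)
  exact h1.inter h2

theorem coneDomain_mono {R c c' : ℝ} (h : c ≤ c') : coneDomain n R c' ⊆ coneDomain n R c :=
  fun p hp => ⟨hp.1, (mul_le_mul_of_nonneg_right h (norm_nonneg p.1)).trans_lt hp.2⟩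

theorem isStarT_coneDomain {R c : ℝ} (hc : 0 ≤ c) : IsStarT (coneDomain n R c) := by
  intro p hp ρ hρ
  rw [contractT_apply]
  refine ⟨hp.1, lt_of_le_of_lt ?_ hp.2⟩
  simp only [norm_mul, Complex.norm_real, Real.norm_of_nonneg hρ.1]
  gcongr
  exact mul_le_of_le_one_left (norm_nonneg _) hρ.2

theorem hasDerivAt_ray {v : ℂ → (Fin n → ℂ) → ℂ} {s φ : ℝ} {x : Fin n → ℂ}
    (hv : DifferentiableAt ℂ (Function.uncurry v) (Complex.exp (s + φ * Complex.I), x)) :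
    HasDerivAt (fun s : ℝ => v (Complex.exp (s + φ * Complex.I)) x)
      (eulerT v (Complex.exp (s + φ * Complex.I)) x) s := by
  have h1 : HasDerivAt (fun τ : ℂ => v (Complex.exp τ) x)
      (eulerT v (Complex.exp (s + φ * Complex.I)) x) (s + φ * Complex.I) := by
    rw [← eulerLog_comp_exp hv]
    exact ((hasDerivAt_time hv).comp _ (Complex.hasDerivAt_exp _)).differentiableAt.hasDerivAt
  exact (h1.comp_add_const (s : ℂ) (φ * Complex.I)).comp_ofReal

variable {l₁ l₂ : ℂ} {R c L : ℝ} {f₁ f₂ : ℂ → (Fin n → ℂ) → ℂ}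

/-- Both solutions are bounded near t = 0, being holomorphic there, so on the ray through t their
difference is the bounded solution of the linear system and the weighted comparison estimate
applies. -/
theorem norm_fuchsSolve_sub_le (hl₁ : l₁.re < 0) (hl₂ : l₂.re < 0) (hc : 0 < c) (hL : 0 ≤ L)
    (hf₁ : AnalyticOnNhd ℂ (Function.uncurry f₁) (coneDomain n R c))
    (hf₂ : AnalyticOnNhd ℂ (Function.uncurry f₂) (coneDomain n R c))
    (hff : ∀ t x, (t, x) ∈ coneDomain n R c →
      ‖f₁ t x - f₂ t x‖ ≤ L * ‖t‖ / coneWeight R (c * ‖t‖) x ^ 3)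
    {t : ℂ} {x : Fin n → ℂ} (hp : (t, x) ∈ coneDomain n R c) :
    ‖fuchsSolve l₁ l₂ f₁ t x - fuchsSolve l₁ l₂ f₂ t x‖ ≤
        (1 + ‖l₂‖) * L * ‖t‖ / coneWeight R (c * ‖t‖) x ∧
      ‖eulerT (fuchsSolve l₁ l₂ f₁) t x - eulerT (fuchsSolve l₁ l₂ f₂) t x‖ ≤
        (1 + ‖l₂‖) * L * ‖t‖ / coneWeight R (c * ‖t‖) x ^ 2 := by
  have hD := isOpen_coneDomain (n := n) R c
  have hstar := isStarT_coneDomain (n := n) (R := R) hc.le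
  have hu₁ := analyticOnNhd_fuchsSolve hl₁ hl₂ hD hstar hf₁
  have hu₂ := analyticOnNhd_fuchsSolve hl₁ hl₂ hD hstar hf₂
  -- No ray reaches t = 0; there the hypothesis forces f₁ = f₂, and the integrals see only these
  -- values.
  rcases eq_or_ne t 0 with rfl | ht
  · have h0 : f₁ 0 x = f₂ 0 x := by
      have := hff 0 x hp
      simp only [norm_zero, mul_zero, zero_div] at this
      exact sub_eq_zero.1 (norm_le_zero_iff.1 this)
    simp [fuchsSolve, fuchsInv, eulerT, h0]
  have hd : 0 < R - ‖x‖ := sub_pos.2 hp.1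
  have hd4 : 0 < (R - ‖x‖) ^ 4 := by positivity
  set φ := Complex.arg t with hφ
  have htexp : Complex.exp (Real.log ‖t‖ + φ * Complex.I) = t := by
    have : Complex.log t = Real.log ‖t‖ + φ * Complex.I := rfl
    rw [← this, Complex.exp_log ht]
  have hexp : Real.exp (Real.log ‖t‖) = ‖t‖ := Real.exp_log (norm_pos_iff.2 ht)
  set s₁ := Real.log ((R - ‖x‖) ^ 4 / c) with hs₁
  have hlog : ∀ s : ℝ, s < s₁ ↔ c * Real.exp s < (R - ‖x‖) ^ 4 := by
    intro s
    rw [hs₁, Real.lt_log_iff_exp_lt (by positivity), lt_div_iff₀ hc, mul_comm]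
  have hmem : ∀ s < s₁, (Complex.exp (s + φ * Complex.I), x) ∈ coneDomain n R c := by
    intro s hs
    refine ⟨hp.1, ?_⟩
    show c * ‖Complex.exp (s + φ * Complex.I)‖ < _
    rw [norm_exp_ray]
    exact (hlog s).1 hs
  have hw : ∀ s, coneWeight R (c * Real.exp s) x = 1 - c / (R - ‖x‖) ^ 4 * Real.exp s :=
    fun s => by rw [coneWeight]; ring
  have hcpt : IsCompact (Metric.closedBall (0 : ℂ) ‖t‖ ×ˢ ({x} : Set (Fin n → ℂ))) :=
    (isCompact_closedBall _ _).prod isCompact_singleton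
  have hsub : Metric.closedBall (0 : ℂ) ‖t‖ ×ˢ ({x} : Set (Fin n → ℂ)) ⊆ coneDomain n R c := by
    rintro ⟨t', x'⟩ ⟨ht', hx'⟩
    rw [Set.mem_singleton_iff] at hx'
    simp only at hx'
    subst hx'
    rw [mem_closedBall_zero_iff] at ht'
    exact ⟨hp.1, (mul_le_mul_of_nonneg_left ht' hc.le).trans_lt hp.2⟩
  have hbd : ∀ v : ℂ → (Fin n → ℂ) → ℂ, AnalyticOnNhd ℂ (Function.uncurry v) (coneDomain n R c) →
      ∃ M, ∀ s < Real.log ‖t‖, ‖v (Complex.exp (s + φ * Complex.I)) x‖ ≤ M := by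
    intro v hv
    obtain ⟨M, hM⟩ := hcpt.exists_bound_of_continuousOn (hv.continuousOn.mono hsub)
    refine ⟨M, fun s hs => hM (_, x) ⟨?_, rfl⟩⟩
    rw [mem_closedBall_zero_iff]
    show ‖Complex.exp (s + φ * Complex.I)‖ ≤ _
    rw [norm_exp_ray, ← hexp]
    exact (Real.exp_lt_exp.2 hs).le
  have key := norm_le_of_system_of_norm_le_weight hl₁ hl₂ (s₁ := s₁)
    (A := fun s : ℝ => fuchsSolve l₁ l₂ f₁ (Complex.exp (s + φ * Complex.I)) x -
      fuchsSolve l₁ l₂ f₂ (Complex.exp (s + φ * Complex.I)) x)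
    (B := fun s : ℝ => eulerT (fuchsSolve l₁ l₂ f₁) (Complex.exp (s + φ * Complex.I)) x -
      eulerT (fuchsSolve l₁ l₂ f₂) (Complex.exp (s + φ * Complex.I)) x)
    (f := fun s : ℝ => f₁ (Complex.exp (s + φ * Complex.I)) x -
      f₂ (Complex.exp (s + φ * Complex.I)) x) (κ := c / (R - ‖x‖) ^ 4) (L := L)
    (fun s hs => (hasDerivAt_ray (hu₁ _ (hmem s hs)).differentiableAt).fun_sub
      (hasDerivAt_ray (hu₂ _ (hmem s hs)).differentiableAt))
    (fun s hs => by
      have e1 := hasDerivAt_ray ((hu₁.eulerT hD) _ (hmem s hs)).differentiableAt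
      have e2 := hasDerivAt_ray ((hu₂.eulerT hD) _ (hmem s hs)).differentiableAt
      rw [eulerT_eulerT_fuchsSolve hl₁ hl₂ hD hstar hf₁ (hmem s hs)] at e1
      rw [eulerT_eulerT_fuchsSolve hl₁ hl₂ hD hstar hf₂ (hmem s hs)] at e2
      exact (e1.fun_sub e2).congr_deriv (by ring))
    (by
      obtain ⟨M₁, h1⟩ := hbd _ hu₁
      obtain ⟨M₂, h2⟩ := hbd _ hu₂
      obtain ⟨M₃, h3⟩ := hbd _ (hu₁.eulerT hD)
      obtain ⟨M₄, h4⟩ := hbd _ (hu₂.eulerT hD)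
      exact ⟨max (M₁ + M₂) (M₃ + M₄), Real.log ‖t‖, fun s hs =>
        ⟨(norm_sub_le _ _).trans ((add_le_add (h1 s hs) (h2 s hs)).trans (le_max_left _ _)),
        (norm_sub_le _ _).trans ((add_le_add (h3 s hs) (h4 s hs)).trans (le_max_right _ _))⟩⟩)
    (by positivity) hL
    (fun s hs => by
      rw [div_mul_eq_mul_div, div_lt_one hd4]
      exact (hlog s).1 hs)
    (fun s hs => by
      rw [← hw]
      have := hff _ x (hmem s hs)
      rwa [norm_exp_ray] at this)
    (s := Real.log ‖t‖) ((hlog _).2 (by rw [hexp]; exact hp.2))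
  simp only [htexp] at key
  rwa [← hw, hexp] at key

/-- The spatial jet of the solution of `(t ∂/∂t - l₁) (t ∂/∂t - l₂) v = f`. -/
noncomputable def solveJet (l₁ l₂ : ℂ) (f : ℂ → (Fin n → ℂ) → ℂ) (t : ℂ) (x : Fin n → ℂ) :
    Idx n → ℂ :=
  spatialJet (fuchsSolve l₁ l₂ f t) (eulerT (fuchsSolve l₁ l₂ f) t) x

theorem solveJet_zero (t : ℂ) (x : Fin n → ℂ) : solveJet l₁ l₂ (fun _ _ => 0) t x = 0 := by
  have h1 : fuchsSolve l₁ l₂ (fun _ (_ : Fin n → ℂ) => 0) = fun _ _ => 0 := by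
    ext t x
    simp [fuchsSolve, fuchsInv]
  have h2 : eulerT (fun _ (_ : Fin n → ℂ) => 0) = fun _ _ => 0 := by
    ext t x
    simp [eulerT]
  rw [solveJet, h1, h2, spatialJet_zero_zero]

theorem analyticOnNhd_solveJet (hl₁ : l₁.re < 0) (hl₂ : l₂.re < 0) (hc : 0 ≤ c)
    (hf₁ : AnalyticOnNhd ℂ (Function.uncurry f₁) (coneDomain n R c)) :
    AnalyticOnNhd ℂ (Function.uncurry (solveJet l₁ l₂ f₁)) (coneDomain n R c) := by
  have hD := isOpen_coneDomain (n := n) R c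
  have hu := analyticOnNhd_fuchsSolve hl₁ hl₂ hD (isStarT_coneDomain hc) hf₁
  exact analyticOnNhd_spatialJet hD hu (hu.eulerT hD)

theorem norm_solveJet_sub_le (hl₁ : l₁.re < 0) (hl₂ : l₂.re < 0) (hR : R ≤ 1) (hc : 0 < c)
    (hL : 0 ≤ L)
    (hf₁ : AnalyticOnNhd ℂ (Function.uncurry f₁) (coneDomain n R c))
    (hf₂ : AnalyticOnNhd ℂ (Function.uncurry f₂) (coneDomain n R c))
    (hff : ∀ t x, (t, x) ∈ coneDomain n R c →
      ‖f₁ t x - f₂ t x‖ ≤ L * ‖t‖ / coneWeight R (c * ‖t‖) x ^ 3)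
    {t : ℂ} {x : Fin n → ℂ} (hp : (t, x) ∈ coneDomain n R c) :
    ‖solveJet l₁ l₂ f₁ t x - solveJet l₁ l₂ f₂ t x‖ ≤ 65536 * ((1 + ‖l₂‖) * L * ‖t‖) /
        ((R - ‖x‖) ^ 2 * coneWeight R (c * ‖t‖) x ^ 3) ∧
      lowNorm (solveJet l₁ l₂ f₁ t x - solveJet l₁ l₂ f₂ t x) ≤
        (1 + ‖l₂‖) * L * ‖t‖ / coneWeight R (c * ‖t‖) x ^ 3 := by
  have hD := isOpen_coneDomain (n := n) R c
  have hu₁ := analyticOnNhd_fuchsSolve hl₁ hl₂ hD (isStarT_coneDomain hc.le) hf₁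
  have hu₂ := analyticOnNhd_fuchsSolve hl₁ hl₂ hD (isStarT_coneDomain hc.le) hf₂
  have hy : 0 ≤ c * ‖t‖ := by positivity
  have hx : x ∈ coneSlice n R (c * ‖t‖) := hp
  have hw0 := coneWeight_pos hx
  have hw1 := coneWeight_le_one (R := R) hy x
  have hsol : ∀ x ∈ coneSlice n R (c * ‖t‖), _ := fun x hx =>
    norm_fuchsSolve_sub_le hl₁ hl₂ hc hL hf₁ hf₂ hff (t := t) (x := x) hx
  have hw23 : (1 + ‖l₂‖) * L * ‖t‖ / coneWeight R (c * ‖t‖) x ^ 2 ≤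
      (1 + ‖l₂‖) * L * ‖t‖ / coneWeight R (c * ‖t‖) x ^ 3 := by
    have := pow_le_pow_of_le_one hw0.le hw1 (show 2 ≤ 3 by norm_num)
    gcongr
  have hw13 : (1 + ‖l₂‖) * L * ‖t‖ / coneWeight R (c * ‖t‖) x ≤
      (1 + ‖l₂‖) * L * ‖t‖ / coneWeight R (c * ‖t‖) x ^ 3 := by
    have := pow_le_of_le_one hw0.le hw1 (show 3 ≠ 0 by norm_num)
    gcongr
  have hsl : ∀ {v : ℂ → (Fin n → ℂ) → ℂ},
      AnalyticOnNhd ℂ (Function.uncurry v) (coneDomain n R c) →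
      AnalyticOnNhd ℂ (v t) (coneSlice n R (c * ‖t‖)) := fun hv =>
    (hv.slice t).mono fun x hx => hx
  exact ⟨norm_spatialJet_sub_le hR hy (by positivity) (hsl hu₁) (hsl (hu₁.eulerT hD)) (hsl hu₂)
      (hsl (hu₂.eulerT hD)) (fun x hx => (hsol x hx).1) (fun x hx => (hsol x hx).2) hx,
    lowNorm_spatialJet_sub_le ((hsol x hx).1.trans hw13) ((hsol x hx).2.trans hw23)⟩

end Existence

/-! ### Existence by successive approximation on shrinking cones. -/

section Picard

variable {n : ℕ} {Ω : Set (ℂ × (Fin n → ℂ) × (Idx n → ℂ))}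
  {F : ℂ × (Fin n → ℂ) × (Idx n → ℂ) → ℂ} {l₁ l₂ : ℂ} {r C R c M : ℝ}

/-- Successive approximations to the nonlinear part of the equation along the solution. -/
noncomputable def picardSeq (F : ℂ × (Fin n → ℂ) × (Idx n → ℂ) → ℂ) (l₁ l₂ : ℂ) :
    ℕ → ℂ → (Fin n → ℂ) → ℂ
  | 0 => fun _ _ => 0
  | k + 1 => fun t x => reducedF F (t, x, solveJet l₁ l₂ (picardSeq F l₁ l₂ k) t x)

/-- The apertures of the shrinking cones for the successive approximations. -/
noncomputable def picardAperture (c : ℝ) (k : ℕ) : ℝ := c * (2 - (1 / 2) ^ k)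

theorem le_picardAperture (hc : 0 ≤ c) (k : ℕ) : c ≤ picardAperture c k := by
  have : ((1 : ℝ) / 2) ^ k ≤ 1 := pow_le_one₀ (by norm_num) (by norm_num)
  unfold picardAperture
  nlinarith

theorem picardAperture_le (hc : 0 ≤ c) (k : ℕ) : picardAperture c k ≤ 2 * c := by
  have : (0 : ℝ) ≤ (1 / 2) ^ k := by positivity
  unfold picardAperture
  nlinarith

theorem picardAperture_succ (c : ℝ) (k : ℕ) :
    picardAperture c (k + 1) = picardAperture c k + c * (1 / 2) ^ (k + 1) := by
  unfold picardAperture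
  rw [pow_succ]
  ring

/-- On a narrower cone the weight of a wider one is bounded below. -/
theorem le_coneWeight_of_mem {c' q : ℝ} (hq1 : q ≤ 1) (hq : c ≤ c' * (1 - q)) {t : ℂ}
    {x : Fin n → ℂ} (hp : (t, x) ∈ coneDomain n R c') : q ≤ coneWeight R (c * ‖t‖) x := by
  have hd : 0 < R - ‖x‖ := sub_pos.2 hp.1
  have hd4 : 0 < (R - ‖x‖) ^ 4 := by positivity
  have h1 : c' * ‖t‖ < (R - ‖x‖) ^ 4 := hp.2
  have h2 : c * ‖t‖ / (R - ‖x‖) ^ 4 ≤ 1 - q := by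
    rw [div_le_iff₀ hd4]
    calc c * ‖t‖ ≤ c' * (1 - q) * ‖t‖ := by gcongr
      _ = (1 - q) * (c' * ‖t‖) := by ring
      _ ≤ (1 - q) * (R - ‖x‖) ^ 4 := mul_le_mul_of_nonneg_left h1.le (by linarith)
  unfold coneWeight
  linarith

/-- A large aperture makes c|t| < d⁴ ≤ d², so jets of size M|t|/d² stay in the region where the
bounds on `reducedF` hold. -/
theorem norm_lt_of_mem_coneDomain (hR1 : R ≤ 1) (hM : 0 ≤ M) (hc : 0 < c) (hcM : 1 + M ≤ c * r)
    {t : ℂ} {x : Fin n → ℂ} (hp : (t, x) ∈ coneDomain n R c) :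
    ‖t‖ < r ∧ M * ‖t‖ / (R - ‖x‖) ^ 2 < r := by
  have hd : 0 < R - ‖x‖ := sub_pos.2 hp.1
  have hd1 : R - ‖x‖ ≤ 1 := by linarith [norm_nonneg x]
  have h1 : c * ‖t‖ < (R - ‖x‖) ^ 4 := hp.2
  have h2 : (R - ‖x‖) ^ 4 ≤ 1 := pow_le_one₀ hd.le hd1
  have h3 : (R - ‖x‖) ^ 4 ≤ (R - ‖x‖) ^ 2 := pow_le_pow_of_le_one hd.le hd1 (by norm_num)
  have hd2 : 0 < (R - ‖x‖) ^ 2 := by positivity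
  constructor
  · nlinarith
  · rw [div_lt_iff₀ hd2]
    refine lt_of_mul_lt_mul_left ?_ hc.le
    calc c * (M * ‖t‖) = M * (c * ‖t‖) := by ring
      _ ≤ M * (R - ‖x‖) ^ 2 := by gcongr; linarith
      _ < (c * r) * (R - ‖x‖) ^ 2 := by gcongr; linarith
      _ = c * (r * (R - ‖x‖) ^ 2) := by ring

theorem analyticOnNhd_reducedF_solveJet (hF : IsFuchsian Ω F) (hΩ : ∀ t x z, ‖t‖ < r → ‖x‖ < r →
      ‖z‖ < r → (t, x, z) ∈ Ω) (hl₁ : l₁.re < 0) (hl₂ : l₂.re < 0) (hRr : R ≤ r) (hc : 0 ≤ c)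
    {f : ℂ → (Fin n → ℂ) → ℂ} (hf : AnalyticOnNhd ℂ (Function.uncurry f) (coneDomain n R c))
    {D : Set (ℂ × (Fin n → ℂ))} (hD : D ⊆ coneDomain n R c)
    (hDr : ∀ t x, (t, x) ∈ D → ‖t‖ < r ∧ ‖solveJet l₁ l₂ f t x‖ < r) :
    AnalyticOnNhd ℂ (Function.uncurry fun t x => reducedF F (t, x, solveJet l₁ l₂ f t x)) D := by
  have h1 : AnalyticOnNhd ℂ (fun p : ℂ × (Fin n → ℂ) => (p.1, p.2, solveJet l₁ l₂ f p.1 p.2)) D :=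
    analyticOnNhd_fst.prod (analyticOnNhd_snd.prod
      ((analyticOnNhd_solveJet hl₁ hl₂ hc hf).mono hD))
  exact hF.analyticOnNhd_reducedF.comp h1 fun p hp => hΩ _ _ _ (hDr p.1 p.2 hp).1
    (lt_of_lt_of_le (hD hp).1 hRr) (hDr p.1 p.2 hp).2

/-- The estimates for the successive approximations. -/
structure PicardBounds (F : ℂ × (Fin n → ℂ) × (Idx n → ℂ) → ℂ) (l₁ l₂ : ℂ) (R c C M : ℝ) (k : ℕ) :
    Prop where
  analytic : AnalyticOnNhd ℂ (Function.uncurry (picardSeq F l₁ l₂ k))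
    (coneDomain n R (picardAperture c k))
  analytic_succ : AnalyticOnNhd ℂ (Function.uncurry (picardSeq F l₁ l₂ (k + 1)))
    (coneDomain n R (picardAperture c k))
  norm_solveJet_le : ∀ t x, (t, x) ∈ coneDomain n R (picardAperture c k) →
    ‖solveJet l₁ l₂ (picardSeq F l₁ l₂ k) t x‖ ≤
      M * (1 - (1 / 2) ^ k) * ‖t‖ / (R - ‖x‖) ^ 2
  norm_sub_le : ∀ t x, (t, x) ∈ coneDomain n R (picardAperture c k) →
    ‖picardSeq F l₁ l₂ (k + 1) t x - picardSeq F l₁ l₂ k t x‖ ≤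
      C * (1 / 32) ^ k * ‖t‖ / coneWeight R (picardAperture c k * ‖t‖) x ^ 3

/-- The contraction needs each jet bounded by M|t|/d², but the estimate for a jet increment blows up
at the edge of its cone. Narrowing the cone at stage k by a relative amount of order 2⁻ᵏ gives w ≥
2⁻⁽ᵏ⁺²⁾ there; the loss w⁻³ of order 8ᵏ is beaten by the gain 32⁻ᵏ, so the increments are summable.
The constant M is chosen so that they add up to at most M|t|/d². -/
theorem picardBounds (hF : IsFuchsian Ω F) (hH : HasReducedBounds F l₁ l₂ r C)
    (hΩ : ∀ t x z, ‖t‖ < r → ‖x‖ < r → ‖z‖ < r → (t, x, z) ∈ Ω) (hRr : R ≤ r)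
    (hRC : 64 * (C * R * (1 + ‖l₂‖)) ≤ 1) (hM : M = 65536 * (1 + ‖l₂‖) * 128 * C) (hc : 0 < c)
    (hcC : 64 * (C * (1 + M) * 65536 * (1 + ‖l₂‖)) ≤ c) (hcM : 1 + M ≤ c * r) (k : ℕ) :
    PicardBounds F l₁ l₂ R c C M k := by
  have hC := hH.C_pos
  have hR1 : R ≤ 1 := hRr.trans hH.r_le_one
  have hM0 : 0 ≤ M := by rw [hM]; positivity
  induction k with
  | zero =>
    have ha : picardAperture c 0 = c := by simp [picardAperture]; ring
    have hz : ∀ t x, solveJet l₁ l₂ (picardSeq F l₁ l₂ 0) t x = 0 := solveJet_zero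
    have hz0 : AnalyticOnNhd ℂ (Function.uncurry (picardSeq F l₁ l₂ 0))
        (coneDomain n R (picardAperture c 0)) := fun _ _ => analyticAt_const
    refine ⟨hz0, ?_, ?_, ?_⟩
    · refine analyticOnNhd_reducedF_solveJet hF hΩ hH.re₁ hH.re₂ hRr (hc.le.trans ha.ge) hz0
        subset_rfl fun t x hp => ⟨?_, ?_⟩
      · rw [ha] at hp
        exact (norm_lt_of_mem_coneDomain hR1 hM0 hc hcM hp).1
      · rw [hz, norm_zero]
        exact hH.r_pos
    · intro t x _
      simp [hz]
    · intro t x hp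
      rw [ha] at hp ⊢
      have hw0 := coneWeight_pos (n := n) (x := x) hp
      have hw1 := coneWeight_le_one (R := R) (show 0 ≤ c * ‖t‖ by positivity) x
      have h1 : picardSeq F l₁ l₂ (0 + 1) t x - picardSeq F l₁ l₂ 0 t x = reducedF F (t, x, 0) := by
        simp [picardSeq, solveJet_zero]
      rw [h1, pow_zero, mul_one]
      exact (hH.norm_le t x (norm_lt_of_mem_coneDomain hR1 hM0 hc hcM hp).1
        (lt_of_lt_of_le hp.1 hRr)).trans
          (le_div_self (by positivity) (by positivity) (pow_le_one₀ hw0.le hw1))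
  | succ k ih =>
    set a := picardAperture c k with ha
    set a' := picardAperture c (k + 1) with ha'
    have hca : c ≤ a := le_picardAperture hc.le k
    have haa : a' = a + c * (1 / 2) ^ (k + 1) := picardAperture_succ c k
    have hpk : (0 : ℝ) < (1 / 2) ^ k := by positivity
    have hpk1 : (1 / 2 : ℝ) ^ k ≤ 1 := pow_le_one₀ (by norm_num) (by norm_num)
    have haa' : a ≤ a' := by rw [haa]; nlinarith [pow_succ (1 / 2 : ℝ) k]
    have ha2 : a' ≤ 2 * c := picardAperture_le hc.le (k + 1)
    have ha0 : 0 < a := hc.trans_le hca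
    have hsub : coneDomain n R a' ⊆ coneDomain n R a := coneDomain_mono haa'
    have hdiff := fun t x (hp : (t, x) ∈ coneDomain n R a) =>
      norm_solveJet_sub_le hH.re₁ hH.re₂ hR1 ha0 (by positivity) ih.analytic_succ ih.analytic
        ih.norm_sub_le hp
    have hJ : ∀ t x, (t, x) ∈ coneDomain n R a' → ‖solveJet l₁ l₂ (picardSeq F l₁ l₂ (k + 1)) t x‖ ≤
        M * (1 - (1 / 2) ^ (k + 1)) * ‖t‖ / (R - ‖x‖) ^ 2 := by
      intro t x hp
      have hd : 0 < R - ‖x‖ := sub_pos.2 hp.1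
      have hω : (1 / 2) ^ (k + 2) ≤ coneWeight R (a * ‖t‖) x := by
        refine le_coneWeight_of_mem (pow_le_one₀ (by norm_num) (by norm_num)) ?_ hp
        have : a' * (1 / 2) ^ (k + 2) ≤ 2 * c * (1 / 2) ^ (k + 2) := by gcongr
        have e : 2 * c * (1 / 2) ^ (k + 2) = c * (1 / 2) ^ (k + 1) := by ring
        linarith
      have h1 := (hdiff t x (hsub hp)).1
      have h2 := ih.norm_solveJet_le t x (hsub hp)
      have h3 : 65536 * ((1 + ‖l₂‖) * (C * (1 / 32) ^ k) * ‖t‖) /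
          ((R - ‖x‖) ^ 2 * coneWeight R (a * ‖t‖) x ^ 3) ≤
            M * (1 / 2) ^ (k + 1) * ‖t‖ / (R - ‖x‖) ^ 2 := by
        calc _ ≤ 65536 * ((1 + ‖l₂‖) * (C * (1 / 32) ^ k) * ‖t‖) /
              ((R - ‖x‖) ^ 2 * ((1 / 2) ^ (k + 2)) ^ 3) := by gcongr
          _ = M * ((1 / 2) * (1 / 4) ^ k) * ‖t‖ / (R - ‖x‖) ^ 2 := by
            have e : ((1 / 2 : ℝ) ^ (k + 2)) ^ 3 = (1 / 64) * (1 / 8) ^ k := by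
              rw [← pow_mul, mul_comm, pow_mul, pow_add]; norm_num; ring
            have e2 : ((1 : ℝ) / 32) ^ k = (1 / 4) ^ k * (1 / 8) ^ k := by
              rw [← mul_pow]; norm_num
            rw [e, e2, hM]
            have : ((1 : ℝ) / 8) ^ k ≠ 0 := by positivity
            field_simp
            ring
          _ ≤ M * (1 / 2) ^ (k + 1) * ‖t‖ / (R - ‖x‖) ^ 2 := by
            have e : (1 / 2 : ℝ) ^ (k + 1) = 1 / 2 * (1 / 2) ^ k := by rw [pow_succ, mul_comm]
            rw [e]
            gcongr
            norm_num
      calc _ ≤ ‖solveJet l₁ l₂ (picardSeq F l₁ l₂ (k + 1)) t x -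
            solveJet l₁ l₂ (picardSeq F l₁ l₂ k) t x‖ + _ := norm_le_norm_sub_add _ _
        _ ≤ _ := add_le_add (h1.trans h3) h2
        _ = _ := by rw [pow_succ]; ring
    have hle : ∀ t x, (t, x) ∈ coneDomain n R a' → ∀ q : ℝ, 0 ≤ q →
        M * (1 - q) * ‖t‖ / (R - ‖x‖) ^ 2 ≤ M * ‖t‖ / (R - ‖x‖) ^ 2 := by
      intro t x hp q hq
      have hd : 0 < R - ‖x‖ := sub_pos.2 hp.1
      gcongr
      exact mul_le_of_le_one_right hM0 (by linarith)
    have hr := fun t x (hp : (t, x) ∈ coneDomain n R a') =>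
      norm_lt_of_mem_coneDomain hR1 hM0 hc hcM (coneDomain_mono (hca.trans haa') hp)
    have hJ1 := fun t x (hp : (t, x) ∈ coneDomain n R a') =>
      (hJ t x hp).trans (hle t x hp ((1 / 2) ^ (k + 1)) (by positivity))
    have hJ0 := fun t x (hp : (t, x) ∈ coneDomain n R a') =>
      (ih.norm_solveJet_le t x (hsub hp)).trans (hle t x hp ((1 / 2) ^ k) (by positivity))
    refine ⟨ih.analytic_succ.mono hsub, ?_, hJ, fun t x hp => ?_⟩
    · exact analyticOnNhd_reducedF_solveJet hF hΩ hH.re₁ hH.re₂ hRr ha0.le ih.analytic_succ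
        hsub fun t x hp => ⟨(hr t x hp).1, (hJ1 t x hp).trans_lt (hr t x hp).2⟩
    · have hw0 : 0 < coneWeight R (a * ‖t‖) x := coneWeight_pos (n := n) (x := x) (hsub hp)
      have hw0' : 0 < coneWeight R (a' * ‖t‖) x := coneWeight_pos (n := n) (x := x) hp
      have hd : 0 < R - ‖x‖ := sub_pos.2 hp.1
      have hww : coneWeight R (a' * ‖t‖) x ≤ coneWeight R (a * ‖t‖) x := by
        unfold coneWeight
        gcongr
      have h1 := hH.norm_sub_le_of_cone hM0 (norm_nonneg t) (L := C * (1 / 32) ^ k)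
        (by positivity) (by positivity) hw0 hcC hc hRC hR1 rfl hp.1 (hr t x hp).1
        (lt_of_lt_of_le hp.1 hRr) ((hJ1 t x hp).trans_lt (hr t x hp).2)
        ((hJ0 t x hp).trans_lt (hr t x hp).2)
        (coneDomain_mono (hca.trans haa') hp).2.le (hJ1 t x hp) (hJ0 t x hp)
        (hdiff t x (hsub hp)).1 (hdiff t x (hsub hp)).2
      calc _ ≤ C * (1 / 32) ^ k / 32 * ‖t‖ / coneWeight R (a * ‖t‖) x ^ 3 := h1
        _ = C * (1 / 32) ^ (k + 1) * ‖t‖ / coneWeight R (a * ‖t‖) x ^ 3 := by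
          rw [pow_succ]; ring
        _ ≤ _ := by gcongr


theorem IsFuchsian.exists_isLocalSolution (hF : IsFuchsian Ω F) (hH : HasReducedBounds F l₁ l₂ r C)
    (hΩ : ∀ t x z, ‖t‖ < r → ‖x‖ < r → ‖z‖ < r → (t, x, z) ∈ Ω) :
    ∃ v : ℂ → (Fin n → ℂ) → ℂ, IsLocalSolution Ω F v := by
  have hC := hH.C_pos
  have hr := hH.r_pos
  set κ := 1 + ‖l₂‖ with hκ
  have hκ0 : 0 < κ := by positivity
  obtain ⟨R, hR0, hRr, hRC⟩ : ∃ R : ℝ, 0 < R ∧ R ≤ r ∧ 64 * (C * R * κ) ≤ 1 := by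
    refine ⟨min r (1 / (64 * (C * κ))), lt_min hr (by positivity), min_le_left _ _, ?_⟩
    have h := min_le_right r (1 / (64 * (C * κ)))
    rw [le_div_iff₀ (by positivity)] at h
    linarith
  set M := 65536 * κ * 128 * C with hM
  have hM0 : 0 ≤ M := by positivity
  set c := max (64 * (C * (1 + M) * 65536 * κ)) ((1 + M) / r) with hc
  have hcC : 64 * (C * (1 + M) * 65536 * κ) ≤ c := le_max_left _ _
  have hcM : 1 + M ≤ c * r := (div_le_iff₀ hr).1 (le_max_right _ _)
  have hc0 : 0 < c := lt_of_lt_of_le (by positivity) hcC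
  have hR1 : R ≤ 1 := hRr.trans hH.r_le_one
  have hP := picardBounds hF hH hΩ hRr hRC hM hc0 hcC hcM
  set f := picardSeq F l₁ l₂ with hf
  -- All apertures stay below 2c, so on the cone of aperture 4c every weight is at least 1/2 and the
  -- convergence is uniform.
  set D := coneDomain n R (4 * c) with hD
  have hDopen : IsOpen D := isOpen_coneDomain R (4 * c)
  have h4c : 0 < 4 * c := by positivity
  have hsub : ∀ k, D ⊆ coneDomain n R (picardAperture c k) := fun k =>
    coneDomain_mono ((picardAperture_le hc0.le k).trans (by linarith))
  have htr : ∀ t x, (t, x) ∈ D → ‖t‖ < r ∧ M * ‖t‖ / (R - ‖x‖) ^ 2 < r := fun t x hp =>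
    norm_lt_of_mem_coneDomain hR1 hM0 hc0 hcM (coneDomain_mono (by linarith) hp)
  have hstep : ∀ k t x, (t, x) ∈ D →
      ‖f (k + 1) t x - f k t x‖ ≤ 8 * C * ‖t‖ * (1 / 32) ^ k := by
    intro k t x hp
    have h1 : 1 / 2 ≤ coneWeight R (picardAperture c k * ‖t‖) x :=
      le_coneWeight_of_mem (by norm_num) (by linarith [picardAperture_le hc0.le k]) hp
    calc _ ≤ C * (1 / 32) ^ k * ‖t‖ / coneWeight R (picardAperture c k * ‖t‖) x ^ 3 :=
          (hP k).norm_sub_le t x (hsub k hp)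
      _ ≤ C * (1 / 32) ^ k * ‖t‖ / (1 / 2) ^ 3 := by gcongr
      _ = _ := by ring
  have hgeom : Summable fun k : ℕ => ((1 : ℝ) / 32) ^ k :=
    summable_geometric_of_lt_one (by norm_num) (by norm_num)
  set g : ℂ → (Fin n → ℂ) → ℂ := fun t x => ∑' k, (f (k + 1) t x - f k t x) with hg
  have hlim : ∀ t x, (t, x) ∈ D → Tendsto (fun k => f k t x) atTop (𝓝 (g t x)) := by
    intro t x hp
    have hs : Summable fun k => f (k + 1) t x - f k t x :=
      Summable.of_norm_bounded (hgeom.mul_left _) fun k => hstep k t x hp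
    have h1 := hs.hasSum.tendsto_sum_nat
    have h0 : f 0 t x = 0 := rfl
    simpa only [Finset.sum_range_sub (fun k => f k t x), h0, sub_zero] using h1
  have hclose : ∀ k t x, (t, x) ∈ D → ‖g t x - f k t x‖ ≤ 16 * C * (1 / 32) ^ k * ‖t‖ := by
    intro k t x hp
    have h1 := dist_le_of_le_geometric_of_tendsto (1 / 32) (8 * C * ‖t‖) (by norm_num)
      (f := fun k => f k t x) (fun k => by
        rw [dist_comm, dist_eq_norm]
        exact hstep k t x hp) (hlim t x hp) k
    rw [dist_comm, dist_eq_norm] at h1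
    refine h1.trans ?_
    have : 0 ≤ C * ‖t‖ * (1 / 32) ^ k := by positivity
    rw [div_le_iff₀ (by norm_num)]
    nlinarith
  have hgan : AnalyticOnNhd ℂ (Function.uncurry g) D := by
    refine analyticOnNhd_tsum (f := fun k p => f (k + 1) p.1 p.2 - f k p.1 p.2)
      hDopen (hgeom.mul_left (8 * C * r)) (fun k => ?_)
      fun k p hp => ?_
    · exact ((hP k).analytic_succ.mono (hsub k)).sub ((hP k).analytic.mono (hsub k))
    · refine (hstep k p.1 p.2 hp).trans ?_
      have := (htr p.1 p.2 hp).1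
      gcongr
  have hJlim : ∀ t x, (t, x) ∈ D →
      Tendsto (fun k => solveJet l₁ l₂ (f k) t x) atTop (𝓝 (solveJet l₁ l₂ g t x)) := by
    intro t x hp
    have hw : 0 < coneWeight R (4 * c * ‖t‖) x := coneWeight_pos (n := n) (x := x) hp
    rw [tendsto_iff_norm_sub_tendsto_zero]
    have hz : Tendsto (fun k : ℕ => 65536 * (κ * (16 * C * (1 / 32) ^ k) * ‖t‖) /
        ((R - ‖x‖) ^ 2 * coneWeight R (4 * c * ‖t‖) x ^ 3)) atTop (𝓝 (65536 * (κ * (16 * C * 0) * ‖t‖) /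
        ((R - ‖x‖) ^ 2 * coneWeight R (4 * c * ‖t‖) x ^ 3))) :=
      (((((tendsto_pow_atTop_nhds_zero_of_lt_one (by norm_num) (by norm_num)).const_mul
        _).const_mul _).mul_const _).const_mul _).div_const _
    simp only [mul_zero, zero_mul, zero_div] at hz
    refine squeeze_zero (fun _ => norm_nonneg _) (fun k => ?_) hz
    rw [norm_sub_rev]
    refine (norm_solveJet_sub_le hH.re₁ hH.re₂ hR1 h4c (by positivity) hgan
      ((hP k).analytic.mono (hsub k)) (fun t x hp => ?_) hp).1
    have hw0 : 0 < coneWeight R (4 * c * ‖t‖) x := coneWeight_pos (n := n) (x := x) hp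
    have hw1 := coneWeight_le_one (R := R) (show 0 ≤ 4 * c * ‖t‖ by positivity) x
    exact (hclose k t x hp).trans
      (le_div_self (by positivity) (by positivity) (pow_le_one₀ hw0.le hw1))
  have hJr : ∀ t x, (t, x) ∈ D → ‖solveJet l₁ l₂ g t x‖ < r := by
    intro t x hp
    refine lt_of_le_of_lt (le_of_tendsto' (hJlim t x hp).norm fun k => ?_) (htr t x hp).2
    have hd : 0 < R - ‖x‖ := sub_pos.2 hp.1
    refine ((hP k).norm_solveJet_le t x (hsub k hp)).trans ?_
    have : (0 : ℝ) ≤ (1 / 2) ^ k := by positivity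
    gcongr
    exact mul_le_of_le_one_right hM0 (by linarith)
  have hmem : ∀ t x, (t, x) ∈ D → (t, x, solveJet l₁ l₂ g t x) ∈ Ω := fun t x hp =>
    hΩ _ _ _ (htr t x hp).1 (lt_of_lt_of_le hp.1 hRr) (hJr t x hp)
  -- The iteration runs on the right-hand side, so its limit g is the nonlinear part evaluated along
  -- the solution with forcing g.
  have hfix : ∀ t x, (t, x) ∈ D → g t x = reducedF F (t, x, solveJet l₁ l₂ g t x) := by
    intro t x hp
    have h1 : Tendsto (fun k => ((t, x, solveJet l₁ l₂ (f k) t x) :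
        ℂ × (Fin n → ℂ) × (Idx n → ℂ))) atTop (𝓝 (t, x, solveJet l₁ l₂ g t x)) :=
      tendsto_const_nhds.prodMk_nhds (tendsto_const_nhds.prodMk_nhds (hJlim t x hp))
    have h2 := (hF.analyticOnNhd_reducedF _ (hmem t x hp)).continuousAt.tendsto.comp h1
    exact tendsto_nhds_unique ((tendsto_add_atTop_iff_nat 1).2 (hlim t x hp)) h2
  have hstar := isStarT_coneDomain (n := n) (R := R) h4c.le
  have hu := analyticOnNhd_fuchsSolve hH.re₁ hH.re₂ hDopen hstar hgan
  have hjet : ∀ t x, (t, x) ∈ D → jet eulerT (fuchsSolve l₁ l₂ g) t x = solveJet l₁ l₂ g t x :=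
    fun t x hp => jet_eulerT_eq_spatialJet hDopen hu hp
  refine ⟨fuchsSolve l₁ l₂ g, D, hDopen, ?_, hu, fun t x hp => ?_, fun x hp => ?_⟩
  · refine ⟨by simpa using hR0, ?_⟩
    simp only [norm_zero, mul_zero, sub_zero]
    positivity
  · rw [hjet t x hp]
    refine ⟨hmem t x hp, ?_⟩
    have h1 := eulerT_eulerT_fuchsSolve hH.re₁ hH.re₂ hDopen hstar hgan hp
    rw [hfix t x hp] at h1
    exact h1.trans (hH.apply_spatialJet t x _ _).symm
  · have h0 : g 0 x = 0 := by
      have := hclose 0 0 x hp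
      simp only [norm_zero, mul_zero] at this
      have h1 : f 0 0 x = 0 := rfl
      rw [h1, sub_zero] at this
      exact norm_le_zero_iff.1 this
    exact fuchsInv_apply_zero (fuchsInv_apply_zero h0)

end Picard

/-! ### Uniqueness of the germ, and the theorem. -/

section Uniqueness

variable {n : ℕ} {Ω : Set (ℂ × (Fin n → ℂ) × (Idx n → ℂ))}
  {F : ℂ × (Fin n → ℂ) × (Idx n → ℂ) → ℂ} {l₁ l₂ : ℂ} {r C : ℝ}

theorem sectorBelow_mono {I : Set ℝ} {r r' : ℝ} (hr : r' ≤ r) : sectorBelow I r' ⊆ sectorBelow I r :=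
  fun _ hτ => ⟨hτ.1, lt_of_lt_of_le hτ.2 hr⟩

theorem IsSectorSolution.mono {I : Set ℝ} {r r' R R' : ℝ} {u : ℂ → (Fin n → ℂ) → ℂ}
    (hu : IsSectorSolution Ω F I r R u) (hr : r' ≤ r) (hR : R' ≤ R) :
    IsSectorSolution Ω F I r' R' u where
  holomorphic := hu.holomorphic.mono
    (Set.prod_mono (sectorBelow_mono hr) fun _ hx => lt_of_lt_of_le hx hR)
  mem τ hτ x hx := hu.mem τ (sectorBelow_mono hr hτ) x (lt_of_lt_of_le hx hR)
  eq τ hτ x hx := hu.eq τ (sectorBelow_mono hr hτ) x (lt_of_lt_of_le hx hR)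

/-- Both solutions, read in the coordinate log t, tend to zero on the sector with I = ℝ, so
uniqueness on sectors applies. Points with t ≠ 0 are reached by the principal logarithm, and at t =
0 both vanish. -/
theorem IsLocalSolution.eventuallyEq (hH : HasReducedBounds F l₁ l₂ r C)
    {v w : ℂ → (Fin n → ℂ) → ℂ} (hv : IsLocalSolution Ω F v) (hw : IsLocalSolution Ω F w) :
    Function.uncurry v =ᶠ[𝓝 (0, 0)] Function.uncurry w := by
  obtain ⟨ρ₁, hρ₁, hv0, hvs⟩ := hv.exists_isSectorSolution
  obtain ⟨ρ₂, hρ₂, hw0, hws⟩ := hw.exists_isSectorSolution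
  set ρ := min ρ₁ ρ₂ with hρ
  have hρ0 : 0 < ρ := lt_min hρ₁ hρ₂
  obtain ⟨hv1, hv2⟩ := hvs Set.univ isOpen_univ ρ (min_le_left _ _) hρ0
  obtain ⟨hw1, hw2⟩ := hws Set.univ isOpen_univ ρ (min_le_right _ _) hρ0
  obtain ⟨δ, hδ, heq⟩ := hv1.eq_of_isSmallAtZero hH isOpen_univ Set.univ_nonempty
    Set.ordConnected_univ hρ0 hw1 hρ0 le_rfl hv2 hw2
  have hmin : 0 < min ρ δ := lt_min hρ0 hδ
  filter_upwards [Metric.ball_mem_nhds ((0, 0) : ℂ × (Fin n → ℂ)) hmin] with p hp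
  have hp' : ‖p‖ < min ρ δ := mem_ball_zero_iff.1 hp
  have h1 : ‖p.1‖ < ρ := (norm_fst_le p).trans_lt (hp'.trans_le (min_le_left _ _))
  have h2 : ‖p.2‖ < min ρ δ := (norm_snd_le p).trans_lt hp'
  obtain ⟨t, x⟩ := p
  show v t x = w t x
  rcases eq_or_ne t 0 with rfl | ht
  · have h3 : ‖x‖ < ρ := h2.trans_le (min_le_left _ _)
    rw [hv0 x (h3.trans_le (min_le_left _ _)), hw0 x (h3.trans_le (min_le_right _ _))]
  · have := heq (Complex.log t) ⟨Set.mem_univ _, by rwa [Complex.exp_log ht]⟩ x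
      (h2.trans_le (min_le_right _ _))
    simpa only [Complex.exp_log ht] using this

end Uniqueness

theorem corollary1 {n : ℕ}
    (Ω : Set (ℂ × (Fin n → ℂ) × (Idx n → ℂ)))
    (F : ℂ × (Fin n → ℂ) × (Idx n → ℂ) → ℂ)
    (hF : IsFuchsian Ω F)
    (hexp : ∀ l : ℂ, IsCharExponent F 0 l → l.re < 0)
    (I : Set ℝ) (hIopen : IsOpen I) (hIne : I.Nonempty) (hIconn : I.OrdConnected)
    (r₀ R₀ : ℝ) (hr₀ : 0 < r₀) (hR₀ : 0 < R₀)
    (u : ℂ → (Fin n → ℂ) → ℂ)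
    (hu : IsSectorSolution Ω F I r₀ R₀ u)
    (R : ℝ) (hR : 0 < R) (hRR₀ : R ≤ R₀)
    (hsmall : Tendsto (fun τ => ⨆ x ∈ polydisc n R, ‖u τ x‖ₑ)
      (comap Complex.exp (𝓝 0) ⊓ 𝓟 (sector I)) (𝓝 0)) :
    ∃ u₀ : ℂ → (Fin n → ℂ) → ℂ,
      IsLocalSolution Ω F u₀ ∧
      (∀ v, IsLocalSolution Ω F v →
        Function.uncurry v =ᶠ[𝓝 (0, 0)] Function.uncurry u₀) ∧
      ∃ σ : ℝ, 0 < σ ∧ ∃ δ : ℝ, 0 < δ ∧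
        ∀ τ ∈ sectorBelow I σ, ∀ x ∈ polydisc n δ, u τ x = u₀ (Complex.exp τ) x := by
  obtain ⟨r, hr, hr1, C, hC, hΩ, hb, hL⟩ := hF.exists_lipschitz
  obtain ⟨l₁, l₂, h₁, h₂, hc₀, hc₁⟩ := exists_charExponents hexp
  have hH : HasReducedBounds F l₁ l₂ r C := ⟨h₁, h₂, hc₀, hc₁, hr, hr1, hC, hb, hL⟩
  obtain ⟨u₀, hu₀⟩ := hF.exists_isLocalSolution hH hΩ
  refine ⟨u₀, hu₀, fun v hv => hv.eventuallyEq hH hu₀, ?_⟩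
  obtain ⟨ρ, hρ, -, hsol⟩ := hu₀.exists_isSectorSolution
  -- One radius serves for both t and x, matching the form in which u₀ becomes a sector solution.
  set σ := min ρ (min r₀ R) with hσ
  have hσ0 : 0 < σ := lt_min hρ (lt_min hr₀ hR)
  have hσr : σ ≤ r₀ := (min_le_right _ _).trans (min_le_left _ _)
  have hσR : σ ≤ R := (min_le_right _ _).trans (min_le_right _ _)
  obtain ⟨hs, hsm⟩ := hsol I hIopen σ (min_le_left _ _) hσ0
  obtain ⟨δ, hδ, heq⟩ := (hu.mono hσr (hσR.trans hRR₀)).eq_of_isSmallAtZero hH hIopen hIne hIconn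
    hσ0 hs hσ0 le_rfl ((isSmallAtZero_of_tendsto hsmall).mono hσR) hsm
  exact ⟨σ, hσ0, δ, hδ, heq⟩
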